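/- Let $(M,D,J)$ be a CR 3-manifold: $M$ is a smooth 3-manifold, $D\subset TM$ is a smooth distribution of rank two with $[D,D]=TM$, and $J$ is a smooth endomorphism of $D$ with $J^2=-\mathrm{id}_D$. Let $SD\to M$ be the spherization of $D$, whose fiber over $x$ is the set of rays $(D_x\setminus\{0\})/\mathbb{R}^+$. A positive contact form is a smooth 1-form $\eta^3$ on $M$ with $D=\ker\eta^3$ and $d\eta^3(X,JX)>0$ for all nonzero $X\in D$. Given such a form, let $\langle X,Y\rangle=d\eta^3(X,JY)$ for $X,Y\in D$, and let $\pi:B\to M$ be the circle bundle whose points over $x$ are the linear isomorphisms $u=(u^1,u^2,u^3):T_xM\to\mathbb{R}^3$ with $u^3=\eta^3_x$, $(d\eta^3)_x=u^1\wedge u^2$ and $\langle\cdot,\cdot\rangle=[(u^1)^2+(u^2)^2]|_{D_x}$. Let $\omega=(\omega^1,\omega^2,\omega^3)$, $\omega_u=u\circ d\pi_u$, be the tautological 1-form on $B$, and let $h:B\to SD$ be the diffeomorphism $u\mapsto[u^{-1}e_1]$, $e_1=(1,0,0)$. There are a unique smooth 1-form $\alpha$ and unique smooth functions $a_1,a_2$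 on $B$ with $$d\omega^1=-\alpha\wedge\omega^2+a_1\,\omega^2\wedge\omega^3+a_2\,\omega^3\wedge\omega^1,\quad d\omega^2=\alpha\wedge\omega^1+a_2\,\omega^2\wedge\omega^3-a_1\,\omega^3\wedge\omega^1,\quad d\omega^3=\omega^1\wedge\omega^2,$$ and unique smooth functions $b_1,b_2,K$ on $B$ with $$d\alpha=b_1\,\omega^2\wedge\omega^3+b_2\,\omega^3\wedge\omega^1+K\,\omega^1\wedge\omega^2.$$ Put $\sigma=\tfrac43\alpha-\tfrac13K\omega^3$. Then $\mathrm g=\omega^1\cdot\omega^1+\omega^2\cdot\omega^2+\omega^3\cdot\sigma$, where $\cdot$ is the symmetric product of 1-forms, with $\theta\cdot\theta=\theta\otimes\theta$, is carried by $h$ to a smooth Lorentzian metric (signature $(3,1)$) on $SD$. The conformal class of this metric on $SD$ is independent of the choice of the positive contact form $\eta^3$. In fact, if $\mu:M\to\mathbb{R}$ is a smooth positive function, then $\mu\eta^3$ is again a positive contact form, and the metric it induces on $SD$ is the one induced by $\eta^3$ multiplied by (the pullback to $SD$ of) $\mu$. -/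

import Mathlib

open Set
open scoped Manifold ContDiff

noncomputable section

namespace FeffermanCR

/-! ### Differential forms and symmetric tensors on manifolds modelled on a normed space -/

section Tensors

variable (E : Type*) [NormedAddCommGroup E] [NormedSpace ℝ E]
  (N : Type*) [TopologicalSpace N] [ChartedSpace E N]

/-- Differential `1`-forms on `N` (no regularity). -/
abbrev OneForm : Type _ := ∀ x : N, TangentSpace 𝓘(ℝ, E) x →L[ℝ] ℝ

/-- Covariant `2`-tensors on `N` (no regularity). -/
abbrev TwoTensor : Type _ := ∀ x : N, LinearMap.BilinForm ℝ (TangentSpace 𝓘(ℝ, E) x)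

variable {E N}

/-- The derivative at the point `y` of the model space of the inverse of the preferred chart at
`x₀`. -/
def chartInvDeriv (x₀ : N) (y : E) :
    E →L[ℝ] TangentSpace 𝓘(ℝ, E) ((chartAt E x₀).symm y) :=
  (mfderiv 𝓘(ℝ, E) 𝓘(ℝ, E) (chartAt E x₀).symm y).comp
    ((NormedSpace.fromTangentSpace (𝕜 := ℝ) y).symm : E →L[ℝ] TangentSpace 𝓘(ℝ, E) y)

/-- The derivative at `x` of the preferred chart at `x`. -/
def chartDeriv (x : N) : TangentSpace 𝓘(ℝ, E) x →L[ℝ] E :=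
  ((NormedSpace.fromTangentSpace (𝕜 := ℝ) (chartAt E x x)) :
    TangentSpace 𝓘(ℝ, E) (chartAt E x x) →L[ℝ] E).comp
    (mfderiv 𝓘(ℝ, E) 𝓘(ℝ, E) (chartAt E x) x)

/-- The expression of a `1`-form in the preferred chart at `x₀`, i.e. its pullback under the
inverse of that chart. -/
def OneForm.inChart (θ : OneForm E N) (x₀ : N) (y : E) : E →L[ℝ] ℝ :=
  (θ ((chartAt E x₀).symm y)).comp (chartInvDeriv x₀ y)

/-- Smooth `1`-forms. -/
def OneForm.IsSmooth (θ : OneForm E N) : Prop :=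
  ∀ x₀ : N, ContDiffOn ℝ ∞ (θ.inChart x₀) (chartAt E x₀).target

/-- The exterior derivative of a `1`-form, computed at `x` in the preferred chart at `x`:
`dθ(v, w) = ∂_v (θ w) - ∂_w (θ v)`. -/
def OneForm.d (θ : OneForm E N) : TwoTensor E N := fun x =>
  let B : LinearMap.BilinForm ℝ (TangentSpace 𝓘(ℝ, E) x) :=
    (fderiv ℝ (θ.inChart x) (chartAt E x x)).toLinearMap₁₂.compl₁₂
      (chartDeriv (E := E) x).toLinearMap
      (chartDeriv (E := E) x).toLinearMap
  B - B.flip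

/-- The tensor product `α ⊗ β` of `1`-forms. -/
def OneForm.tensor (α β : OneForm E N) : TwoTensor E N := fun x =>
  LinearMap.BilinForm.linMulLin
    (α x : TangentSpace 𝓘(ℝ, E) x →ₗ[ℝ] ℝ) (β x : TangentSpace 𝓘(ℝ, E) x →ₗ[ℝ] ℝ)

/-- The wedge product `(α ∧ β)(v, w) = α(v) β(w) - α(w) β(v)`. -/
def OneForm.wedge (α β : OneForm E N) : TwoTensor E N := α.tensor β - β.tensor α

/-- The symmetric product `α · β`, with `α · α = α ⊗ α`. -/
def OneForm.symmProd (α β : OneForm E N) : TwoTensor E N :=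
  fun x => (1 / 2 : ℝ) • (α.tensor β x + β.tensor α x)

/-- Smooth covariant `2`-tensors: all components in the preferred charts are smooth. -/
def TwoTensor.IsSmooth (g : TwoTensor E N) : Prop :=
  ∀ (x₀ : N) (v w : E), ContDiffOn ℝ ∞
    (fun y => g ((chartAt E x₀).symm y) (chartInvDeriv x₀ y v) (chartInvDeriv x₀ y w))
    (chartAt E x₀).target

/-- Smooth real functions. -/
def IsSmoothFun (f : N → ℝ) : Prop := ContMDiff 𝓘(ℝ, E) 𝓘(ℝ) ∞ f

/-- Smooth vector fields on an open set. -/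
def IsSmoothFieldOn (X : ∀ x : N, TangentSpace 𝓘(ℝ, E) x) (U : Set N) [IsManifold 𝓘(ℝ, E) 1 N] :
    Prop :=
  ContMDiffOn 𝓘(ℝ, E) 𝓘(ℝ, E).tangent ∞
    (fun x => (Bundle.TotalSpace.mk' E x (X x) : TangentBundle 𝓘(ℝ, E) N)) U

/-- A Lorentzian metric on a `4`-manifold: a smooth symmetric covariant `2`-tensor of
signature `(3, 1)` at every point. -/
structure TwoTensor.IsLorentzian (g : TwoTensor E N) : Prop where
  smooth : g.IsSmooth
  symm : ∀ x v w, g x v w = g x w v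
  signature : ∀ x, ∃ b : Module.Basis (Fin 4) ℝ (TangentSpace 𝓘(ℝ, E) x),
    ∀ i j, g x (b i) (b j) = if i = j then (if i = 3 then -1 else 1) else 0

end Tensors

/-- Euclidean `3`-space, the model of `3`-manifolds. -/
abbrev E3 : Type := EuclideanSpace ℝ (Fin 3)

/-- The model space of the circle bundles. -/
abbrev E4 : Type := E3 × ℝ

/-- A CR structure on a `3`-manifold `M`: a smooth contact distribution `D` of rank two,
`[D, D] = TM`, with a smooth complex structure `J` on `D`. -/
structure CRStructure (M : Type*) [TopologicalSpace M] [ChartedSpace E3 M]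
    [IsManifold 𝓘(ℝ, E3) ∞ M] where
  D : ∀ x : M, Submodule ℝ (TangentSpace 𝓘(ℝ, E3) x)
  finrank_D : ∀ x, Module.finrank ℝ (D x) = 2
  smooth_D : ∀ x, ∃ U : Set M, IsOpen U ∧ x ∈ U ∧ ∃ X Y : ∀ y : M, D y,
    IsSmoothFieldOn (fun y => (X y : TangentSpace 𝓘(ℝ, E3) y)) U ∧
    IsSmoothFieldOn (fun y => (Y y : TangentSpace 𝓘(ℝ, E3) y)) U ∧
    ∀ y ∈ U, LinearIndependent ℝ ![X y, Y y]
  contact : ∀ x, Submodule.span ℝ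
    {v | ∃ U : Set M, IsOpen U ∧ x ∈ U ∧ ∃ X Y : ∀ y : M, D y,
      IsSmoothFieldOn (fun y => (X y : TangentSpace 𝓘(ℝ, E3) y)) U ∧
      IsSmoothFieldOn (fun y => (Y y : TangentSpace 𝓘(ℝ, E3) y)) U ∧
      v = VectorField.mlieBracket 𝓘(ℝ, E3) (fun y => (X y : TangentSpace 𝓘(ℝ, E3) y))
        (fun y => (Y y : TangentSpace 𝓘(ℝ, E3) y)) x} = ⊤
  J : ∀ x, D x →ₗ[ℝ] D x
  J_sq : ∀ x v, J x (J x v) = -v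
  smooth_J : ∀ (U : Set M) (X : ∀ y : M, D y), IsOpen U →
    IsSmoothFieldOn (fun y => (X y : TangentSpace 𝓘(ℝ, E3) y)) U →
    IsSmoothFieldOn (fun y => (J y (X y) : TangentSpace 𝓘(ℝ, E3) y)) U

namespace CRStructure

variable {M : Type*} [TopologicalSpace M] [ChartedSpace E3 M] [IsManifold 𝓘(ℝ, E3) ∞ M]
  (C : CRStructure M)

/-! ### The spherization `SD` of the contact distribution -/

/-- The spherization of `D`: a point `x` of `M` with a ray in `D x`, i.e. a nonzero vector of
`D x` up to positive factors. -/
@[ext]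
structure Spherization where
  pt : M
  ray : Module.Ray ℝ (C.D pt)

lemma nontrivial_D (x : M) : Nontrivial (C.D x) :=
  Module.nontrivial_of_finrank_pos (R := ℝ) (by rw [C.finrank_D x]; norm_num)

open Classical in
/-- The ray spanned by `v` (an arbitrary ray if `v = 0`). -/
def mkRay (x : M) (v : C.D x) : Module.Ray ℝ (C.D x) :=
  if h : v ≠ 0 then rayOfNeZero ℝ v h else
    haveI := C.nontrivial_D x
    Classical.arbitrary _

lemma mkRay_of_ne {x : M} {v : C.D x} (h : v ≠ 0) : C.mkRay x v = rayOfNeZero ℝ v h := by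
  simp [mkRay, h]

lemma mkRay_eq_iff {x : M} {v w : C.D x} (hv : v ≠ 0) (hw : w ≠ 0) :
    C.mkRay x v = C.mkRay x w ↔ ∃ r : ℝ, 0 < r ∧ v = r • w := by
  rw [C.mkRay_of_ne hv, C.mkRay_of_ne hw, ray_eq_iff]
  constructor
  · intro h
    obtain ⟨r, hr, h⟩ := h.symm.exists_pos_left hw hv
    exact ⟨r, hr, h.symm⟩
  · rintro ⟨r, hr, rfl⟩
    exact SameRay.sameRay_pos_smul_left _ hr

lemma exists_mkRay (x : M) (r : Module.Ray ℝ (C.D x)) : ∃ v, v ≠ 0 ∧ r = C.mkRay x v := by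
  refine ⟨r.someVector, r.someVector_ne_zero, ?_⟩
  rw [C.mkRay_of_ne r.someVector_ne_zero, r.someVector_ray]

/-- A smooth frame `X, Y` of `D` over an open set contained in the domain of a preferred chart
of `M`. -/
structure Frame where
  base : M
  dom : Set M
  isOpen_dom : IsOpen dom
  dom_subset : dom ⊆ (chartAt E3 base).source
  X : ∀ x, C.D x
  Y : ∀ x, C.D x
  smooth_X : IsSmoothFieldOn (fun x => (X x : TangentSpace 𝓘(ℝ, E3) x)) dom
  smooth_Y : IsSmoothFieldOn (fun x => (Y x : TangentSpace 𝓘(ℝ, E3) x)) dom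
  indep : ∀ x ∈ dom, LinearIndependent ℝ ![X x, Y x]

namespace Frame

variable {C} (F G : C.Frame)

/-- The ray of `X + s Y` at `x`. -/
def point (x : M) (s : ℝ) : C.Spherization := ⟨x, C.mkRay x (F.X x + s • F.Y x)⟩

lemma indep' {x : M} (hx : x ∈ F.dom) {a b : ℝ} (h : a • F.X x + b • F.Y x = 0) :
    a = 0 ∧ b = 0 :=
  LinearIndependent.pair_iff.1 (F.indep x hx) a b h

lemma coord_inj {x : M} (hx : x ∈ F.dom) {a b a' b' : ℝ}
    (h : a • F.X x + b • F.Y x = a' • F.X x + b' • F.Y x) : a = a' ∧ b = b' := by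
  have := F.indep' hx (a := a - a') (b := b - b') (by
    rw [← sub_eq_zero] at h; rw [← h]; module)
  exact ⟨sub_eq_zero.1 this.1, sub_eq_zero.1 this.2⟩

lemma exists_coord {x : M} (hx : x ∈ F.dom) (v : C.D x) :
    ∃ a b : ℝ, v = a • F.X x + b • F.Y x := by
  have h := (F.indep x hx).span_eq_top_of_card_eq_finrank (by simp [C.finrank_D])
  have hv : v ∈ Submodule.span ℝ (range ![F.X x, F.Y x]) := by rw [h]; trivial
  rw [Matrix.range_cons, Matrix.range_cons, Matrix.range_empty, union_empty,
    singleton_union] at hv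
  obtain ⟨a, b, h⟩ := Submodule.mem_span_pair.1 hv
  exact ⟨a, b, h.symm⟩

lemma ne_zero {x : M} (hx : x ∈ F.dom) (s : ℝ) : F.X x + s • F.Y x ≠ 0 := by
  intro h
  have := F.indep' hx (a := 1) (b := s) (by simpa using h)
  exact one_ne_zero this.1

lemma point_inj {x : M} (hx : x ∈ F.dom) {s t : ℝ} (h : F.point x s = F.point x t) : s = t := by
  have h' : C.mkRay x (F.X x + s • F.Y x) = C.mkRay x (F.X x + t • F.Y x) := by
    simpa [point] using h
  obtain ⟨r, -, h⟩ := (C.mkRay_eq_iff (F.ne_zero hx s) (F.ne_zero hx t)).1 h'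
  obtain ⟨h1, h2⟩ := F.coord_inj hx (a := 1) (b := s) (a' := r) (b' := r * t) (by
    rw [one_smul, h]; module)
  rw [h2, ← h1, one_mul]

open Classical in
/-- The slope with respect to the frame of a ray of the form `[X + s Y]`. -/
def slope (r : C.Spherization) : ℝ :=
  if h : ∃ s, r = F.point r.pt s then h.choose else 0

lemma slope_point {x : M} (hx : x ∈ F.dom) (s : ℝ) : F.slope (F.point x s) = s := by
  have h : ∃ t, F.point x s = F.point (F.point x s).pt t := ⟨s, rfl⟩
  rw [slope, dif_pos h]
  exact F.point_inj hx h.choose_spec.symm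

/-- The coordinates of `SD` given by a frame `X, Y` of `D`: the ray `[X + s Y]` at `x` has as
coordinates the coordinates of `x` and the slope `s`. -/
def coords : PartialEquiv C.Spherization E4 where
  toFun r := (chartAt E3 F.base r.pt, F.slope r)
  invFun p := F.point ((chartAt E3 F.base).symm p.1) p.2
  source := {r | r.pt ∈ F.dom ∧ ∃ s, r = F.point r.pt s}
  target := {p | p.1 ∈ (chartAt E3 F.base).target ∧ (chartAt E3 F.base).symm p.1 ∈ F.dom}
  map_source' := by
    rintro r ⟨hr, -⟩
    refine ⟨(chartAt E3 F.base).map_source (F.dom_subset hr), ?_⟩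
    rw [(chartAt E3 F.base).left_inv (F.dom_subset hr)]
    exact hr
  map_target' := by
    rintro p ⟨-, h⟩
    exact ⟨h, _, rfl⟩
  left_inv' := by
    rintro r ⟨hr, s, hs⟩
    dsimp only
    rw [(chartAt E3 F.base).left_inv (F.dom_subset hr)]
    rw [hs]
    exact congrArg (F.point r.pt) (F.slope_point hr s)
  right_inv' := by
    rintro p ⟨h, h'⟩
    ext1
    · exact (chartAt E3 F.base).right_inv h
    · exact F.slope_point h' _

/-- Each ray lies in the coordinate domain of some frame. -/
lemma exists_mem_source (r : C.Spherization) : ∃ F : C.Frame, r ∈ F.coords.source := by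
  obtain ⟨U, hU, hxU, X, Y, hX, hY, hXY⟩ := C.smooth_D r.pt
  let F : C.Frame := ⟨r.pt, U ∩ (chartAt E3 r.pt).source,
    hU.inter (chartAt E3 r.pt).open_source, inter_subset_right, X, Y,
    hX.mono inter_subset_left, hY.mono inter_subset_left, fun x hx => hXY x hx.1⟩
  have hx : r.pt ∈ F.dom := ⟨hxU, mem_chart_source E3 r.pt⟩
  clear_value F
  obtain ⟨v, hv, hr⟩ := C.exists_mkRay r.pt r.ray
  obtain ⟨a, b, hab⟩ := F.exists_coord hx v
  have hne : a ^ 2 + b ^ 2 ≠ 0 := by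
    intro h
    have ha : a = 0 := by nlinarith
    have hb : b = 0 := by nlinarith
    exact hv (by rw [hab, ha, hb]; simp)
  have key : ∀ c d : ℝ, IsSmoothFieldOn (fun x => ((c • F.X x + d • F.Y x : C.D x) :
      TangentSpace 𝓘(ℝ, E3) x)) F.dom := by
    intro c d
    exact ((contMDiffOn_const (c := c)).smul_section F.smooth_X).add_section
      ((contMDiffOn_const (c := d)).smul_section F.smooth_Y)
  refine ⟨⟨F.base, F.dom, F.isOpen_dom, F.dom_subset, fun x => a • F.X x + b • F.Y x,
    fun x => (-b) • F.X x + a • F.Y x, key a b, key (-b) a, ?_⟩, hx, 0, ?_⟩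
  · intro x hx
    rw [LinearIndependent.pair_iff]
    intro s t h
    obtain ⟨h1, h2⟩ := F.indep' hx (a := s * a - t * b) (b := s * b + t * a) (by
      rw [← h]; module)
    constructor
    · have : s * (a ^ 2 + b ^ 2) = 0 := by linear_combination a * h1 + b * h2
      exact (mul_eq_zero.1 this).resolve_right hne
    · have : t * (a ^ 2 + b ^ 2) = 0 := by linear_combination -b * h1 + a * h2
      exact (mul_eq_zero.1 this).resolve_right hne
  · have h1 : r = ⟨r.pt, C.mkRay r.pt (a • F.X r.pt + b • F.Y r.pt)⟩ := by
      rw [← hab, ← hr]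
    have h2 : a • F.X r.pt + b • F.Y r.pt
        = a • F.X r.pt + b • F.Y r.pt + (0 : ℝ) • ((-b) • F.X r.pt + a • F.Y r.pt) := by
      rw [zero_smul, add_zero]
    rw [h2] at h1
    exact h1


/-- The coefficients with respect to a frame of a smooth field tangent to `D` are smooth. -/
lemma exists_smooth_coord {U : Set M} (hU : IsOpen U) (hUG : U ⊆ G.dom) (Z : ∀ x, C.D x)
    (hZ : IsSmoothFieldOn (fun x => (Z x : TangentSpace 𝓘(ℝ, E3) x)) U) :
    ∃ a b : M → ℝ, ContMDiffOn 𝓘(ℝ, E3) 𝓘(ℝ) ∞ a U ∧ ContMDiffOn 𝓘(ℝ, E3) 𝓘(ℝ) ∞ b U ∧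
      ∀ x ∈ U, Z x = a x • G.X x + b x • G.Y x := by
  let e := trivializationAt E3 (TangentSpace 𝓘(ℝ, E3) : M → Type _) G.base
  have hbase : e.baseSet = (chartAt E3 G.base).source := rfl
  have hUe : U ⊆ e.baseSet := fun x hx => G.dom_subset (hUG hx)
  let L : ∀ x : M, TangentSpace 𝓘(ℝ, E3) x →ₗ[ℝ] E3 := fun x => e.linearMapAt ℝ x
  have hL : ∀ x ∈ U, ∀ v, L x v = (e ⟨x, v⟩).2 := fun x hx v =>
    congrFun (e.coe_linearMapAt_of_mem (R := ℝ) (hUe hx)) v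
  have hinj : ∀ x ∈ U, ∀ v, L x v = 0 → v = 0 := by
    intro x hx v hv
    have := e.symmₗ_linearMapAt (R := ℝ) (hUe hx) v
    rw [← this]
    change e.symmₗ ℝ x (L x v) = 0
    rw [hv, map_zero]
  have sm : ∀ W : ∀ x, C.D x, IsSmoothFieldOn (fun x => (W x : TangentSpace 𝓘(ℝ, E3) x)) U →
      ContMDiffOn 𝓘(ℝ, E3) 𝓘(ℝ, E3) ∞ (fun x => L x (W x)) U := by
    intro W hW
    exact ((e.contMDiffOn_section_iff hU hUe).1 hW).congr fun x hx => hL x hx _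
  have hX := sm G.X (G.smooth_X.mono hUG)
  have hY := sm G.Y (G.smooth_Y.mono hUG)
  have hZ' := sm Z hZ
  have ip : ∀ {f g : M → E3}, ContMDiffOn 𝓘(ℝ, E3) 𝓘(ℝ, E3) ∞ f U →
      ContMDiffOn 𝓘(ℝ, E3) 𝓘(ℝ, E3) ∞ g U →
      ContMDiffOn 𝓘(ℝ, E3) 𝓘(ℝ) ∞ (fun x => inner ℝ (f x) (g x)) U := by
    intro f g hf hg
    exact (contDiff_inner (𝕜 := ℝ) (E := E3) (n := ∞)).contMDiff.comp_contMDiffOn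
      (hf.prodMk_space hg)
  let x₁ := fun x => L x (G.X x)
  let y₁ := fun x => L x (G.Y x)
  let z₁ := fun x => L x (Z x)
  let Δ : M → ℝ := fun x => inner ℝ (x₁ x) (x₁ x) * inner ℝ (y₁ x) (y₁ x)
    - inner ℝ (x₁ x) (y₁ x) * inner ℝ (x₁ x) (y₁ x)
  have hΔ : ∀ x ∈ U, Δ x ≠ 0 := by
    intro x hx h0
    have hy0 : (inner ℝ (y₁ x) (y₁ x) : ℝ) ≠ 0 := by
      intro h
      have h1 : (G.Y x : TangentSpace 𝓘(ℝ, E3) x) = 0 := hinj x hx _ (inner_self_eq_zero.1 h)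
      have h2 : G.Y x = 0 := Subtype.ext h1
      have := G.indep' (hUG hx) (a := 0) (b := 1) (by rw [h2]; simp)
      exact one_ne_zero this.2
    let w := (inner ℝ (y₁ x) (y₁ x) : ℝ) • x₁ x - (inner ℝ (x₁ x) (y₁ x) : ℝ) • y₁ x
    have hw : inner ℝ w w = inner ℝ (y₁ x) (y₁ x) * Δ x := by
      simp only [w, Δ, inner_sub_left, inner_sub_right, inner_smul_left, inner_smul_right,
        real_inner_comm (y₁ x) (x₁ x)]
      simp
      ring
    rw [h0, mul_zero] at hw
    have hw0 : w = 0 := inner_self_eq_zero.1 hw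
    have h1 : (((inner ℝ (y₁ x) (y₁ x) : ℝ) • G.X x + (-(inner ℝ (x₁ x) (y₁ x) : ℝ)) • G.Y x :
        C.D x) : TangentSpace 𝓘(ℝ, E3) x) = 0 := by
      apply hinj x hx
      rw [← hw0]
      simp only [Submodule.coe_add, Submodule.coe_smul, map_add, map_smul, neg_smul, w, x₁, y₁,
        sub_eq_add_neg, map_neg, Submodule.coe_neg]
    have := G.indep' (hUG hx) (Subtype.ext h1)
    exact hy0 this.1
  refine ⟨fun x => (inner ℝ (z₁ x) (x₁ x) * inner ℝ (y₁ x) (y₁ x)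
      - inner ℝ (z₁ x) (y₁ x) * inner ℝ (x₁ x) (y₁ x)) / Δ x,
    fun x => (inner ℝ (z₁ x) (y₁ x) * inner ℝ (x₁ x) (x₁ x)
      - inner ℝ (z₁ x) (x₁ x) * inner ℝ (x₁ x) (y₁ x)) / Δ x, ?_, ?_, ?_⟩
  · exact (((ip hZ' hX).mul (ip hY hY)).sub ((ip hZ' hY).mul (ip hX hY))).div₀
      (((ip hX hX).mul (ip hY hY)).sub ((ip hX hY).mul (ip hX hY))) hΔ
  · exact (((ip hZ' hY).mul (ip hX hX)).sub ((ip hZ' hX).mul (ip hX hY))).div₀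
      (((ip hX hX).mul (ip hY hY)).sub ((ip hX hY).mul (ip hX hY))) hΔ
  · intro x hx
    obtain ⟨a, b, hab⟩ := G.exists_coord (hUG hx) (Z x)
    have hz : z₁ x = a • x₁ x + b • y₁ x := by
      simp only [z₁, x₁, y₁, hab, Submodule.coe_add, Submodule.coe_smul, map_add, map_smul]
    have e1 : (inner ℝ (z₁ x) (x₁ x) : ℝ)
        = a * inner ℝ (x₁ x) (x₁ x) + b * inner ℝ (x₁ x) (y₁ x) := by
      rw [hz, inner_add_left, real_inner_smul_left, real_inner_smul_left,
        real_inner_comm (x₁ x) (y₁ x)]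
    have e2 : (inner ℝ (z₁ x) (y₁ x) : ℝ)
        = a * inner ℝ (x₁ x) (y₁ x) + b * inner ℝ (y₁ x) (y₁ x) := by
      rw [hz, inner_add_left, real_inner_smul_left, real_inner_smul_left]
    have ha : (inner ℝ (z₁ x) (x₁ x) * inner ℝ (y₁ x) (y₁ x)
      - inner ℝ (z₁ x) (y₁ x) * inner ℝ (x₁ x) (y₁ x)) / Δ x = a := by
      rw [div_eq_iff (hΔ x hx), e1, e2]; simp only [Δ]; ring
    have hb : (inner ℝ (z₁ x) (y₁ x) * inner ℝ (x₁ x) (x₁ x)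
      - inner ℝ (z₁ x) (x₁ x) * inner ℝ (x₁ x) (y₁ x)) / Δ x = b := by
      rw [div_eq_iff (hΔ x hx), e1, e2]; simp only [Δ]; ring
    dsimp only
    rw [ha, hb, ← hab]

/-- The set of coordinates with respect to `F` of the rays over the common domain. -/
def overlap : Set E4 :=
  {p | p.1 ∈ (chartAt E3 F.base).target ∩ (chartAt E3 F.base).symm ⁻¹' (F.dom ∩ G.dom)}

lemma isOpen_overlap : IsOpen (F.overlap G) :=
  ((chartAt E3 F.base).isOpen_inter_preimage_symm
    (F.isOpen_dom.inter G.isOpen_dom)).preimage continuous_fst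

lemma exists_transition : ∃ P Q : E4 → ℝ, ContDiffOn ℝ ∞ P (F.overlap G) ∧
    ContDiffOn ℝ ∞ Q (F.overlap G) ∧ ∀ p ∈ F.overlap G,
      F.X ((chartAt E3 F.base).symm p.1) + p.2 • F.Y ((chartAt E3 F.base).symm p.1)
      = P p • G.X ((chartAt E3 F.base).symm p.1) + Q p • G.Y ((chartAt E3 F.base).symm p.1) := by
  have hU := F.isOpen_dom.inter G.isOpen_dom
  obtain ⟨a, b, ha, hb, h1⟩ := G.exists_smooth_coord hU inter_subset_right F.X
    (F.smooth_X.mono inter_subset_left)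
  obtain ⟨c, d, hc, hd, h2⟩ := G.exists_smooth_coord hU inter_subset_right F.Y
    (F.smooth_Y.mono inter_subset_left)
  have key : ∀ f : M → ℝ, ContMDiffOn 𝓘(ℝ, E3) 𝓘(ℝ) ∞ f (F.dom ∩ G.dom) →
      ContDiffOn ℝ ∞ (fun p : E4 => f ((chartAt E3 F.base).symm p.1)) (F.overlap G) := by
    intro f hf
    have h : ContDiffOn ℝ ∞ (f ∘ (chartAt E3 F.base).symm)
        ((chartAt E3 F.base).target ∩ (chartAt E3 F.base).symm ⁻¹' (F.dom ∩ G.dom)) :=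
      contMDiffOn_iff_contDiffOn.1 (hf.comp'
        (contMDiffOn_chart_symm (I := 𝓘(ℝ, E3)) (x := F.base)))
    exact h.comp contDiff_fst.contDiffOn fun p hp => hp
  refine ⟨_, _, (key a ha).add (contDiff_snd.contDiffOn.mul (key c hc)),
    (key b hb).add (contDiff_snd.contDiffOn.mul (key d hd)), ?_⟩
  intro p hp
  rw [h1 _ hp.2, h2 _ hp.2]
  module

lemma transition_source {P Q : E4 → ℝ} (h : ∀ p ∈ F.overlap G,
      F.X ((chartAt E3 F.base).symm p.1) + p.2 • F.Y ((chartAt E3 F.base).symm p.1)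
      = P p • G.X ((chartAt E3 F.base).symm p.1) + Q p • G.Y ((chartAt E3 F.base).symm p.1)) :
    (F.coords.symm.trans G.coords).source = F.overlap G ∩ {p | 0 < P p} ∧
    ∀ p ∈ F.overlap G ∩ {p | 0 < P p}, F.coords.symm.trans G.coords p
      = (chartAt E3 G.base ((chartAt E3 F.base).symm p.1), Q p / P p) := by
  have key : ∀ p ∈ F.overlap G, ∀ s, F.point ((chartAt E3 F.base).symm p.1) p.2
      = G.point ((chartAt E3 F.base).symm p.1) s ↔ 0 < P p ∧ s = Q p / P p := by
    intro p hp s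
    have hG := G.ne_zero hp.2.2 s
    have hF := F.ne_zero hp.2.1 p.2
    have : F.point ((chartAt E3 F.base).symm p.1) p.2
      = G.point ((chartAt E3 F.base).symm p.1) s ↔
      C.mkRay _ (F.X ((chartAt E3 F.base).symm p.1) + p.2 • F.Y ((chartAt E3 F.base).symm p.1))
      = C.mkRay _ (G.X ((chartAt E3 F.base).symm p.1)
        + s • G.Y ((chartAt E3 F.base).symm p.1)) := by
      simp [point]
    rw [this, C.mkRay_eq_iff hF hG]
    rw [h p hp]
    constructor
    · rintro ⟨r, hr, hr'⟩
      obtain ⟨h1, h2⟩ := G.coord_inj hp.2.2 (a' := r) (b' := r * s)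
        (hr'.trans (by module))
      rw [h1, h2]
      exact ⟨hr, by field_simp⟩
    · rintro ⟨hP, rfl⟩
      refine ⟨P p, hP, ?_⟩
      rw [smul_add, smul_smul, mul_div_cancel₀ _ hP.ne']
  constructor
  · ext p
    rw [PartialEquiv.trans_source]
    constructor
    · rintro ⟨⟨h1, h2⟩, h3, s, hs⟩
      have hp : p ∈ F.overlap G := ⟨h1, h2, h3⟩
      exact ⟨hp, ((key p hp s).1 hs).1⟩
    · rintro ⟨hp, hP⟩
      exact ⟨⟨hp.1, hp.2.1⟩, hp.2.2, Q p / P p, (key p hp _).2 ⟨hP, rfl⟩⟩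
  · rintro p ⟨hp, hP⟩
    have h1 := (key p hp _).2 ⟨hP, rfl⟩
    change (chartAt E3 G.base ((chartAt E3 F.base).symm p.1),
      G.slope (F.point ((chartAt E3 F.base).symm p.1) p.2)) = _
    rw [h1, G.slope_point hp.2.2]

/-- The coordinate changes are smooth, with open domains. -/
lemma transition_smooth : IsOpen (F.coords.symm.trans G.coords).source ∧
    ContDiffOn ℝ ∞ (F.coords.symm.trans G.coords) (F.coords.symm.trans G.coords).source := by
  obtain ⟨P, Q, hP, hQ, h⟩ := F.exists_transition G
  obtain ⟨h1, h2⟩ := F.transition_source G h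
  rw [h1]
  refine ⟨hP.continuousOn.isOpen_inter_preimage (F.isOpen_overlap G) isOpen_Ioi, ?_⟩
  refine ContDiffOn.congr (ContDiffOn.prodMk ?_ ?_) h2
  · have h : ContDiffOn ℝ ∞ (chartAt E3 G.base ∘ (chartAt E3 F.base).symm)
        ((chartAt E3 F.base).target ∩ (chartAt E3 F.base).symm ⁻¹' (chartAt E3 G.base).source) :=
      contMDiffOn_iff_contDiffOn.1 ((contMDiffOn_chart (I := 𝓘(ℝ, E3)) (x := G.base)).comp'
        (contMDiffOn_chart_symm (I := 𝓘(ℝ, E3)) (x := F.base)))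
    exact h.comp contDiff_fst.contDiffOn fun p hp => ⟨hp.1.1, G.dom_subset hp.1.2.2⟩
  · exact (hQ.mono inter_subset_left).div (hP.mono inter_subset_left) fun p hp => ne_of_gt hp.2

end Frame

/-- The atlas of `SD` given by all frames of `D`. -/
def spherizationCore : ChartedSpaceCore E4 C.Spherization where
  atlas := range fun F : C.Frame => F.coords
  chartAt r := (Frame.exists_mem_source r).choose.coords
  mem_chart_source r := (Frame.exists_mem_source r).choose_spec
  chart_mem_atlas r := mem_range_self _
  open_source := by
    rintro _ _ ⟨F, rfl⟩ ⟨G, rfl⟩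
    exact (F.transition_smooth G).1
  continuousOn_toFun := by
    rintro _ _ ⟨F, rfl⟩ ⟨G, rfl⟩
    exact (F.transition_smooth G).2.continuousOn

instance : TopologicalSpace C.Spherization := C.spherizationCore.toTopologicalSpace

instance : ChartedSpace E4 C.Spherization := C.spherizationCore.toChartedSpace

instance : IsManifold 𝓘(ℝ, E4) ∞ C.Spherization := by
  apply isManifold_of_contDiffOn
  rintro e e' he he'
  have he : ∃ F : C.Frame, e.toPartialEquiv = F.coords := by
    obtain ⟨s, ⟨f, rfl⟩, t, ⟨⟨F, rfl⟩, rfl⟩, h⟩ := he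
    exact ⟨F, by rw [mem_singleton_iff.1 h]; rfl⟩
  have he' : ∃ F : C.Frame, e'.toPartialEquiv = F.coords := by
    obtain ⟨s, ⟨f, rfl⟩, t, ⟨⟨F, rfl⟩, rfl⟩, h⟩ := he'
    exact ⟨F, by rw [mem_singleton_iff.1 h]; rfl⟩
  obtain ⟨F, hF⟩ := he
  obtain ⟨G, hG⟩ := he'
  have h := (F.transition_smooth G).2
  rw [← hF, ← hG] at h
  simpa using h


end CRStructure

/-! ### Positive contact forms, adapted coframes and the circle bundle `B` -/

/-- A positive contact form of a CR structure: a smooth `1`-form `η` with `D = ker η` and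
`dη(X, JX) > 0` for all nonzero `X` in `D`. -/
structure PositiveContactForm {M : Type*} [TopologicalSpace M] [ChartedSpace E3 M]
    [IsManifold 𝓘(ℝ, E3) ∞ M] (C : CRStructure M) where
  form : OneForm E3 M
  smooth : form.IsSmooth
  mem_D_iff : ∀ x v, v ∈ C.D x ↔ form x v = 0
  pos : ∀ x (v : C.D x), v ≠ 0 → 0 < form.d x v (C.J x v)

/-- The coframe bundle `F*` of a `3`-manifold: a point `x` with a linear isomorphism
`T_x M → ℝ³`. -/
structure Coframe (M : Type*) [TopologicalSpace M] [ChartedSpace E3 M] where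
  pt : M
  map : TangentSpace 𝓘(ℝ, E3) pt ≃L[ℝ] (Fin 3 → ℝ)

lemma OneForm.d_swap {E N : Type*} [NormedAddCommGroup E] [NormedSpace ℝ E]
    [TopologicalSpace N] [ChartedSpace E N] (θ : OneForm E N) (x : N)
    (v w : TangentSpace 𝓘(ℝ, E) x) : θ.d x v w = - θ.d x w v := by
  simp [OneForm.d]

namespace PositiveContactForm

variable {M : Type*} [TopologicalSpace M] [ChartedSpace E3 M] [IsManifold 𝓘(ℝ, E3) ∞ M]
  {C : CRStructure M} (η : PositiveContactForm C)

/-- A coframe `u = (u¹, u², u³)` at `x` is adapted to the positive contact form `η` if `u³ = η`,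
`dη = u¹ ∧ u²` on `T_x M`, and the inner product `⟨v, w⟩ = dη(v, Jw)` on `D` is the restriction
of `(u¹)² + (u²)²`. -/
structure IsAdapted (u : Coframe M) : Prop where
  third : ∀ v, u.map v 2 = η.form u.pt v
  wedge : ∀ v w, η.form.d u.pt v w = u.map v 0 * u.map w 1 - u.map w 0 * u.map v 1
  metric : ∀ v w : C.D u.pt, η.form.d u.pt v (C.J u.pt w)
    = u.map v 0 * u.map w 0 + u.map v 1 * u.map w 1

/-- The circle bundle `B → M` of coframes adapted to `η`. -/
def CircleBundle : Type _ := {u : Coframe M // η.IsAdapted u}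

variable {η} in
/-- The projection `B → M`. -/
def CircleBundle.proj (u : η.CircleBundle) : M := u.1.pt

variable {η} in
/-- The vector `u⁻¹ e₁` of `D`, i.e. the vector `X` with `u¹(X) = 1`, `u²(X) = u³(X) = 0`. -/
def CircleBundle.firstVector (u : η.CircleBundle) : C.D u.1.pt :=
  ⟨u.1.map.symm (Pi.single 0 1), by
    rw [η.mem_D_iff, ← u.2.third, ContinuousLinearEquiv.apply_symm_apply]
    simp⟩

variable {η} in
lemma CircleBundle.map_firstVector (u : η.CircleBundle) :
    u.1.map (u.firstVector : TangentSpace 𝓘(ℝ, E3) u.1.pt) = Pi.single 0 1 :=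
  u.1.map.apply_symm_apply _

variable {η} in
lemma CircleBundle.firstVector_ne_zero (u : η.CircleBundle) : u.firstVector ≠ 0 := by
  intro h
  have := u.map_firstVector
  rw [h] at this
  simpa using congrFun this 0

/-- The map `h : B → SD`, `u ↦ [u⁻¹ e₁]`. -/
def toSpherization (u : η.CircleBundle) : C.Spherization :=
  ⟨u.1.pt, rayOfNeZero ℝ u.firstVector u.firstVector_ne_zero⟩

lemma d_self_J {x : M} (v : C.D x) :
    η.form.d x v v = 0 := by
  have := η.form.d_swap x v v
  linarith

/-- An adapted coframe is determined by its first vector. -/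
lemma map_eq_of_first {u : Coframe M} (hu : η.IsAdapted u) (v : C.D u.pt)
    (hv : u.map (v : TangentSpace 𝓘(ℝ, E3) u.pt) = Pi.single 0 1)
    (w : TangentSpace 𝓘(ℝ, E3) u.pt) :
    u.map w = ![η.form.d u.pt w (C.J u.pt v), η.form.d u.pt v w, η.form u.pt w] := by
  have h0 : u.map (v : TangentSpace 𝓘(ℝ, E3) u.pt) 0 = 1 := by rw [hv]; simp
  have h1 : u.map (v : TangentSpace 𝓘(ℝ, E3) u.pt) 1 = 0 := by rw [hv]; simp
  have e1 := hu.metric v v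
  have e2 := hu.wedge v (C.J u.pt v)
  have e3 := hu.metric v (C.J u.pt v)
  rw [C.J_sq] at e3
  rw [h0, h1] at e1 e2 e3
  have e4 : η.form.d u.pt v (-v : C.D u.pt) = 0 := by
    have := η.d_self_J v
    simp [this]
  rw [e4] at e3
  ext i
  fin_cases i
  · simp only [Fin.zero_eta, Matrix.cons_val_zero]
    rw [hu.wedge w, show u.map (C.J u.pt v : TangentSpace 𝓘(ℝ, E3) u.pt) 1 = 1 by linarith,
      show u.map (C.J u.pt v : TangentSpace 𝓘(ℝ, E3) u.pt) 0 = 0 by linarith]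
    ring
  · simp only [Fin.mk_one, Matrix.cons_val_one]
    rw [hu.wedge v w, h0, h1]
    simp
  · exact hu.third w

lemma exists_adapted {x : M} (v : C.D x) (hv : η.form.d x v (C.J x v) = 1) :
    ∃ u : TangentSpace 𝓘(ℝ, E3) x ≃L[ℝ] (Fin 3 → ℝ), η.IsAdapted ⟨x, u⟩ ∧
      u (v : TangentSpace 𝓘(ℝ, E3) x) = Pi.single 0 1 := by
  have hfr : Module.finrank ℝ (TangentSpace 𝓘(ℝ, E3) x) = 3 := finrank_euclideanSpace_fin
  have : FiniteDimensional ℝ (TangentSpace 𝓘(ℝ, E3) x) :=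
    Module.finite_of_finrank_pos (by rw [hfr]; norm_num)
  let Ω := η.form.d x
  have sw : ∀ a b, Ω a b = - Ω b a := η.form.d_swap x
  have self : ∀ a, Ω a a = 0 := fun a => by have := sw a a; linarith
  let j : C.D x := C.J x v
  have hvj : Ω v j = 1 := hv
  have hjv : Ω j v = -1 := by rw [sw, hvj]
  -- every vector of `D` is a combination of `v` and `Jv`
  have hD : ∀ w : C.D x, ∃ a b : ℝ, w = a • v + b • j := by
    have hind : LinearIndependent ℝ ![v, j] := by
      rw [LinearIndependent.pair_iff]
      intro s t h
      have h' : (s • (v : TangentSpace 𝓘(ℝ, E3) x) + t • (j : TangentSpace 𝓘(ℝ, E3) x)) = 0 :=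
        congrArg Subtype.val h
      have h1 : Ω v (s • (v : TangentSpace 𝓘(ℝ, E3) x) + t • (j : TangentSpace 𝓘(ℝ, E3) x)) = 0 := by
        rw [h', map_zero]
      have h2 : Ω j (s • (v : TangentSpace 𝓘(ℝ, E3) x) + t • (j : TangentSpace 𝓘(ℝ, E3) x)) = 0 := by
        rw [h', map_zero]
      simp only [map_add, map_smul, self, hvj, hjv, smul_eq_mul] at h1 h2
      constructor <;> linarith
    intro w
    have h := hind.span_eq_top_of_card_eq_finrank (by simp [C.finrank_D])
    have hw : w ∈ Submodule.span ℝ (range ![v, j]) := by rw [h]; trivial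
    rw [Matrix.range_cons, Matrix.range_cons, Matrix.range_empty, union_empty,
      singleton_union] at hw
    obtain ⟨a, b, h⟩ := Submodule.mem_span_pair.1 hw
    exact ⟨a, b, h.symm⟩
  obtain ⟨t, ht⟩ : ∃ t, η.form x t = 1 := by
    have : ∃ t, η.form x t ≠ 0 := by
      by_contra hcon
      push Not at hcon
      have : C.D x = ⊤ := by
        ext w; simp [η.mem_D_iff, hcon]
      have h2 := C.finrank_D x
      rw [this, finrank_top, hfr] at h2
      norm_num at h2
    obtain ⟨t, ht⟩ := this
    exact ⟨(η.form x t)⁻¹ • t, by simp [ht]⟩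
  have hT : ∀ w : TangentSpace 𝓘(ℝ, E3) x, ∃ a b c : ℝ,
      w = a • (v : TangentSpace 𝓘(ℝ, E3) x) + b • (j : TangentSpace 𝓘(ℝ, E3) x) + c • t := by
    intro w
    have hw : w - η.form x w • t ∈ C.D x := by
      rw [η.mem_D_iff]; simp [ht]
    obtain ⟨a, b, h⟩ := hD ⟨_, hw⟩
    refine ⟨a, b, η.form x w, ?_⟩
    have h' : w - η.form x w • t
      = a • (v : TangentSpace 𝓘(ℝ, E3) x) + b • (j : TangentSpace 𝓘(ℝ, E3) x) :=
        congrArg Subtype.val h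
    rw [← h']; abel
  let f : TangentSpace 𝓘(ℝ, E3) x →ₗ[ℝ] (Fin 3 → ℝ) :=
    LinearMap.pi ![Ω.flip j, Ω v, (η.form x).toLinearMap]
  have f0 : ∀ w, f w 0 = Ω w j := fun w => rfl
  have f1 : ∀ w, f w 1 = Ω v w := fun w => rfl
  have f2 : ∀ w, f w 2 = η.form x w := fun w => rfl
  have ff : ∀ a b : ℝ, f (a • (v : TangentSpace 𝓘(ℝ, E3) x)
      + b • (j : TangentSpace 𝓘(ℝ, E3) x)) 0 = a ∧ f (a • (v : TangentSpace 𝓘(ℝ, E3) x)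
      + b • (j : TangentSpace 𝓘(ℝ, E3) x)) 1 = b := by
    intro a b
    rw [f0, f1]
    simp [self, hvj]
  have hinj : Function.Injective f := by
    rw [← LinearMap.ker_eq_bot, LinearMap.ker_eq_bot']
    intro w hw
    have h2 : w ∈ C.D x := by rw [η.mem_D_iff, ← f2, hw]; rfl
    obtain ⟨a, b, h⟩ := hD ⟨w, h2⟩
    have h' : w = a • (v : TangentSpace 𝓘(ℝ, E3) x) + b • (j : TangentSpace 𝓘(ℝ, E3) x) :=
        congrArg Subtype.val h
    obtain ⟨ha, hb⟩ := ff a b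
    rw [← h', hw] at ha hb
    rw [h', ← ha, ← hb]; simp
  let e := LinearEquiv.ofInjectiveOfFinrankEq f hinj (by rw [hfr]; simp)
  have he : ∀ w, e w = f w := fun w => rfl
  have : T2Space (TangentSpace 𝓘(ℝ, E3) x) := inferInstanceAs (T2Space E3)
  refine ⟨e.toContinuousLinearEquiv, ⟨?_, ?_, ?_⟩, ?_⟩
  · intro w
    exact f2 w
  · intro w w'
    change Ω w w' = f w 0 * f w' 1 - f w' 0 * f w 1
    rw [f0, f1, f0, f1]
    obtain ⟨a, b, c, rfl⟩ := hT w
    obtain ⟨a', b', c', rfl⟩ := hT w'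
    simp only [map_add, map_smul, LinearMap.add_apply, LinearMap.smul_apply, smul_eq_mul, self,
      hvj, hjv, sw t v, sw t j]
    ring
  · intro w w'
    change Ω w (C.J x w') = f w 0 * f w' 0 + f w 1 * f w' 1
    obtain ⟨a, b, rfl⟩ := hD w
    obtain ⟨a', b', rfl⟩ := hD w'
    have hJ : C.J x (a' • v + b' • j) = a' • j - b' • v := by
      rw [map_add, map_smul, map_smul, C.J_sq]; simp only [j]; module
    rw [hJ]
    simp only [Submodule.coe_add, Submodule.coe_smul, Submodule.coe_sub]
    rw [(ff a b).1, (ff a b).2, (ff a' b').1, (ff a' b').2]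
    simp only [map_add, map_sub, map_smul, LinearMap.add_apply, LinearMap.smul_apply,
      smul_eq_mul, self, hvj, hjv]
    ring
  · change f v = _
    have := ff 1 0
    simp only [one_smul, zero_smul, add_zero] at this
    ext i
    fin_cases i
    · simpa using this.1
    · simpa using this.2
    · simpa [f2] using (η.mem_D_iff x v).1 v.2

lemma toSpherization_bijective : Function.Bijective η.toSpherization := by
  constructor
  · rintro ⟨⟨x, u⟩, hu⟩ ⟨⟨x', u'⟩, hu'⟩ h
    obtain rfl : x = x' := congrArg CRStructure.Spherization.pt h
    let U : η.CircleBundle := ⟨⟨x, u⟩, hu⟩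
    let U' : η.CircleBundle := ⟨⟨x, u'⟩, hu'⟩
    have hr : rayOfNeZero ℝ U.firstVector U.firstVector_ne_zero
        = rayOfNeZero ℝ U'.firstVector U'.firstVector_ne_zero := by
      simpa [toSpherization] using h
    rw [ray_eq_iff] at hr
    obtain ⟨r, hr, hrv⟩ := hr.exists_pos_left U.firstVector_ne_zero U'.firstVector_ne_zero
    have key : ∀ V : η.CircleBundle, η.form.d V.1.pt V.firstVector (C.J _ V.firstVector) = 1 := by
      intro V
      rw [V.2.metric, V.map_firstVector]
      simp
    have k1 : η.form.d x U.firstVector (C.J x U.firstVector) = 1 := key U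
    have k2 : η.form.d x U'.firstVector (C.J x U'.firstVector) = 1 := key U'
    have hv : r • U.firstVector = U'.firstVector := hrv
    rw [← hv, map_smul] at k2
    simp only [Submodule.coe_smul, map_smul, LinearMap.smul_apply, smul_eq_mul] at k2
    erw [k1] at k2
    have hr1 : r = 1 := by nlinarith
    rw [hr1, one_smul] at hv
    have huu : u = u' := by
      ext1; funext w
      have h1 := η.map_eq_of_first hu U.firstVector U.map_firstVector w
      have h2 := η.map_eq_of_first hu' U'.firstVector U'.map_firstVector w
      exact h1.trans ((by rw [← hv]) : _ = _) |>.trans h2.symm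
    subst huu
    rfl
  · rintro ⟨x, ray⟩
    obtain ⟨v, hv, rfl⟩ := C.exists_mkRay x ray
    have hp := η.pos x v hv
    set q := η.form.d x v (C.J x v) with hq
    let c := (Real.sqrt q)⁻¹
    have hc : 0 < c := inv_pos.2 (Real.sqrt_pos.2 hp)
    obtain ⟨u, hu, huv⟩ := η.exists_adapted (c • v) (by
      rw [map_smul]
      simp only [Submodule.coe_smul, map_smul, LinearMap.smul_apply, smul_eq_mul]
      rw [← hq, ← mul_assoc, ← mul_inv, Real.mul_self_sqrt hp.le, inv_mul_cancel₀ hp.ne'])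
    let U : η.CircleBundle := ⟨⟨x, u⟩, hu⟩
    refine ⟨U, ?_⟩
    have h1 : U.firstVector = c • v := by
      apply Subtype.ext
      change u.symm (Pi.single 0 1) = _
      rw [← huv, u.symm_apply_apply]
    have h2 : rayOfNeZero ℝ U.firstVector U.firstVector_ne_zero = C.mkRay x v := by
      rw [C.mkRay_of_ne hv, ray_eq_iff, h1]
      exact SameRay.sameRay_pos_smul_left v hc
    exact congrArg (CRStructure.Spherization.mk x) h2

/-- The bijection `h : B ≃ SD`, `u ↦ [u⁻¹ e₁]`. -/
def equivSpherization : η.CircleBundle ≃ C.Spherization :=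
  Equiv.ofBijective η.toSpherization η.toSpherization_bijective

/-! The smooth structure of `B`: the local coordinates of an adapted coframe `u` at `x` are
coordinates of `x` together with the slope, with respect to a local frame of `D`, of the first
vector `u⁻¹ e₁`. This is the structure of `B` as a subbundle of the coframe bundle: an adapted
coframe at `x` depends smoothly on `x` and on its first vector, see `map_eq_of_first`. -/

instance : TopologicalSpace η.CircleBundle :=
  TopologicalSpace.induced η.equivSpherization inferInstance

/-- `h` as a homeomorphism. -/
def homeoSpherization : η.CircleBundle ≃ₜ C.Spherization :=
  η.equivSpherization.toHomeomorphOfIsInducing ⟨rfl⟩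

instance : ChartedSpace E4 η.CircleBundle where
  atlas := (fun e => η.homeoSpherization.toOpenPartialHomeomorph.trans e) '' atlas E4 C.Spherization
  chartAt u := η.homeoSpherization.toOpenPartialHomeomorph.trans
    (chartAt E4 (η.toSpherization u))
  mem_chart_source u := by
    rw [OpenPartialHomeomorph.trans_source]
    exact ⟨mem_univ _, mem_chart_source E4 (η.toSpherization u)⟩
  chart_mem_atlas u := mem_image_of_mem _ (chart_mem_atlas E4 _)

instance : IsManifold 𝓘(ℝ, E4) ∞ η.CircleBundle := by
  apply isManifold_of_contDiffOn
  rintro _ _ ⟨e, he, rfl⟩ ⟨e', he', rfl⟩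
  have h := (contDiffGroupoid ∞ 𝓘(ℝ, E4)).compatible he he'
  rw [contDiffGroupoid, mem_groupoid_of_pregroupoid] at h
  have h1 : ContDiffOn ℝ ∞ (e' ∘ e.symm) (e.symm.trans e').source := by
    simpa [contDiffPregroupoid] using h.1
  have hs : ((η.homeoSpherization.toOpenPartialHomeomorph.trans e).symm.trans
      (η.homeoSpherization.toOpenPartialHomeomorph.trans e')).source = (e.symm.trans e').source := by
    ext p; simp
  have h2 : ∀ p, (η.homeoSpherization.toOpenPartialHomeomorph.trans e')
      ((η.homeoSpherization.toOpenPartialHomeomorph.trans e).symm p) = e' (e.symm p) := by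
    intro p; simp
  refine (h1.mono ?_).congr fun p _ => ?_
  · rw [hs]; simp
  · exact h2 p

/-! ### The structure equations and the induced metric -/

/-- The components `ω¹, ω², ω³` of the tautological `1`-form on `B`, `ω_u = u ∘ dπ_u`. -/
def tautological (i : Fin 3) : OneForm E4 η.CircleBundle := fun u =>
  ((ContinuousLinearMap.proj i).comp (u.1.map : TangentSpace 𝓘(ℝ, E3) u.1.pt →L[ℝ] (Fin 3 → ℝ))).comp
    (mfderiv 𝓘(ℝ, E4) 𝓘(ℝ, E3) CircleBundle.proj u)

/-- The first structure equation for a smooth `1`-form `α` and smooth functions `a₁, a₂`. -/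
structure FirstStructureEquation (α : OneForm E4 η.CircleBundle) (a₁ a₂ : η.CircleBundle → ℝ) :
    Prop where
  smooth_α : α.IsSmooth
  smooth_a₁ : IsSmoothFun (E := E4) a₁
  smooth_a₂ : IsSmoothFun (E := E4) a₂
  d_ω₁ : ∀ u, (η.tautological 0).d u = -(α.wedge (η.tautological 1) u)
    + a₁ u • ((η.tautological 1).wedge (η.tautological 2) u)
    + a₂ u • ((η.tautological 2).wedge (η.tautological 0) u)
  d_ω₂ : ∀ u, (η.tautological 1).d u = α.wedge (η.tautological 0) u
    + a₂ u • ((η.tautological 1).wedge (η.tautological 2) u)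
    - a₁ u • ((η.tautological 2).wedge (η.tautological 0) u)
  d_ω₃ : ∀ u, (η.tautological 2).d u = (η.tautological 0).wedge (η.tautological 1) u

/-- The second structure equation for the `1`-form `α` and smooth functions `b₁, b₂, K`. -/
structure SecondStructureEquation (α : OneForm E4 η.CircleBundle)
    (b₁ b₂ K : η.CircleBundle → ℝ) : Prop where
  smooth_b₁ : IsSmoothFun (E := E4) b₁
  smooth_b₂ : IsSmoothFun (E := E4) b₂
  smooth_K : IsSmoothFun (E := E4) K
  d_α : ∀ u, α.d u = b₁ u • ((η.tautological 1).wedge (η.tautological 2) u)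
    + b₂ u • ((η.tautological 2).wedge (η.tautological 0) u)
    + K u • ((η.tautological 0).wedge (η.tautological 1) u)

/-- `α` and `K` are the connection form and the scalar curvature of `η`, given by the structure
equations. -/
def IsWebster (α : OneForm E4 η.CircleBundle) (K : η.CircleBundle → ℝ) : Prop :=
  ∃ a₁ a₂ b₁ b₂, η.FirstStructureEquation α a₁ a₂ ∧ η.SecondStructureEquation α b₁ b₂ K

/-- The `1`-form `σ = (4/3) α - (1/3) K ω³`. -/
def sigma (α : OneForm E4 η.CircleBundle) (K : η.CircleBundle → ℝ) : OneForm E4 η.CircleBundle :=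
  fun u => (4 / 3 : ℝ) • α u - ((1 / 3 : ℝ) * K u) • η.tautological 2 u

/-- The metric `ω¹ · ω¹ + ω² · ω² + ω³ · σ` on `B`. -/
def bundleMetric (α : OneForm E4 η.CircleBundle) (K : η.CircleBundle → ℝ) :
    TwoTensor E4 η.CircleBundle :=
  (η.tautological 0).symmProd (η.tautological 0) + (η.tautological 1).symmProd (η.tautological 1)
    + (η.tautological 2).symmProd (η.sigma α K)

/-- The metric on `SD` induced by `h`, i.e. the pullback under `h⁻¹` of the metric on `B`. -/
def inducedMetric (α : OneForm E4 η.CircleBundle) (K : η.CircleBundle → ℝ) :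
    TwoTensor E4 C.Spherization := fun r =>
  (η.bundleMetric α K (η.equivSpherization.symm r)).comp
    (mfderiv 𝓘(ℝ, E4) 𝓘(ℝ, E4) η.equivSpherization.symm r).toLinearMap
    (mfderiv 𝓘(ℝ, E4) 𝓘(ℝ, E4) η.equivSpherization.symm r).toLinearMap

end PositiveContactForm

/-- Two covariant `2`-tensors are conformally equivalent if one is the product of the other with
a smooth positive function. -/
def ConformallyEquivalent {E N : Type*} [NormedAddCommGroup E] [NormedSpace ℝ E]
    [TopologicalSpace N] [ChartedSpace E N] (g g' : TwoTensor E N) : Prop :=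
  ∃ f : N → ℝ, IsSmoothFun (E := E) f ∧ (∀ x, 0 < f x) ∧ ∀ x, g' x = f x • g x

end FeffermanCR

end

open FeffermanCR

/-! Write ω₀, ω₁, ω₂ for the tautological forms, numbered from 0 as in the code.

Structure equations. Near any point of M there is a unitary frame X, JX, that is, dη(X, JX) = 1. It
gives a coframe θ₀, θ₁, θ₂ = η with dη = θ₀ ∧ θ₁, and the adapted coframes are its rotations by an
angle φ. Differentiating the rotated forms yields α = π*β - dφ, where β is read off on M from dθ₀
and dθ₁. The identity d(dη) = 0 is what makes two torsion functions enough
(`UnitaryCoframe.comp_symm`, `UnitaryCoframe.firstAt`). The data in the structure equations are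
unique at each point (`FirstAt.unique`, `ww_coeff_unique`), so the local solutions agree on
overlaps, and smoothness is inherited from them. On vertical vectors α is -dφ. Hence ω₀, ω₁, ω₂, α
form a coframe of B, and so do ω₀, ω₁, ω₂, σ. The product ω₂ · σ is a hyperbolic plane, which gives
the signature (`isLorentzian_inducedMetric`).

Change of contact form. Let η' = μη and ρ = √μ, and identify the two circle bundles through SD.
Adapted coframes with the same first ray are related by τ₀ = ρω₀ + Pω₂, τ₁ = ρω₁ + Qω₂, τ₂ = ρ²ω₂,
with P and Q given by first derivatives of μ (`exists_map_eq`). Comparing the first structure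
equations expresses the derivatives of ρ along D by P and Q, and shows that the new connection form
is γ = α - (3/2ρ)(Pω₀ + Qω₁) + γ₂ω₂, where γ₂ contains derivatives of P and Q, that is, second
derivatives of μ. One more differentiation gives ρ²K' = K + 4γ₂ + terms quadratic in P, Q. In (4/3)γ
- (1/3)K'τ₂ the function γ₂ therefore cancels: this is the role of the constants 4/3 and 1/3. What
is left is ρ²σ' = ρ²σ - 2ρ(Pω₀ + Qω₁) - (P² + Q²)ω₂ (`StructureForms.transformation`), and after
multiplication by ω₂ the correction cancels the extra terms in τ₀² + τ₁². So the metric is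
multiplied by ρ² = μ (`inducedMetric_smul`). Any two positive contact forms are proportional
(`exists_factor`), whence the conformal invariance. -/

noncomputable section

namespace FeffermanCR

open Filter Topology

set_option linter.unusedSectionVars false

/-! ### Pullbacks of 1-forms and their exterior derivatives in charts. -/

section Calculus

variable {E : Type*} [NormedAddCommGroup E] [NormedSpace ℝ E]
  {N : Type*} [TopologicalSpace N] [ChartedSpace E N] [IsManifold 𝓘(ℝ, E) ∞ N]
  {E' : Type*} [NormedAddCommGroup E'] [NormedSpace ℝ E']
  {N' : Type*} [TopologicalSpace N'] [ChartedSpace E' N'] [IsManifold 𝓘(ℝ, E') ∞ N']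

lemma two_le_infty : (2 : WithTop ℕ∞) ≤ ∞ :=
  WithTop.coe_le_coe.2 (le_top : (2 : ℕ∞) ≤ ⊤)

/-- The derivative at `x` of the preferred chart at `x₀`. -/
def chartDerivAt (x₀ x : N) : TangentSpace 𝓘(ℝ, E) x →L[ℝ] E :=
  ((NormedSpace.fromTangentSpace (𝕜 := ℝ) (chartAt E x₀ x)) :
    TangentSpace 𝓘(ℝ, E) (chartAt E x₀ x) →L[ℝ] E).comp
    (mfderiv 𝓘(ℝ, E) 𝓘(ℝ, E) (chartAt E x₀) x)

lemma mdifferentiable_chartAt (x₀ : N) :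
    (chartAt E x₀).MDifferentiable 𝓘(ℝ, E) 𝓘(ℝ, E) := by
  have : IsManifold 𝓘(ℝ, E) 1 N := IsManifold.of_le (n := ∞) (by norm_num)
  exact mdifferentiable_chart x₀

lemma chartDerivAt_chartInvDeriv (x₀ : N) {y : E} (hy : y ∈ (chartAt E x₀).target) (v : E) :
    chartDerivAt x₀ ((chartAt E x₀).symm y) (chartInvDeriv x₀ y v) = v := by
  have h := (mdifferentiable_chartAt x₀).comp_symm_deriv hy
  exact congrArg (fun L => L v) h

lemma chartInvDeriv_chartDerivAt (x₀ : N) {y : E} (hy : y ∈ (chartAt E x₀).target)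
    (v : TangentSpace 𝓘(ℝ, E) ((chartAt E x₀).symm y)) :
    chartInvDeriv x₀ y (chartDerivAt x₀ ((chartAt E x₀).symm y) v) = v := by
  have h := (mdifferentiable_chartAt x₀).symm_comp_deriv ((chartAt E x₀).map_target hy)
  have h2 := congrArg (fun L => L v) h
  rw [(chartAt E x₀).right_inv hy] at h2
  exact h2

lemma OneForm.apply_eq_inChart (θ : OneForm E N) (x₀ : N) {x : N} (hx : x ∈ (chartAt E x₀).source)
    (v : TangentSpace 𝓘(ℝ, E) x) :
    θ x v = θ.inChart x₀ (chartAt E x₀ x) (chartDerivAt x₀ x v) := by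
  obtain ⟨y, hy, rfl⟩ : ∃ y ∈ (chartAt E x₀).target, (chartAt E x₀).symm y = x :=
    ⟨_, (chartAt E x₀).map_source hx, (chartAt E x₀).left_inv hx⟩
  rw [(chartAt E x₀).right_inv hy]
  change _ = θ _ (chartInvDeriv x₀ y _)
  rw [chartInvDeriv_chartDerivAt x₀ hy]

/-- Pullback of `1`-forms. -/
def OneForm.pullback (Φ : N' → N) (θ : OneForm E N) : OneForm E' N' := fun x =>
  (θ (Φ x)).comp (mfderiv 𝓘(ℝ, E') 𝓘(ℝ, E) Φ x)

/-- The differential of a function. -/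
def dFun (f : N → ℝ) : OneForm E N := fun x =>
  ((NormedSpace.fromTangentSpace (𝕜 := ℝ) (f x)) : TangentSpace 𝓘(ℝ) (f x) →L[ℝ] ℝ).comp
    (mfderiv 𝓘(ℝ, E) 𝓘(ℝ) f x)

/-- The exterior derivative of a `1`-form on a vector space. -/
def flatD (f : E → E →L[ℝ] ℝ) (y v w : E) : ℝ := fderiv ℝ f y v w - fderiv ℝ f y w v

/-- The expression in charts of a map. -/
def mapInChart (Φ : N' → N) (x₀ : N') (z₀ : N) : E' → E :=
  chartAt E z₀ ∘ Φ ∘ (chartAt E' x₀).symm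

lemma OneForm.d_apply (θ : OneForm E N) (x : N) (v w : TangentSpace 𝓘(ℝ, E) x) :
    θ.d x v w = flatD (θ.inChart x) (chartAt E x x) (chartDerivAt x x v) (chartDerivAt x x w) := by
  rfl

lemma fderiv_mapInChart {Φ : N' → N} {x₀ : N'} {z₀ : N} {y : E'}
    (hy : y ∈ (chartAt E' x₀).target)
    (hΦ : MDifferentiableAt 𝓘(ℝ, E') 𝓘(ℝ, E) Φ ((chartAt E' x₀).symm y))
    (hz : Φ ((chartAt E' x₀).symm y) ∈ (chartAt E z₀).source) (v : E') :
    fderiv ℝ (mapInChart Φ x₀ z₀) y v = chartDerivAt z₀ (Φ ((chartAt E' x₀).symm y))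
      (mfderiv 𝓘(ℝ, E') 𝓘(ℝ, E) Φ ((chartAt E' x₀).symm y) (chartInvDeriv x₀ y v)) := by
  have h1 := (mdifferentiable_chartAt (E := E) z₀).mdifferentiableAt hz
  have h2 := (mdifferentiable_chartAt (E := E') x₀).mdifferentiableAt_symm hy
  have h3 := mfderiv_comp y hΦ h2
  have h4 := mfderiv_comp y h1 (hΦ.comp y h2)
  rw [← mfderiv_eq_fderiv]
  unfold mapInChart
  rw [h4, h3]
  rfl

lemma OneForm.inChart_pullback {Φ : N' → N} (θ : OneForm E N) {x₀ : N'} {z₀ : N} {y : E'}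
    (hy : y ∈ (chartAt E' x₀).target)
    (hΦ : MDifferentiableAt 𝓘(ℝ, E') 𝓘(ℝ, E) Φ ((chartAt E' x₀).symm y))
    (hz : Φ ((chartAt E' x₀).symm y) ∈ (chartAt E z₀).source) :
    (θ.pullback Φ).inChart x₀ y
      = (θ.inChart z₀ (mapInChart Φ x₀ z₀ y)).comp (fderiv ℝ (mapInChart Φ x₀ z₀) y) := by
  ext v
  rw [ContinuousLinearMap.comp_apply, fderiv_mapInChart hy hΦ hz]
  exact θ.apply_eq_inChart z₀ hz _

lemma contDiffAt_mapInChart {Φ : N' → N} {x : N'} {n : WithTop ℕ∞} (hn : n ≤ ∞)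
    (hΦ : ContMDiffAt 𝓘(ℝ, E') 𝓘(ℝ, E) n Φ x) {x₀ : N'} {z₀ : N}
    (hx : x ∈ (chartAt E' x₀).source) (hz : Φ x ∈ (chartAt E z₀).source) :
    ContDiffAt ℝ n (mapInChart (E := E) (E' := E') Φ x₀ z₀) (chartAt E' x₀ x) := by
  have h1 : ContMDiffAt 𝓘(ℝ, E) 𝓘(ℝ, E) n (chartAt E z₀) (Φ x) :=
    ((contMDiffOn_chart (I := 𝓘(ℝ, E)) (n := ∞) (x := z₀)).contMDiffAt
      ((chartAt E z₀).open_source.mem_nhds hz)).of_le hn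
  have h2 : ContMDiffAt 𝓘(ℝ, E') 𝓘(ℝ, E') n (chartAt E' x₀).symm (chartAt E' x₀ x) :=
    ((contMDiffOn_chart_symm (I := 𝓘(ℝ, E')) (n := ∞) (x := x₀)).contMDiffAt
      ((chartAt E' x₀).open_target.mem_nhds ((chartAt E' x₀).map_source hx))).of_le hn
  have hl := (chartAt E' x₀).left_inv hx
  refine ContMDiffAt.contDiffAt ?_
  refine ContMDiffAt.comp (I' := 𝓘(ℝ, E)) _ (g := chartAt E z₀) ?_
    (ContMDiffAt.comp (I' := 𝓘(ℝ, E')) _ (g := Φ) ?_ h2)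
  · simpa [hl] using h1
  · rw [hl]; exact hΦ

/-- Smoothness of a `1`-form at a point. -/
def OneForm.SmoothAt (θ : OneForm E N) (x : N) : Prop :=
  ContDiffAt ℝ ∞ (θ.inChart x) (chartAt E x x)

lemma eventually_inChart_pullback {Φ : N' → N} (θ : OneForm E N) {x : N'}
    (hΦ : ContMDiffAt 𝓘(ℝ, E') 𝓘(ℝ, E) ∞ Φ x) {x₀ : N'} {z₀ : N}
    (hx : x ∈ (chartAt E' x₀).source) (hz : Φ x ∈ (chartAt E z₀).source) :
    (θ.pullback Φ).inChart x₀ =ᶠ[𝓝 (chartAt E' x₀ x)] fun y =>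
      (θ.inChart z₀ (mapInChart Φ x₀ z₀ y)).comp (fderiv ℝ (mapInChart Φ x₀ z₀) y) := by
  have hl := (chartAt E' x₀).left_inv hx
  have hc : Tendsto (chartAt E' x₀).symm (𝓝 (chartAt E' x₀ x)) (𝓝 x) := by
    have := (chartAt E' x₀).continuousAt_symm ((chartAt E' x₀).map_source hx)
    rw [ContinuousAt, hl] at this
    exact this
  -- Smoothness of order ∞ at one point need not persist with order ∞ on a neighbourhood. Order one
  -- is enough: the chart formula only needs Φ differentiable at nearby points.
  have h1 : ∀ᶠ z in 𝓝 x, ContMDiffAt 𝓘(ℝ, E') 𝓘(ℝ, E) 1 Φ z := by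
    have : IsManifold 𝓘(ℝ, E) 1 N := IsManifold.of_le (n := ∞) (by norm_num)
    have : IsManifold 𝓘(ℝ, E') 1 N' := IsManifold.of_le (n := ∞) (by norm_num)
    exact (contMDiffAt_iff_contMDiffAt_nhds (by simp)).1 (hΦ.of_le (by norm_num))
  have h2 : ∀ᶠ z in 𝓝 x, Φ z ∈ (chartAt E z₀).source :=
    hΦ.continuousAt.eventually ((chartAt E z₀).open_source.mem_nhds hz)
  filter_upwards [hc.eventually h1, hc.eventually h2,
    (chartAt E' x₀).open_target.mem_nhds ((chartAt E' x₀).map_source hx)] with y hy1 hy2 hy3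
  exact θ.inChart_pullback hy3 (hy1.mdifferentiableAt (by simp)) hy2

lemma contDiffAt_inChart_pullback {Φ : N' → N} {θ : OneForm E N} {x : N'}
    (hΦ : ContMDiffAt 𝓘(ℝ, E') 𝓘(ℝ, E) ∞ Φ x) {x₀ : N'} {z₀ : N}
    (hx : x ∈ (chartAt E' x₀).source) (hz : Φ x ∈ (chartAt E z₀).source)
    (hθ : ContDiffAt ℝ ∞ (θ.inChart z₀) (chartAt E z₀ (Φ x))) :
    ContDiffAt ℝ ∞ ((θ.pullback Φ).inChart x₀) (chartAt E' x₀ x) := by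
  refine ContDiffAt.congr_of_eventuallyEq ?_ (eventually_inChart_pullback θ hΦ hx hz)
  have h := contDiffAt_mapInChart (E := E) (E' := E') le_rfl hΦ hx hz
  have hθ' : ContDiffAt ℝ ∞ (θ.inChart z₀) (mapInChart Φ x₀ z₀ (chartAt E' x₀ x)) := by
    simpa [mapInChart, (chartAt E' x₀).left_inv hx] using hθ
  exact (hθ'.comp _ h).clm_comp (h.fderiv_right (m := ∞) (by simp))

/-- By the product and chain rules the derivative of the pulled back form contains the second
derivative of the map; being symmetric, it drops out of the antisymmetrization. -/
lemma flatD_inChart_pullback {Φ : N' → N} {θ : OneForm E N} {x : N'}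
    (hΦ : ContMDiffAt 𝓘(ℝ, E') 𝓘(ℝ, E) ∞ Φ x) {x₀ : N'} {z₀ : N}
    (hx : x ∈ (chartAt E' x₀).source) (hz : Φ x ∈ (chartAt E z₀).source)
    (hθ : ContDiffAt ℝ ∞ (θ.inChart z₀) (chartAt E z₀ (Φ x))) (v w : E') :
    flatD ((θ.pullback Φ).inChart x₀) (chartAt E' x₀ x) v w
      = flatD (θ.inChart z₀) (chartAt E z₀ (Φ x))
        (fderiv ℝ (mapInChart Φ x₀ z₀) (chartAt E' x₀ x) v)
        (fderiv ℝ (mapInChart Φ x₀ z₀) (chartAt E' x₀ x) w) := by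
  have h := contDiffAt_mapInChart (E := E) (E' := E') le_rfl hΦ hx hz
  have hp : mapInChart Φ x₀ z₀ (chartAt E' x₀ x) = chartAt E z₀ (Φ x) := by
    simp [mapInChart, (chartAt E' x₀).left_inv hx]
  unfold flatD
  rw [(eventually_inChart_pullback θ hΦ hx hz).fderiv_eq]
  rw [← hp] at hθ ⊢
  have hd := (h.fderiv_right (m := 1) two_le_infty).differentiableAt (by simp)
  have hm := h.differentiableAt (by simp)
  have hθd := hθ.differentiableAt (by simp)
  have hc : DifferentiableAt ℝ (fun y => θ.inChart z₀ (mapInChart Φ x₀ z₀ y))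
    (chartAt E' x₀ x) := hθd.comp _ hm
  rw [fderiv_clm_comp hc hd]
  have h2 : fderiv ℝ (fun y => θ.inChart z₀ (mapInChart Φ x₀ z₀ y)) (chartAt E' x₀ x)
      = (fderiv ℝ (θ.inChart z₀) (mapInChart Φ x₀ z₀ (chartAt E' x₀ x))).comp
        (fderiv ℝ (mapInChart Φ x₀ z₀) (chartAt E' x₀ x)) :=
    fderiv_comp _ hθd hm
  rw [h2]
  have hs := h.isSymmSndFDerivAt (by simpa using two_le_infty) v w
  simp [hs]

end Calculus

/-! ### Independence of the chart, and the rules for `d` on sums, multiples and differentials. -/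

section Calculus

variable {E : Type*} [NormedAddCommGroup E] [NormedSpace ℝ E]
  {N : Type*} [TopologicalSpace N] [ChartedSpace E N] [IsManifold 𝓘(ℝ, E) ∞ N]
  {E' : Type*} [NormedAddCommGroup E'] [NormedSpace ℝ E']
  {N' : Type*} [TopologicalSpace N'] [ChartedSpace E' N'] [IsManifold 𝓘(ℝ, E') ∞ N']

/-- Applied to the identity map, the pullback lemmas become change-of-chart statements; this is how
the definitions based on preferred charts are shown to be independent of the chart. -/
lemma OneForm.pullback_id (θ : OneForm E N) : θ.pullback (id : N → N) = θ := by
  funext x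
  unfold OneForm.pullback
  rw [mfderiv_id]
  rfl

lemma OneForm.SmoothAt.contDiffAt {θ : OneForm E N} {x : N} (h : θ.SmoothAt x) {x₀ : N}
    (hx : x ∈ (chartAt E x₀).source) : ContDiffAt ℝ ∞ (θ.inChart x₀) (chartAt E x₀ x) := by
  have := contDiffAt_inChart_pullback (θ := θ) (Φ := (id : N → N)) contMDiffAt_id hx
    (mem_chart_source E x) h
  rwa [θ.pullback_id] at this

lemma OneForm.isSmooth_iff {θ : OneForm E N} : θ.IsSmooth ↔ ∀ x, θ.SmoothAt x := by
  constructor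
  · intro h x
    exact (h x).contDiffAt ((chartAt E x).open_target.mem_nhds
      ((chartAt E x).map_source (mem_chart_source E x)))
  · intro h x₀ y hy
    have := (h ((chartAt E x₀).symm y)).contDiffAt ((chartAt E x₀).map_target hy)
    rw [(chartAt E x₀).right_inv hy] at this
    exact this.contDiffWithinAt

lemma OneForm.SmoothAt.pullback {Φ : N' → N} {θ : OneForm E N} {x : N'}
    (hΦ : ContMDiffAt 𝓘(ℝ, E') 𝓘(ℝ, E) ∞ Φ x) (h : θ.SmoothAt (Φ x)) :
    (OneForm.pullback (E' := E') Φ θ).SmoothAt x :=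
  contDiffAt_inChart_pullback hΦ (mem_chart_source E' x) (mem_chart_source E (Φ x)) h

lemma fderiv_mapInChart_chartDerivAt {Φ : N' → N} {x₀ : N'} {z₀ : N} {x : N'}
    (hΦ : MDifferentiableAt 𝓘(ℝ, E') 𝓘(ℝ, E) Φ x)
    (hx : x ∈ (chartAt E' x₀).source) (hz : Φ x ∈ (chartAt E z₀).source)
    (v : TangentSpace 𝓘(ℝ, E') x) :
    fderiv ℝ (mapInChart Φ x₀ z₀) (chartAt E' x₀ x) (chartDerivAt x₀ x v)
      = chartDerivAt z₀ (Φ x) (mfderiv 𝓘(ℝ, E') 𝓘(ℝ, E) Φ x v) := by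
  obtain ⟨y, hy, rfl⟩ : ∃ y ∈ (chartAt E' x₀).target, (chartAt E' x₀).symm y = x :=
    ⟨_, (chartAt E' x₀).map_source hx, (chartAt E' x₀).left_inv hx⟩
  rw [(chartAt E' x₀).right_inv hy, fderiv_mapInChart hy hΦ hz, chartInvDeriv_chartDerivAt _ hy]

lemma flatD_pullback_chartDerivAt {Φ : N' → N} {θ : OneForm E N} {x : N'}
    (hΦ : ContMDiffAt 𝓘(ℝ, E') 𝓘(ℝ, E) ∞ Φ x) {x₀ : N'} {z₀ : N}
    (hx : x ∈ (chartAt E' x₀).source) (hz : Φ x ∈ (chartAt E z₀).source)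
    (hθ : θ.SmoothAt (Φ x)) (v w : TangentSpace 𝓘(ℝ, E') x) :
    flatD ((θ.pullback Φ).inChart x₀) (chartAt E' x₀ x) (chartDerivAt x₀ x v)
        (chartDerivAt x₀ x w)
      = flatD (θ.inChart z₀) (chartAt E z₀ (Φ x))
        (chartDerivAt z₀ (Φ x) (mfderiv 𝓘(ℝ, E') 𝓘(ℝ, E) Φ x v))
        (chartDerivAt z₀ (Φ x) (mfderiv 𝓘(ℝ, E') 𝓘(ℝ, E) Φ x w)) := by
  have hm := hΦ.mdifferentiableAt (by simp)
  rw [flatD_inChart_pullback hΦ hx hz (hθ.contDiffAt hz),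
    fderiv_mapInChart_chartDerivAt hm hx hz, fderiv_mapInChart_chartDerivAt hm hx hz]

/-- The exterior derivative commutes with pullbacks. -/
lemma OneForm.d_pullback {Φ : N' → N} {θ : OneForm E N} {x : N'}
    (hΦ : ContMDiffAt 𝓘(ℝ, E') 𝓘(ℝ, E) ∞ Φ x) (hθ : θ.SmoothAt (Φ x))
    (v w : TangentSpace 𝓘(ℝ, E') x) :
    (θ.pullback Φ).d x v w = θ.d (Φ x) (mfderiv 𝓘(ℝ, E') 𝓘(ℝ, E) Φ x v)
      (mfderiv 𝓘(ℝ, E') 𝓘(ℝ, E) Φ x w) :=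
  flatD_pullback_chartDerivAt hΦ (mem_chart_source E' x) (mem_chart_source E (Φ x)) hθ v w

/-- The exterior derivative can be computed in any preferred chart. -/
lemma OneForm.SmoothAt.d_eq {θ : OneForm E N} {x : N} (hθ : θ.SmoothAt x) {x₀ : N}
    (hx : x ∈ (chartAt E x₀).source) (v w : TangentSpace 𝓘(ℝ, E) x) :
    θ.d x v w = flatD (θ.inChart x₀) (chartAt E x₀ x) (chartDerivAt x₀ x v)
      (chartDerivAt x₀ x w) := by
  have h := flatD_pullback_chartDerivAt (Φ := (id : N → N)) contMDiffAt_id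
    (mem_chart_source E x) hx hθ v w
  rw [θ.pullback_id, mfderiv_id] at h
  exact h

lemma OneForm.eventually_inChart {θ θ' : OneForm E N} {x : N} (h : ∀ᶠ z in 𝓝 x, θ z = θ' z) :
    θ.inChart x =ᶠ[𝓝 (chartAt E x x)] θ'.inChart x := by
  have hx := mem_chart_source E x
  have hc := (chartAt E x).continuousAt_symm ((chartAt E x).map_source hx)
  rw [ContinuousAt, (chartAt E x).left_inv hx] at hc
  filter_upwards [hc.eventually h] with y hy
  unfold OneForm.inChart
  rw [hy]

lemma OneForm.SmoothAt.congr {θ θ' : OneForm E N} {x : N} (hθ : θ.SmoothAt x)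
    (h : ∀ᶠ z in 𝓝 x, θ' z = θ z) : θ'.SmoothAt x :=
  ContDiffAt.congr_of_eventuallyEq hθ (OneForm.eventually_inChart h)

lemma OneForm.d_congr {θ θ' : OneForm E N} {x : N} (h : ∀ᶠ z in 𝓝 x, θ z = θ' z) :
    θ.d x = θ'.d x := by
  ext v w
  rw [OneForm.d_apply, OneForm.d_apply]
  unfold flatD
  rw [(OneForm.eventually_inChart h).fderiv_eq]

lemma OneForm.SmoothAt.differentiableAt {θ : OneForm E N} {x : N} (h : θ.SmoothAt x) :
    DifferentiableAt ℝ (θ.inChart x) (chartAt E x x) :=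
  ContDiffAt.differentiableAt h (by simp)

lemma OneForm.SmoothAt.add {θ θ' : OneForm E N} {x : N} (h : θ.SmoothAt x)
    (h' : θ'.SmoothAt x) : OneForm.SmoothAt (fun z => θ z + θ' z) x :=
  ContDiffAt.add h h'

lemma OneForm.SmoothAt.sub {θ θ' : OneForm E N} {x : N} (h : θ.SmoothAt x)
    (h' : θ'.SmoothAt x) : OneForm.SmoothAt (fun z => θ z - θ' z) x :=
  ContDiffAt.sub h h'

lemma OneForm.d_add {θ θ' : OneForm E N} {x : N} (h : θ.SmoothAt x)
    (h' : θ'.SmoothAt x) (v w : TangentSpace 𝓘(ℝ, E) x) :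
    OneForm.d (fun z => θ z + θ' z) x v w = θ.d x v w + θ'.d x v w := by
  simp only [OneForm.d_apply, flatD]
  have : OneForm.inChart (fun z => θ z + θ' z) x = θ.inChart x + θ'.inChart x := rfl
  rw [this, fderiv_add h.differentiableAt h'.differentiableAt]
  simp only [add_apply]
  ring

lemma OneForm.d_sub {θ θ' : OneForm E N} {x : N} (h : θ.SmoothAt x)
    (h' : θ'.SmoothAt x) (v w : TangentSpace 𝓘(ℝ, E) x) :
    OneForm.d (fun z => θ z - θ' z) x v w = θ.d x v w - θ'.d x v w := by
  simp only [OneForm.d_apply, flatD]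
  have : OneForm.inChart (fun z => θ z - θ' z) x = θ.inChart x - θ'.inChart x := rfl
  rw [this, fderiv_sub h.differentiableAt h'.differentiableAt]
  simp only [sub_apply]
  ring

lemma contDiffAt_comp_chart_symm {F : Type*} [NormedAddCommGroup F] [NormedSpace ℝ F]
    {f : N → F} {x : N} (hf : ContMDiffAt 𝓘(ℝ, E) 𝓘(ℝ, F) ∞ f x) {x₀ : N}
    (hx : x ∈ (chartAt E x₀).source) :
    ContDiffAt ℝ ∞ (fun y => f ((chartAt E x₀).symm y)) (chartAt E x₀ x) := by
  have := contDiffAt_mapInChart (E := F) (z₀ := f x) le_rfl hf hx (mem_chart_source F (f x))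
  exact this

lemma contMDiffAt_of_contDiffAt_chart {F : Type*} [NormedAddCommGroup F] [NormedSpace ℝ F]
    {f : N → F} {x : N} {x₀ : N} (hx : x ∈ (chartAt E x₀).source)
    (hf : ContDiffAt ℝ ∞ (fun y => f ((chartAt E x₀).symm y)) (chartAt E x₀ x)) :
    ContMDiffAt 𝓘(ℝ, E) 𝓘(ℝ, F) ∞ f x := by
  have h1 : ContMDiffAt 𝓘(ℝ, E) 𝓘(ℝ, E) ∞ (chartAt E x₀) x :=
    (contMDiffOn_chart (I := 𝓘(ℝ, E)) (n := ∞) (x := x₀)).contMDiffAt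
      ((chartAt E x₀).open_source.mem_nhds hx)
  have h2 := ContMDiffAt.comp x (I' := 𝓘(ℝ, E)) hf.contMDiffAt h1
  refine h2.congr_of_eventuallyEq ?_
  filter_upwards [(chartAt E x₀).open_source.mem_nhds hx] with z hz
  simp [(chartAt E x₀).left_inv hz]

lemma OneForm.SmoothAt.smul {f : N → ℝ} {θ : OneForm E N} {x : N}
    (hf : ContMDiffAt 𝓘(ℝ, E) 𝓘(ℝ) ∞ f x) (h : θ.SmoothAt x) :
    OneForm.SmoothAt (fun z => f z • θ z) x :=
  ContDiffAt.smul (contDiffAt_comp_chart_symm hf (mem_chart_source E x)) h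

lemma fderiv_comp_chart_symm {f : N → ℝ} {x : N} (hf : MDifferentiableAt 𝓘(ℝ, E) 𝓘(ℝ) f x)
    {x₀ : N} (hx : x ∈ (chartAt E x₀).source) (v : TangentSpace 𝓘(ℝ, E) x) :
    fderiv ℝ (fun y => f ((chartAt E x₀).symm y)) (chartAt E x₀ x) (chartDerivAt x₀ x v)
      = dFun f x v := by
  have h := fderiv_mapInChart_chartDerivAt (z₀ := f x) hf hx (mem_chart_source ℝ (f x)) v
  refine h.trans ?_
  unfold chartDerivAt
  rw [chartAt_self_eq]
  have : mfderiv 𝓘(ℝ) 𝓘(ℝ) (OpenPartialHomeomorph.refl ℝ) (f x) = ContinuousLinearMap.id ℝ _ :=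
    mfderiv_id
  simp only [ContinuousLinearMap.comp_apply]
  rw [this]
  rfl

lemma OneForm.d_smul {f : N → ℝ} {θ : OneForm E N} {x : N}
    (hf : ContMDiffAt 𝓘(ℝ, E) 𝓘(ℝ) ∞ f x) (h : θ.SmoothAt x) (v w : TangentSpace 𝓘(ℝ, E) x) :
    OneForm.d (fun z => f z • θ z) x v w
      = dFun f x v * θ x w - dFun f x w * θ x v + f x * θ.d x v w := by
  have hx := mem_chart_source E x
  simp only [OneForm.d_apply, flatD, θ.apply_eq_inChart x hx,
    ← fderiv_comp_chart_symm (hf.mdifferentiableAt (by simp)) hx]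
  have : OneForm.inChart (fun z => f z • θ z) x
    = fun y => (f ((chartAt E x).symm y)) • θ.inChart x y := rfl
  rw [this, fderiv_fun_smul ((contDiffAt_comp_chart_symm hf hx).differentiableAt (by simp))
    h.differentiableAt]
  simp [(chartAt E x).left_inv hx]
  ring

lemma eventually_inChart_dFun {f : N → ℝ} {x : N} (hf : ContMDiffAt 𝓘(ℝ, E) 𝓘(ℝ) ∞ f x) :
    (dFun (E := E) f).inChart x =ᶠ[𝓝 (chartAt E x x)]
      fderiv ℝ (fun y => f ((chartAt E x).symm y)) := by
  have hx := mem_chart_source E x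
  have hc := (chartAt E x).continuousAt_symm ((chartAt E x).map_source hx)
  rw [ContinuousAt, (chartAt E x).left_inv hx] at hc
  have h1 : ∀ᶠ z in 𝓝 x, ContMDiffAt 𝓘(ℝ, E) 𝓘(ℝ) 1 f z := by
    have : IsManifold 𝓘(ℝ, E) 1 N := IsManifold.of_le (n := ∞) (by norm_num)
    exact (contMDiffAt_iff_contMDiffAt_nhds (by simp)).1 (hf.of_le (by norm_num))
  filter_upwards [hc.eventually h1, (chartAt E x).open_target.mem_nhds
    ((chartAt E x).map_source hx)] with y hy hy'
  ext v
  have h2 := fderiv_comp_chart_symm (hy.mdifferentiableAt (by simp))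
    ((chartAt E x).map_target hy') (chartInvDeriv x y v)
  rw [chartDerivAt_chartInvDeriv x hy', (chartAt E x).right_inv hy'] at h2
  exact h2.symm

lemma smoothAt_dFun {f : N → ℝ} {x : N} (hf : ContMDiffAt 𝓘(ℝ, E) 𝓘(ℝ) ∞ f x) :
    (dFun (E := E) f).SmoothAt x :=
  ContDiffAt.congr_of_eventuallyEq
    ((contDiffAt_comp_chart_symm hf (mem_chart_source E x)).fderiv_right (m := ∞) (by simp))
    (eventually_inChart_dFun hf)

/-- In the chart at `x` this is the symmetry of the second derivative. -/
lemma d_dFun {f : N → ℝ} {x : N} (hf : ContMDiffAt 𝓘(ℝ, E) 𝓘(ℝ) ∞ f x) 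
    (v w : TangentSpace 𝓘(ℝ, E) x) : (dFun (E := E) f).d x v w = 0 := by
  rw [OneForm.d_apply, flatD, (eventually_inChart_dFun hf).fderiv_eq]
  have := (contDiffAt_comp_chart_symm hf (mem_chart_source E x)).isSymmSndFDerivAt
    (by simpa using two_le_infty)
    (chartDerivAt x x v) (chartDerivAt x x w)
  rw [this, sub_self]

end Calculus

/-! ### Smooth vector fields, dual frames and d² = 0. -/

section Fields

variable {E : Type*} [NormedAddCommGroup E] [NormedSpace ℝ E]
  {N : Type*} [TopologicalSpace N] [ChartedSpace E N] [IsManifold 𝓘(ℝ, E) ∞ N]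

/-- The expression of a vector field in the preferred chart at `x₀`. -/
def fieldInChart (Z : ∀ x : N, TangentSpace 𝓘(ℝ, E) x) (x₀ : N) (y : E) : E :=
  chartDerivAt x₀ ((chartAt E x₀).symm y) (Z ((chartAt E x₀).symm y))

/-- Smoothness of a vector field at a point. -/
def SmoothFieldAt (Z : ∀ x : N, TangentSpace 𝓘(ℝ, E) x) (x : N) : Prop :=
  ContDiffAt ℝ ∞ (fieldInChart Z x) (chartAt E x x)

lemma tendsto_chart_symm (x : N) :
    Tendsto (chartAt E x).symm (𝓝 (chartAt E x x)) (𝓝 x) := by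
  have hx := mem_chart_source E x
  have hc := (chartAt E x).continuousAt_symm ((chartAt E x).map_source hx)
  rwa [ContinuousAt, (chartAt E x).left_inv hx] at hc

lemma eventually_chart_target (x : N) :
    ∀ᶠ y in 𝓝 (chartAt E x x), y ∈ (chartAt E x).target :=
  (chartAt E x).open_target.mem_nhds ((chartAt E x).map_source (mem_chart_source E x))

lemma OneForm.apply_chart_symm (θ : OneForm E N) (x : N) {y : E} (hy : y ∈ (chartAt E x).target)
    (v : TangentSpace 𝓘(ℝ, E) ((chartAt E x).symm y)) :
    θ ((chartAt E x).symm y) v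
      = θ.inChart x y (chartDerivAt x ((chartAt E x).symm y) v) := by
  rw [θ.apply_eq_inChart x ((chartAt E x).map_target hy), (chartAt E x).right_inv hy]

lemma OneForm.SmoothAt.d_chart_symm {θ : OneForm E N} (x : N) {y : E}
    (hy : y ∈ (chartAt E x).target) (hθ : θ.SmoothAt ((chartAt E x).symm y))
    (v w : TangentSpace 𝓘(ℝ, E) ((chartAt E x).symm y)) :
    θ.d ((chartAt E x).symm y) v w
      = flatD (θ.inChart x) y (chartDerivAt x ((chartAt E x).symm y) v)
        (chartDerivAt x ((chartAt E x).symm y) w) := by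
  rw [hθ.d_eq ((chartAt E x).map_target hy), (chartAt E x).right_inv hy]

/-- Smoothness of θ is required near `x` and not only at `x`: `θ.d z` is defined with the chart
preferred at `z`, and moving it to the chart of `x` uses smoothness at `z`. -/
lemma OneForm.contMDiffAt_d_apply {θ : OneForm E N} {Z W : ∀ x : N, TangentSpace 𝓘(ℝ, E) x}
    {x : N} (hθ : ∀ᶠ z in 𝓝 x, θ.SmoothAt z) (hZ : SmoothFieldAt Z x) (hW : SmoothFieldAt W x) :
    ContMDiffAt 𝓘(ℝ, E) 𝓘(ℝ) ∞ (fun z => θ.d z (Z z) (W z)) x := by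
  apply contMDiffAt_of_contDiffAt_chart (mem_chart_source E x)
  have hd := ContDiffAt.fderiv_right (m := ∞) hθ.self_of_nhds (by simp)
  refine (((hd.clm_apply hZ).clm_apply hW).sub
    ((hd.clm_apply hW).clm_apply hZ)).congr_of_eventuallyEq ?_
  filter_upwards [eventually_chart_target x, (tendsto_chart_symm x).eventually hθ] with y hy hy'
  exact hy'.d_chart_symm x hy _ _

/-- The interior product of the exterior derivative of a smooth form with a smooth field is
smooth. -/
lemma OneForm.smoothAt_interior {θ τ : OneForm E N} {Z : ∀ x : N, TangentSpace 𝓘(ℝ, E) x}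
    {x : N} (hθ : ∀ᶠ z in 𝓝 x, θ.SmoothAt z) (hZ : SmoothFieldAt Z x)
    (hτ : ∀ᶠ z in 𝓝 x, ∀ w, τ z w = θ.d z (Z z) w) : τ.SmoothAt x := by
  have hd := ContDiffAt.fderiv_right (m := ∞) hθ.self_of_nhds (by simp)
  -- One of the two terms of the exterior derivative has the field in the second slot; flipping the
  -- slots is a bounded linear operation, hence smooth.
  have hF : ContDiff ℝ ∞ (fun T : E →L[ℝ] E →L[ℝ] ℝ => T.flip) :=
    IsBoundedLinearMap.contDiff
      { map_add := fun _ _ => rfl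
        map_smul := fun _ _ => rfl
        bound := ⟨1, one_pos, fun T => by rw [T.opNorm_flip, one_mul]⟩ }
  have hflip : ContDiffAt ℝ ∞ (fun y => (fderiv ℝ (θ.inChart x) y).flip) (chartAt E x x) :=
    hF.contDiffAt.comp _ hd
  refine ((hd.clm_apply hZ).sub (hflip.clm_apply hZ)).congr_of_eventuallyEq ?_
  filter_upwards [eventually_chart_target x, (tendsto_chart_symm x).eventually hθ,
    (tendsto_chart_symm x).eventually hτ] with y hy hy' hy''
  ext v
  change τ _ (chartInvDeriv x y v) = _
  rw [hy'', hy'.d_chart_symm x hy, chartDerivAt_chartInvDeriv x hy]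
  rfl

/-- The dual frame of a smooth coframe is smooth. -/
lemma smoothFieldAt_of_dual {n : ℕ} [FiniteDimensional ℝ E] (hn : Module.finrank ℝ E = n)
    {θ : Fin n → OneForm E N} {e : Fin n → ∀ x : N, TangentSpace 𝓘(ℝ, E) x} {x : N}
    (hθ : ∀ i, (θ i).SmoothAt x)
    (h : ∀ᶠ z in 𝓝 x, ∀ i j, θ i z (e j z) = if i = j then 1 else 0) (j : Fin n) :
    SmoothFieldAt (e j) x := by
  have : CompleteSpace E := FiniteDimensional.complete ℝ E
  let L : E → E →L[ℝ] (Fin n → ℝ) := fun y => ContinuousLinearMap.pi fun i => (θ i).inChart x y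
  have hL : ContDiffAt ℝ ∞ L (chartAt E x x) := by
    let P : (Fin n → (E →L[ℝ] ℝ)) →ₗ[ℝ] (E →L[ℝ] (Fin n → ℝ)) :=
      { toFun := fun f => ContinuousLinearMap.pi f
        map_add' := fun f g => rfl
        map_smul' := fun c f => rfl }
    have hP : ContDiff ℝ ∞ (LinearMap.toContinuousLinearMap P) :=
      (LinearMap.toContinuousLinearMap P).contDiff
    exact hP.contDiffAt.comp _ (contDiffAt_pi.2 hθ)
  have hev : ∀ᶠ y in 𝓝 (chartAt E x x), ∀ j, L y (fieldInChart (e j) x y) = Pi.single j 1 := by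
    filter_upwards [eventually_chart_target x, (tendsto_chart_symm x).eventually h] with y hy hy' j
    ext i
    have := hy' i j
    rw [(θ i).apply_chart_symm x hy] at this
    refine this.trans ?_
    rw [Pi.single_apply]
  -- Duality makes the matrix of the coframe surjective, hence invertible because the dimensions
  -- agree.
  have hinv : ∀ y, (∀ j, L y (fieldInChart (e j) x y) = Pi.single j 1) →
      ∃ T : E ≃L[ℝ] (Fin n → ℝ), (T : E →L[ℝ] (Fin n → ℝ)) = L y := by
    intro y hy
    have hs : Function.Surjective (L y).toLinearMap := by
      intro w
      refine ⟨∑ j, w j • fieldInChart (e j) x y, ?_⟩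
      rw [map_sum]
      simp only [map_smul]
      change ∑ j, w j • L y (fieldInChart (e j) x y) = w
      simp only [hy]
      ext i
      simp [Finset.sum_apply, Pi.single_apply]
    have hi := (LinearMap.injective_iff_surjective_of_finrank_eq_finrank
      (f := (L y).toLinearMap) (by simp [hn])).2 hs
    exact ⟨(LinearEquiv.ofBijective _ ⟨hi, hs⟩).toContinuousLinearEquiv, by ext v; rfl⟩
  obtain ⟨T, hT⟩ := hinv _ hev.self_of_nhds
  -- The dual vectors are the inverse of `L y` applied to constant vectors, and inversion is smooth
  -- at invertible maps.
  have hI : ContDiffAt ℝ ∞ (fun y => (L y).inverse) (chartAt E x x) := by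
    have := contDiffAt_map_inverse (n := ∞) (𝕜 := ℝ) T
    rw [hT] at this
    exact this.comp _ hL
  refine (hI.clm_apply (contDiffAt_const (c := (Pi.single j 1 : Fin n → ℝ)))).congr_of_eventuallyEq
    ?_
  filter_upwards [hev] with y hy
  obtain ⟨S, hS⟩ := hinv y hy
  rw [← hS, ContinuousLinearMap.inverse_equiv]
  have := hy j
  rw [← hS] at this
  exact ((S.symm_apply_eq).2 this.symm).symm

/-- The trivialization of the tangent bundle at `x` is fibrewise the derivative of the preferred
chart at `x`, so bundle smoothness of a section is smoothness of its chart expression. -/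
lemma smoothFieldAt_of_isSmoothFieldOn [IsManifold 𝓘(ℝ, E) 1 N]
    {Z : ∀ x : N, TangentSpace 𝓘(ℝ, E) x} {U : Set N} (hU : IsOpen U)
    (h : IsSmoothFieldOn Z U) {x : N} (hx : x ∈ U) : SmoothFieldAt Z x := by
  let e := trivializationAt E (TangentSpace 𝓘(ℝ, E) : N → Type _) x
  have hbase : e.baseSet = (chartAt E x).source := rfl
  have h1 : IsSmoothFieldOn Z (U ∩ (chartAt E x).source) := h.mono inter_subset_left
  have h2 := (e.contMDiffOn_section_iff (hU.inter (chartAt E x).open_source)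
    inter_subset_right).1 h1
  have h3 : ContMDiffAt 𝓘(ℝ, E) 𝓘(ℝ, E) ∞ (fun z => (e ⟨z, Z z⟩).2) x :=
    h2.contMDiffAt ((hU.inter (chartAt E x).open_source).mem_nhds ⟨hx, mem_chart_source E x⟩)
  refine (contDiffAt_comp_chart_symm h3 (mem_chart_source E x)).congr_of_eventuallyEq ?_
  filter_upwards [eventually_chart_target x] with y hy
  have h4 := TangentBundle.continuousLinearMapAt_trivializationAt (I := 𝓘(ℝ, E))
    ((chartAt E x).map_target hy)
  have h5 := congrArg (fun L => L (Z ((chartAt E x).symm y))) h4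
  have h6 : (e ⟨(chartAt E x).symm y, Z ((chartAt E x).symm y)⟩).2
    = e.continuousLinearMapAt ℝ _ (Z ((chartAt E x).symm y)) := by
    exact (congrFun (e.coe_linearMapAt_of_mem (R := ℝ) ((chartAt E x).map_target hy)) _).symm
  rw [h6]
  exact h5.symm

/-- A consequence of `d² = 0` for a form with decomposable exterior derivative. -/
lemma OneForm.d_wedge_eq_zero {θ θ₁ θ₂ : OneForm E N} {x : N} (hθ : ∀ᶠ z in 𝓝 x, θ.SmoothAt z)
    (h₁ : θ₁.SmoothAt x) (h₂ : θ₂.SmoothAt x)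
    (h : ∀ᶠ z in 𝓝 x, ∀ v w, θ.d z v w = θ₁ z v * θ₂ z w - θ₁ z w * θ₂ z v)
    (a b c : TangentSpace 𝓘(ℝ, E) x) :
    θ₁.d x a b * θ₂ x c + θ₁.d x b c * θ₂ x a + θ₁.d x c a * θ₂ x b
      - (θ₁ x a * θ₂.d x b c + θ₁ x b * θ₂.d x c a + θ₁ x c * θ₂.d x a b) = 0 := by
  have hx := mem_chart_source E x
  have hev : ∀ᶠ y in 𝓝 (chartAt E x x), ∀ v w : E, flatD (θ.inChart x) y v w
      = θ₁.inChart x y v * θ₂.inChart x y w - θ₁.inChart x y w * θ₂.inChart x y v := by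
    filter_upwards [eventually_chart_target x, (tendsto_chart_symm x).eventually hθ,
      (tendsto_chart_symm x).eventually h] with y hy hy' hy'' v w
    have := hy'' (chartInvDeriv x y v) (chartInvDeriv x y w)
    rw [hy'.d_chart_symm x hy, chartDerivAt_chartInvDeriv x hy,
      chartDerivAt_chartInvDeriv x hy] at this
    exact this
  have hd := (ContDiffAt.fderiv_right (m := ∞) hθ.self_of_nhds (by simp)).differentiableAt
    (by simp)
  have hs := ContDiffAt.isSymmSndFDerivAt hθ.self_of_nhds (by simpa using two_le_infty)
  -- The expression of dθ as a wedge product holds on a neighbourhood, so it may be differentiated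
  -- once more, in the direction `u`.
  have key : ∀ u v w : E, fderiv ℝ (fderiv ℝ (θ.inChart x)) (chartAt E x x) u v w
      - fderiv ℝ (fderiv ℝ (θ.inChart x)) (chartAt E x x) u w v
      = fderiv ℝ (θ₁.inChart x) (chartAt E x x) u v * θ₂.inChart x (chartAt E x x) w
      + θ₁.inChart x (chartAt E x x) v * fderiv ℝ (θ₂.inChart x) (chartAt E x x) u w
      - fderiv ℝ (θ₁.inChart x) (chartAt E x x) u w * θ₂.inChart x (chartAt E x x) v
      - θ₁.inChart x (chartAt E x x) w * fderiv ℝ (θ₂.inChart x) (chartAt E x x) u v := by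
    intro u v w
    have e1 : (fun y => fderiv ℝ (θ.inChart x) y v w - fderiv ℝ (θ.inChart x) y w v)
        =ᶠ[𝓝 (chartAt E x x)] fun y => θ₁.inChart x y v * θ₂.inChart x y w
          - θ₁.inChart x y w * θ₂.inChart x y v := by
      filter_upwards [hev] with y hy using hy v w
    have ap : ∀ {f : E → E →L[ℝ] ℝ} (_ : DifferentiableAt ℝ f (chartAt E x x)) (v : E),
        HasFDerivAt (fun y => f y v) ((fderiv ℝ f (chartAt E x x)).flip v) (chartAt E x x) := by
      intro f hf v
      have := hf.hasFDerivAt.clm_apply (hasFDerivAt_const v (chartAt E x x))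
      simpa using this
    have ap2 : ∀ v w : E, HasFDerivAt (fun y => fderiv ℝ (θ.inChart x) y v w)
        (((fderiv ℝ (fderiv ℝ (θ.inChart x)) (chartAt E x x)).flip v).flip w)
        (chartAt E x x) := by
      intro v w
      have := (hd.hasFDerivAt.clm_apply (hasFDerivAt_const v (chartAt E x x))).clm_apply
        (hasFDerivAt_const w (chartAt E x x))
      simpa using this
    have e2 := ((ap2 v w).sub (ap2 w v)).unique (HasFDerivAt.congr_of_eventuallyEq
      (((ap h₁.differentiableAt v).mul (ap h₂.differentiableAt w)).sub
        ((ap h₁.differentiableAt w).mul (ap h₂.differentiableAt v))) e1)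
    have e3 := congrArg (fun L => L u) e2
    simp at e3
    linarith
  simp only [OneForm.d_apply, flatD, θ₁.apply_eq_inChart x hx, θ₂.apply_eq_inChart x hx]
  generalize chartDerivAt x x a = a, chartDerivAt x x b = b, chartDerivAt x x c = c
  -- In the cyclic sum the second derivatives of θ cancel in pairs, by symmetry in the first two
  -- slots.
  have k1 := key a b c
  have k2 := key b c a
  have k3 := key c a b
  rw [hs a b] at k1
  rw [hs b c] at k2
  rw [hs c a] at k3
  linarith

/-- The factor of proportionality of smooth forms is smooth. -/
lemma contMDiffAt_of_smul_eq {θ τ : OneForm E N} {f : N → ℝ} {x : N} (hθ : θ.SmoothAt x)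
    (hτ : τ.SmoothAt x) (h : ∀ᶠ z in 𝓝 x, τ z = f z • θ z) (hx : θ x ≠ 0) :
    ContMDiffAt 𝓘(ℝ, E) 𝓘(ℝ) ∞ f x := by
  -- A vector that is constant in the chart and on which θ does not vanish near `x` exhibits `f` as
  -- a quotient of smooth functions.
  obtain ⟨v, hv⟩ : ∃ v : E, θ.inChart x (chartAt E x x) v ≠ 0 := by
    by_contra hcon
    push Not at hcon
    apply hx
    ext w
    rw [θ.apply_eq_inChart x (mem_chart_source E x), hcon]
    rfl
  apply contMDiffAt_of_contDiffAt_chart (mem_chart_source E x)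
  have h1 : ContDiffAt ℝ ∞ (fun y => θ.inChart x y v) (chartAt E x x) :=
    ContDiffAt.clm_apply hθ contDiffAt_const
  have h2 : ContDiffAt ℝ ∞ (fun y => τ.inChart x y v) (chartAt E x x) :=
    ContDiffAt.clm_apply hτ contDiffAt_const
  refine (h2.div h1 hv).congr_of_eventuallyEq ?_
  filter_upwards [(tendsto_chart_symm x).eventually h, h1.continuousAt.eventually_ne hv]
    with y hy hy'
  refine (eq_div_iff hy').2 ?_
  change _ = τ _ (chartInvDeriv x y v)
  rw [hy]
  rfl

end Fields

/-- A `2`-form in dimension three is determined by its values on a frame. -/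
lemma OneForm.d_expand {E N : Type*} [NormedAddCommGroup E] [NormedSpace ℝ E]
    [TopologicalSpace N] [ChartedSpace E N] (τ : OneForm E N) {x : N}
    {a b c : TangentSpace 𝓘(ℝ, E) x} {θ₀ θ₁ θ₂ : TangentSpace 𝓘(ℝ, E) x → ℝ}
    (h : ∀ v, v = θ₀ v • a + θ₁ v • b + θ₂ v • c) (v w : TangentSpace 𝓘(ℝ, E) x) :
    τ.d x v w = τ.d x a b * (θ₀ v * θ₁ w - θ₀ w * θ₁ v)
      + τ.d x b c * (θ₁ v * θ₂ w - θ₁ w * θ₂ v) + τ.d x c a * (θ₂ v * θ₀ w - θ₂ w * θ₀ v) := by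
  have self : ∀ a, τ.d x a a = 0 := fun a => by have := τ.d_swap x a a; linarith
  have e1 := τ.d_swap x b a
  have e2 := τ.d_swap x c b
  have e3 := τ.d_swap x a c
  have : τ.d x v w = τ.d x (θ₀ v • a + θ₁ v • b + θ₂ v • c)
      (θ₀ w • a + θ₁ w • b + θ₂ w • c) := by rw [← h v, ← h w]
  rw [this]
  simp only [map_add, map_smul, LinearMap.add_apply, LinearMap.smul_apply, smul_eq_mul, self,
    e1, e2, e3]
  ring

/-! ### Unitary frames on M, their coframes, and the connection form on the base. -/

namespace PositiveContactForm

variable {M : Type*} [TopologicalSpace M] [ChartedSpace E3 M] [IsManifold 𝓘(ℝ, E3) ∞ M]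
  {C : CRStructure M} (η : PositiveContactForm C)

lemma smoothAt_form (x : M) : η.form.SmoothAt x := OneForm.isSmooth_iff.1 η.smooth x

/-- Frames `X, JX` with `dη(X, JX) = 1`. -/
def IsUnitary (F : C.Frame) : Prop :=
  ∀ x ∈ F.dom, F.Y x = C.J x (F.X x) ∧ η.form.d x (F.X x) (F.Y x) = 1

variable {η}

/-- J has no real eigenvector: applying J to a relation s v + t Jv = 0 and eliminating Jv gives (s²
+ t²) v = 0. -/
lemma linearIndependent_pair_J {x : M} {v : C.D x} (hv : v ≠ 0) :
    LinearIndependent ℝ ![v, C.J x v] := by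
  rw [LinearIndependent.pair_iff]
  intro s t h
  have h2 : s • C.J x v - t • v = 0 := by
    have := congrArg (C.J x) h
    rw [map_add, map_smul, map_smul, C.J_sq, map_zero] at this
    rw [← this]; module
  have h3 : (s ^ 2 + t ^ 2) • v = 0 := by
    have : (s ^ 2 + t ^ 2) • v = s • (s • v + t • C.J x v) - t • (s • C.J x v - t • v) := by
      module
    rw [this, h, h2]; simp
  have h4 := (smul_eq_zero.1 h3).resolve_right hv
  constructor <;> nlinarith

variable (η) in
/-- Each ray is spanned by a vector of the form `X + s Y` for some unitary frame. -/
lemma exists_unitary_frame (r : C.Spherization) :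
    ∃ F : C.Frame, η.IsUnitary F ∧ r ∈ F.coords.source := by
  have : IsManifold 𝓘(ℝ, E3) 1 M := IsManifold.of_le (n := ∞) (by norm_num)
  obtain ⟨F, hr, s, hs⟩ := CRStructure.Frame.exists_mem_source r
  -- This field passes through the given ray, so that the ray has slope 0 in the final frame.
  -- Dividing it by √(dη(X, JX)) makes the frame X, JX unitary.
  let X : ∀ x, C.D x := fun x => F.X x + s • F.Y x
  have hX : IsSmoothFieldOn (fun x => (X x : TangentSpace 𝓘(ℝ, E3) x)) F.dom :=
    F.smooth_X.add_section ((contMDiffOn_const (c := s)).smul_section F.smooth_Y)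
  have hX0 : ∀ x ∈ F.dom, X x ≠ 0 := fun x hx => F.ne_zero hx s
  let q : M → ℝ := fun x => η.form.d x (X x) (C.J x (X x))
  have hq : ∀ x ∈ F.dom, 0 < q x := fun x hx => η.pos x _ (hX0 x hx)
  have hJX := C.smooth_J F.dom X F.isOpen_dom hX
  have hqs : ContMDiffOn 𝓘(ℝ, E3) 𝓘(ℝ) ∞ q F.dom := by
    intro x hx
    exact (OneForm.contMDiffAt_d_apply (Eventually.of_forall η.smoothAt_form)
      (smoothFieldAt_of_isSmoothFieldOn F.isOpen_dom hX hx)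
      (smoothFieldAt_of_isSmoothFieldOn F.isOpen_dom hJX hx)).contMDiffWithinAt
  let c : M → ℝ := fun x => (Real.sqrt (q x))⁻¹
  have hc0 : ∀ x ∈ F.dom, 0 < c x := fun x hx => inv_pos.2 (Real.sqrt_pos.2 (hq x hx))
  have hc : ContMDiffOn 𝓘(ℝ, E3) 𝓘(ℝ) ∞ c F.dom := by
    intro x hx
    have h1 : ContDiffAt ℝ ∞ (fun t : ℝ => (Real.sqrt t)⁻¹) (q x) :=
      (Real.contDiffAt_sqrt (hq x hx).ne').inv (Real.sqrt_pos.2 (hq x hx)).ne'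
    exact h1.contMDiffAt.comp_contMDiffWithinAt x (hqs x hx)
  have hcX : IsSmoothFieldOn (fun x => ((c x • X x : C.D x) : TangentSpace 𝓘(ℝ, E3) x)) F.dom :=
    hc.smul_section hX
  refine ⟨⟨F.base, F.dom, F.isOpen_dom, F.dom_subset, fun x => c x • X x,
    fun x => C.J x (c x • X x), hcX, C.smooth_J F.dom _ F.isOpen_dom hcX, fun x hx =>
      linearIndependent_pair_J (smul_ne_zero (hc0 x hx).ne' (hX0 x hx))⟩, ?_, hr, 0, ?_⟩
  · intro x hx
    refine ⟨rfl, ?_⟩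
    change η.form.d x ((c x • X x : C.D x) : TangentSpace 𝓘(ℝ, E3) x)
      ((C.J x (c x • X x) : C.D x) : TangentSpace 𝓘(ℝ, E3) x) = 1
    rw [map_smul]
    simp only [Submodule.coe_smul, map_smul, LinearMap.smul_apply, smul_eq_mul]
    change c x * (c x * q x) = 1
    have h1 : Real.sqrt (q x) ≠ 0 := (Real.sqrt_pos.2 (hq x hx)).ne'
    have h2 := Real.mul_self_sqrt (hq x hx).le
    simp only [c]
    field_simp
    nlinarith
  · rw [hs]
    unfold CRStructure.Frame.point
    congr 1
    have hx : (F.point r.pt s).pt = r.pt := rfl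
    simp only [zero_smul, add_zero]
    exact ((C.mkRay_eq_iff (smul_ne_zero (hc0 _ hr).ne' (hX0 _ hr)) (hX0 _ hr)).2
      ⟨c r.pt, hc0 _ hr, rfl⟩).symm

/-- The coframe dual to a unitary frame and the Reeb direction, with its dual frame. -/
structure UnitaryCoframe (η : PositiveContactForm C) (F : C.Frame) where
  θ : Fin 3 → OneForm E3 M
  e : Fin 3 → ∀ x : M, TangentSpace 𝓘(ℝ, E3) x
  dual : ∀ x ∈ F.dom, ∀ i j, θ i x (e j x) = if i = j then 1 else 0
  expand : ∀ x ∈ F.dom, ∀ v, v = θ 0 x v • e 0 x + θ 1 x v • e 1 x + θ 2 x v • e 2 x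
  θ_zero : ∀ x ∈ F.dom, ∀ v, θ 0 x v = η.form.d x v (F.Y x)
  θ_one : ∀ x ∈ F.dom, ∀ v, θ 1 x v = η.form.d x (F.X x) v
  θ_two : ∀ x ∈ F.dom, θ 2 x = η.form x
  wedge : ∀ x ∈ F.dom, ∀ v w, η.form.d x v w = θ 0 x v * θ 1 x w - θ 0 x w * θ 1 x v

open Classical in
/-- The coframe of a unitary frame. -/
def unitaryCoframe {F : C.Frame} (hF : η.IsUnitary F) : η.UnitaryCoframe F :=
  have h : ∀ x ∈ F.dom, ∃ u : TangentSpace 𝓘(ℝ, E3) x ≃L[ℝ] (Fin 3 → ℝ), η.IsAdapted ⟨x, u⟩ ∧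
      u (F.X x : TangentSpace 𝓘(ℝ, E3) x) = Pi.single 0 1 := fun x hx =>
    η.exists_adapted (F.X x) (by rw [← (hF x hx).1]; exact (hF x hx).2)
  { θ := fun i x => if hx : x ∈ F.dom then (ContinuousLinearMap.proj i).comp
      ((h x hx).choose : TangentSpace 𝓘(ℝ, E3) x →L[ℝ] (Fin 3 → ℝ)) else 0
    e := fun i x => if hx : x ∈ F.dom then (h x hx).choose.symm (Pi.single i 1) else 0
    dual := fun x hx i j => by
      simp [hx, Pi.single_apply]
    expand := fun x hx v => by
      simp only [hx, dite_true]
      apply (h x hx).choose.injective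
      ext i
      fin_cases i <;> simp
    θ_zero := fun x hx v => by
      simp only [hx, dite_true]
      have := η.map_eq_of_first (h x hx).choose_spec.1 (F.X x) (h x hx).choose_spec.2 v
      exact (congrFun this 0).trans (by rw [(hF x hx).1]; rfl)
    θ_one := fun x hx v => by
      simp only [hx, dite_true]
      have := η.map_eq_of_first (h x hx).choose_spec.1 (F.X x) (h x hx).choose_spec.2 v
      exact congrFun this 1
    θ_two := fun x hx => by
      ext v
      simp only [hx, dite_true]
      exact (h x hx).choose_spec.1.third v
    wedge := fun x hx v w => by
      simp only [hx, dite_true]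
      exact (h x hx).choose_spec.1.wedge v w }

namespace UnitaryCoframe

variable {F : C.Frame} (Θ : η.UnitaryCoframe F)

/-- The coframe is chosen point by point, so its smoothness has to come from its formulas: each form
is η itself or an interior product of dη with a field of the frame. -/
lemma smoothAt_θ (i : Fin 3) {x : M} (hx : x ∈ F.dom) : (Θ.θ i).SmoothAt x := by
  have : IsManifold 𝓘(ℝ, E3) 1 M := IsManifold.of_le (n := ∞) (by norm_num)
  have hn := F.isOpen_dom.mem_nhds hx
  have h0 : ∀ z, OneForm.inChart (0 : OneForm E3 M) z = fun _ => 0 := fun z => rfl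
  have hs : ∀ z, (0 : OneForm E3 M).SmoothAt z := fun z => by
    unfold OneForm.SmoothAt
    rw [h0]
    exact contDiffAt_const
  fin_cases i
  -- The interior product lemma puts the field in the first slot, whereas θ₀ = dη(·, Y); the sign is
  -- absorbed by using -η, written as 0 - η.
  · refine OneForm.smoothAt_interior (θ := fun z => (0 : OneForm E3 M) z - η.form z) (τ := Θ.θ 0)
      (Eventually.of_forall fun z => OneForm.SmoothAt.sub (hs z) (η.smoothAt_form z))
      (smoothFieldAt_of_isSmoothFieldOn F.isOpen_dom F.smooth_Y hx) ?_
    filter_upwards [hn] with z hz w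
    rw [OneForm.d_sub (hs z) (η.smoothAt_form z), Θ.θ_zero z hz, η.form.d_swap]
    have : (0 : OneForm E3 M).d z (F.Y z) w = 0 := by
      rw [OneForm.d_apply, flatD, h0]
      simp
    rw [this, zero_sub]
  · refine OneForm.smoothAt_interior (θ := η.form) (τ := Θ.θ 1)
      (Eventually.of_forall η.smoothAt_form)
      (smoothFieldAt_of_isSmoothFieldOn F.isOpen_dom F.smooth_X hx) ?_
    filter_upwards [hn] with z hz w using Θ.θ_one z hz w
  · refine (η.smoothAt_form x).congr ?_
    filter_upwards [hn] with z hz using Θ.θ_two z hz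

lemma smoothFieldAt_e (i : Fin 3) {x : M} (hx : x ∈ F.dom) : SmoothFieldAt (Θ.e i) x :=
  smoothFieldAt_of_dual finrank_euclideanSpace_fin (fun i => Θ.smoothAt_θ i hx)
    (by filter_upwards [F.isOpen_dom.mem_nhds hx] with z hz using Θ.dual z hz) i

/-- A component of the exterior derivative of a form in the dual frame. -/
def comp (τ : OneForm E3 M) (i j : Fin 3) (x : M) : ℝ := τ.d x (Θ.e i x) (Θ.e j x)

lemma contMDiffAt_comp {τ : OneForm E3 M} (hτ : ∀ x ∈ F.dom, τ.SmoothAt x) (i j : Fin 3)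
    {x : M} (hx : x ∈ F.dom) : ContMDiffAt 𝓘(ℝ, E3) 𝓘(ℝ) ∞ (Θ.comp τ i j) x :=
  OneForm.contMDiffAt_d_apply (by filter_upwards [F.isOpen_dom.mem_nhds hx] with z hz using hτ z hz)
    (Θ.smoothFieldAt_e i hx) (Θ.smoothFieldAt_e j hx)

lemma d_expand (τ : OneForm E3 M) {x : M} (hx : x ∈ F.dom) (v w : TangentSpace 𝓘(ℝ, E3) x) :
    τ.d x v w = Θ.comp τ 0 1 x * (Θ.θ 0 x v * Θ.θ 1 x w - Θ.θ 0 x w * Θ.θ 1 x v)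
      + Θ.comp τ 1 2 x * (Θ.θ 1 x v * Θ.θ 2 x w - Θ.θ 1 x w * Θ.θ 2 x v)
      + Θ.comp τ 2 0 x * (Θ.θ 2 x v * Θ.θ 0 x w - Θ.θ 2 x w * Θ.θ 0 x v) :=
  τ.d_expand (Θ.expand x hx) v w

/-- The torsion coefficients. -/
def A₁ (x : M) : ℝ := (1 / 2 : ℝ) * (Θ.comp (Θ.θ 0) 1 2 x - Θ.comp (Θ.θ 1) 2 0 x)

/-- The torsion coefficients. -/
def A₂ (x : M) : ℝ := Θ.comp (Θ.θ 0) 2 0 x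

/-- The `θ²`-coefficient of the connection form. -/
def β₂ (x : M) : ℝ := (1 / 2 : ℝ) * (Θ.comp (Θ.θ 0) 1 2 x + Θ.comp (Θ.θ 1) 2 0 x)

/-- The connection form on the base. -/
def β : OneForm E3 M := fun x =>
  Θ.β₂ x • Θ.θ 2 x - (Θ.comp (Θ.θ 0) 0 1 x • Θ.θ 0 x + Θ.comp (Θ.θ 1) 0 1 x • Θ.θ 1 x)

/-- This is the coefficient of θ₀ ∧ θ₁ ∧ θ₂ in d(dη) = d(θ₀ ∧ θ₁) = 0. It makes the torsion
trace-free, so that the two functions `A₁`, `A₂` describe it completely. -/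
lemma comp_symm {x : M} (hx : x ∈ F.dom) : Θ.comp (Θ.θ 1) 1 2 x = Θ.comp (Θ.θ 0) 2 0 x := by
  have h := OneForm.d_wedge_eq_zero (Eventually.of_forall η.smoothAt_form) (Θ.smoothAt_θ 0 hx)
    (Θ.smoothAt_θ 1 hx)
    (by filter_upwards [F.isOpen_dom.mem_nhds hx] with z hz using Θ.wedge z hz)
    (Θ.e 0 x) (Θ.e 1 x) (Θ.e 2 x)
  simp only [Θ.dual x hx] at h
  simp at h
  unfold comp
  linarith

lemma contMDiffAt_A₁ {x : M} (hx : x ∈ F.dom) : ContMDiffAt 𝓘(ℝ, E3) 𝓘(ℝ) ∞ Θ.A₁ x :=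
  contMDiffAt_const.mul ((Θ.contMDiffAt_comp (fun _ => Θ.smoothAt_θ 0) 1 2 hx).sub
    (Θ.contMDiffAt_comp (fun _ => Θ.smoothAt_θ 1) 2 0 hx))

lemma contMDiffAt_A₂ {x : M} (hx : x ∈ F.dom) : ContMDiffAt 𝓘(ℝ, E3) 𝓘(ℝ) ∞ Θ.A₂ x :=
  Θ.contMDiffAt_comp (fun _ => Θ.smoothAt_θ 0) 2 0 hx

lemma contMDiffAt_β₂ {x : M} (hx : x ∈ F.dom) : ContMDiffAt 𝓘(ℝ, E3) 𝓘(ℝ) ∞ Θ.β₂ x :=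
  contMDiffAt_const.mul ((Θ.contMDiffAt_comp (fun _ => Θ.smoothAt_θ 0) 1 2 hx).add
    (Θ.contMDiffAt_comp (fun _ => Θ.smoothAt_θ 1) 2 0 hx))

lemma smoothAt_β {x : M} (hx : x ∈ F.dom) : Θ.β.SmoothAt x :=
  ((Θ.smoothAt_θ 2 hx).smul (Θ.contMDiffAt_β₂ hx)).sub
    (((Θ.smoothAt_θ 0 hx).smul (Θ.contMDiffAt_comp (fun _ => Θ.smoothAt_θ 0) 0 1 hx)).add
    ((Θ.smoothAt_θ 1 hx).smul (Θ.contMDiffAt_comp (fun _ => Θ.smoothAt_θ 1) 0 1 hx)))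

/-- The coefficients in `β`, `A₁`, `A₂` were obtained by solving this equation together with the one
for θ₁. The θ₀ ∧ θ₁ coefficients give the horizontal part of β; half the sum and half the difference
of the θ₁ ∧ θ₂ coefficient of dθ₀ and the θ₂ ∧ θ₀ coefficient of dθ₁ give `β₂` and `A₁`. -/
lemma d_θ_zero {x : M} (hx : x ∈ F.dom) (v w : TangentSpace 𝓘(ℝ, E3) x) :
    (Θ.θ 0).d x v w = -(Θ.β x v * Θ.θ 1 x w - Θ.β x w * Θ.θ 1 x v)
      + Θ.A₁ x * (Θ.θ 1 x v * Θ.θ 2 x w - Θ.θ 1 x w * Θ.θ 2 x v)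
      + Θ.A₂ x * (Θ.θ 2 x v * Θ.θ 0 x w - Θ.θ 2 x w * Θ.θ 0 x v) := by
  rw [Θ.d_expand _ hx]
  simp only [β, β₂, A₁, A₂, sub_apply, add_apply, smul_apply, smul_eq_mul]
  ring

lemma d_θ_one {x : M} (hx : x ∈ F.dom) (v w : TangentSpace 𝓘(ℝ, E3) x) :
    (Θ.θ 1).d x v w = (Θ.β x v * Θ.θ 0 x w - Θ.β x w * Θ.θ 0 x v)
      + Θ.A₂ x * (Θ.θ 1 x v * Θ.θ 2 x w - Θ.θ 1 x w * Θ.θ 2 x v)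
      - Θ.A₁ x * (Θ.θ 2 x v * Θ.θ 0 x w - Θ.θ 2 x w * Θ.θ 0 x v) := by
  rw [Θ.d_expand _ hx, Θ.comp_symm hx]
  simp only [β, β₂, A₁, A₂, sub_apply, add_apply, smul_apply, smul_eq_mul]
  ring

end UnitaryCoframe
end PositiveContactForm

section Fun

variable {E : Type*} [NormedAddCommGroup E] [NormedSpace ℝ E]
  {N : Type*} [TopologicalSpace N] [ChartedSpace E N] [IsManifold 𝓘(ℝ, E) ∞ N]

lemma dFun_comp {f : N → ℝ} {g : ℝ → ℝ} {g' : ℝ} {x : N}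
    (hf : ContMDiffAt 𝓘(ℝ, E) 𝓘(ℝ) ∞ f x) (hg : HasDerivAt g g' (f x))
    (v : TangentSpace 𝓘(ℝ, E) x) :
    dFun (E := E) (fun z => g (f z)) x v = g' * dFun (E := E) f x v := by
  have h1 := HasMFDerivAt.comp x hg.hasFDerivAt.hasMFDerivAt
    (hf.mdifferentiableAt (by simp)).hasMFDerivAt
  have h2 : mfderiv 𝓘(ℝ, E) 𝓘(ℝ) (fun z => g (f z)) x = _ := h1.mfderiv
  unfold dFun
  rw [h2, mul_comm]
  rfl

end Fun

variable {M : Type*} [TopologicalSpace M] [ChartedSpace E3 M] [IsManifold 𝓘(ℝ, E3) ∞ M]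
  {C : CRStructure M}

/-! ### Charts of SD and of B given by frames, and the angle coordinate on the fibres. -/

namespace CRStructure.Frame

/-- The chart of `SD` given by a frame. -/
def chart (F : C.Frame) : OpenPartialHomeomorph C.Spherization E4 :=
  C.spherizationCore.openPartialHomeomorph F.coords (mem_range_self F)

lemma chart_mem_atlas (F : C.Frame) : F.chart ∈ atlas E4 C.Spherization := by
  change F.chart ∈ ⋃ (e : PartialEquiv C.Spherization E4) (he : e ∈ C.spherizationCore.atlas), _
  simp only [mem_iUnion, mem_singleton_iff]
  exact ⟨F.coords, mem_range_self F, rfl⟩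

end CRStructure.Frame

namespace PositiveContactForm

variable {η : PositiveContactForm C}

/-- The chart of `B` given by a frame. -/
def bundleChart (η : PositiveContactForm C) (F : C.Frame) :
    OpenPartialHomeomorph η.CircleBundle E4 :=
  η.homeoSpherization.toOpenPartialHomeomorph.trans F.chart

lemma bundleChart_mem_atlas (F : C.Frame) :
    η.bundleChart F ∈ atlas E4 η.CircleBundle :=
  ⟨F.chart, F.chart_mem_atlas, rfl⟩

lemma mem_bundleChart_source {F : C.Frame} {u : η.CircleBundle} :
    u ∈ (η.bundleChart F).source ↔ η.toSpherization u ∈ F.coords.source := by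
  unfold bundleChart
  rw [OpenPartialHomeomorph.trans_source]
  exact ⟨fun h => h.2, fun h => ⟨mem_univ _, h⟩⟩

lemma proj_mem_dom {F : C.Frame} {u : η.CircleBundle} (hu : u ∈ (η.bundleChart F).source) :
    CircleBundle.proj u ∈ F.dom := (mem_bundleChart_source.1 hu).1

lemma contMDiffAt_bundleChart {F : C.Frame} {u : η.CircleBundle}
    (hu : u ∈ (η.bundleChart F).source) :
    ContMDiffAt 𝓘(ℝ, E4) 𝓘(ℝ, E4) ∞ (η.bundleChart F) u :=
  contMDiffAt_of_mem_maximalAtlas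
    (IsManifold.subset_maximalAtlas (η.bundleChart_mem_atlas F)) hu

lemma contMDiffAt_chart {F : C.Frame} {r : C.Spherization} (hr : r ∈ F.coords.source) :
    ContMDiffAt 𝓘(ℝ, E4) 𝓘(ℝ, E4) ∞ F.chart r :=
  contMDiffAt_of_mem_maximalAtlas (e := F.chart)
    (IsManifold.subset_maximalAtlas F.chart_mem_atlas) hr

lemma exists_mem_bundleChart_source (u : η.CircleBundle) :
    ∃ F : C.Frame, η.IsUnitary F ∧ u ∈ (η.bundleChart F).source := by
  obtain ⟨F, hF, h⟩ := η.exists_unitary_frame (η.toSpherization u)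
  exact ⟨F, hF, mem_bundleChart_source.2 h⟩

lemma contMDiff_proj :
    ContMDiff 𝓘(ℝ, E4) 𝓘(ℝ, E3) ∞ (CircleBundle.proj (η := η)) := by
  intro u
  obtain ⟨F, -, hu⟩ := exists_mem_bundleChart_source u
  have h1 : ContMDiffAt 𝓘(ℝ, E4) 𝓘(ℝ, E3) ∞ (fun p : E4 => p.1) (η.bundleChart F u) :=
    contDiff_fst.contMDiff.contMDiffAt
  have h2 : ContMDiffAt 𝓘(ℝ, E3) 𝓘(ℝ, E3) ∞ (chartAt E3 F.base).symm (η.bundleChart F u).1 :=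
    (contMDiffOn_chart_symm (I := 𝓘(ℝ, E3)) (n := ∞) (x := F.base)).contMDiffAt
      ((chartAt E3 F.base).open_target.mem_nhds
        ((chartAt E3 F.base).map_source (F.dom_subset (proj_mem_dom hu))))
  have h3 := h2.comp u (h1.comp u (contMDiffAt_bundleChart hu))
  refine h3.congr_of_eventuallyEq ?_
  filter_upwards [(η.bundleChart F).open_source.mem_nhds hu] with z hz
  exact ((chartAt E3 F.base).left_inv (F.dom_subset (proj_mem_dom hz))).symm

/-- The atlas of B is transported along h, so in the two charts of one frame h and its inverse are
the identity. -/
lemma contMDiff_equivSpherization :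
    ContMDiff 𝓘(ℝ, E4) 𝓘(ℝ, E4) ∞ η.equivSpherization := by
  intro u
  obtain ⟨F, -, hu⟩ := exists_mem_bundleChart_source u
  have h2 : ContMDiffAt 𝓘(ℝ, E4) 𝓘(ℝ, E4) ∞ F.chart.symm (η.bundleChart F u) :=
    contMDiffAt_symm_of_mem_maximalAtlas
      (IsManifold.subset_maximalAtlas F.chart_mem_atlas)
      (F.chart.map_source (mem_bundleChart_source.1 hu))
  refine (h2.comp u (contMDiffAt_bundleChart hu)).congr_of_eventuallyEq ?_
  filter_upwards [(η.bundleChart F).open_source.mem_nhds hu] with z hz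
  exact (F.chart.left_inv (mem_bundleChart_source.1 hz)).symm

lemma contMDiff_equivSpherization_symm :
    ContMDiff 𝓘(ℝ, E4) 𝓘(ℝ, E4) ∞ η.equivSpherization.symm := by
  intro r
  obtain ⟨F, -, hu⟩ := exists_mem_bundleChart_source (η.equivSpherization.symm r)
  have hr : r ∈ F.coords.source := by
    have := mem_bundleChart_source.1 hu
    rwa [show η.toSpherization (η.equivSpherization.symm r) = r from
      η.equivSpherization.apply_symm_apply r] at this
  have h2 : ContMDiffAt 𝓘(ℝ, E4) 𝓘(ℝ, E4) ∞ (η.bundleChart F).symm (F.chart r) :=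
    contMDiffAt_symm_of_mem_maximalAtlas
      (IsManifold.subset_maximalAtlas (η.bundleChart_mem_atlas F))
      (by
        have := (η.bundleChart F).map_source hu
        rwa [show η.bundleChart F (η.equivSpherization.symm r) = F.chart r from
          congrArg F.chart (η.equivSpherization.apply_symm_apply r)] at this)
  refine (h2.comp r (contMDiffAt_chart hr)).congr_of_eventuallyEq ?_
  filter_upwards [F.chart.open_source.mem_nhds (show r ∈ F.chart.source from hr)] with z hz
  change _ = η.equivSpherization.symm (F.chart.symm (F.chart z))
  rw [F.chart.left_inv hz]

/-- The angle of an adapted coframe with respect to a unitary frame. -/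
def angle (η : PositiveContactForm C) (F : C.Frame) (u : η.CircleBundle) : ℝ :=
  Real.arctan (F.slope (η.toSpherization u))

lemma contMDiffAt_slope {F : C.Frame} {u : η.CircleBundle}
    (hu : u ∈ (η.bundleChart F).source) :
    ContMDiffAt 𝓘(ℝ, E4) 𝓘(ℝ) ∞ (fun u => F.slope (η.toSpherization u)) u := by
  have h1 : ContMDiffAt 𝓘(ℝ, E4) 𝓘(ℝ) ∞ (fun p : E4 => p.2) (η.bundleChart F u) :=
    contDiff_snd.contMDiff.contMDiffAt
  exact h1.comp u (contMDiffAt_bundleChart hu)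

/-- The chart of a frame contains only the rays of the form X + sY, an open half circle over each
point, so the arctangent of the slope is a smooth angle on all of it. -/
lemma contMDiffAt_angle {F : C.Frame} {u : η.CircleBundle}
    (hu : u ∈ (η.bundleChart F).source) : ContMDiffAt 𝓘(ℝ, E4) 𝓘(ℝ) ∞ (η.angle F) u :=
  (Real.contDiff_arctan.contMDiff.contMDiffAt).comp u (contMDiffAt_slope hu)

lemma contMDiffAt_cos_angle {F : C.Frame} {u : η.CircleBundle}
    (hu : u ∈ (η.bundleChart F).source) :
    ContMDiffAt 𝓘(ℝ, E4) 𝓘(ℝ) ∞ (fun u => Real.cos (η.angle F u)) u :=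
  (Real.contDiff_cos.contMDiff.contMDiffAt).comp u (contMDiffAt_angle hu)

lemma contMDiffAt_sin_angle {F : C.Frame} {u : η.CircleBundle}
    (hu : u ∈ (η.bundleChart F).source) :
    ContMDiffAt 𝓘(ℝ, E4) 𝓘(ℝ) ∞ (fun u => Real.sin (η.angle F u)) u :=
  (Real.contDiff_sin.contMDiff.contMDiffAt).comp u (contMDiffAt_angle hu)

/-- The components of the chart are the coordinates of the base point and the slope. Since the
derivative of a chart is bijective, this splitting yields both the surjectivity of dπ and the fact
that ds detects vertical vectors. -/
lemma mfderiv_bundleChart {F : C.Frame} {u : η.CircleBundle}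
    (hu : u ∈ (η.bundleChart F).source) (w : TangentSpace 𝓘(ℝ, E4) u) :
    (mfderiv 𝓘(ℝ, E4) 𝓘(ℝ, E4) (η.bundleChart F) u w : E4)
      = (chartDerivAt F.base (CircleBundle.proj u)
          (mfderiv 𝓘(ℝ, E4) 𝓘(ℝ, E3) CircleBundle.proj u w),
        dFun (E := E4) (fun u => F.slope (η.toSpherization u)) u w) := by
  have hc := (contMDiffAt_bundleChart hu).mdifferentiableAt (by simp)
  have h1 : mfderiv 𝓘(ℝ, E4) 𝓘(ℝ, E3) (fun z => (η.bundleChart F z).1) u = _ :=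
    mfderiv_comp u (ContinuousLinearMap.fst ℝ E3 ℝ).differentiableAt.mdifferentiableAt hc
  have h2 : mfderiv 𝓘(ℝ, E4) 𝓘(ℝ) (fun z => (η.bundleChart F z).2) u = _ :=
    mfderiv_comp u (ContinuousLinearMap.snd ℝ E3 ℝ).differentiableAt.mdifferentiableAt hc
  have f1 : mfderiv 𝓘(ℝ, E4) 𝓘(ℝ, E3) (Prod.fst : E4 → E3) (η.bundleChart F u)
      = ContinuousLinearMap.fst ℝ E3 ℝ := (ContinuousLinearMap.fst ℝ E3 ℝ).mfderiv_eq
  have f2 : mfderiv 𝓘(ℝ, E4) 𝓘(ℝ) (Prod.snd : E4 → ℝ) (η.bundleChart F u)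
      = ContinuousLinearMap.snd ℝ E3 ℝ := (ContinuousLinearMap.snd ℝ E3 ℝ).mfderiv_eq
  rw [f1] at h1
  rw [f2] at h2
  have hp := (contMDiff_proj (η := η) u).mdifferentiableAt (by simp)
  have h3 : mfderiv 𝓘(ℝ, E4) 𝓘(ℝ, E3)
      (fun z : η.CircleBundle => chartAt E3 F.base (CircleBundle.proj z)) u = _ :=
    mfderiv_comp u ((mdifferentiable_chartAt F.base).mdifferentiableAt
      (F.dom_subset (proj_mem_dom hu))) hp
  refine Prod.ext ?_ ?_
  · exact congrArg (fun L => L w) (h1.symm.trans h3)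
  · exact (congrArg (fun L => L w) h2).symm

lemma mfderiv_bundleChart_bijective {F : C.Frame} {u : η.CircleBundle}
    (hu : u ∈ (η.bundleChart F).source) :
    Function.Bijective (mfderiv 𝓘(ℝ, E4) 𝓘(ℝ, E4) (η.bundleChart F) u) := by
  have : IsManifold 𝓘(ℝ, E4) 1 η.CircleBundle := IsManifold.of_le (n := ∞) (by norm_num)
  exact (mdifferentiable_of_mem_atlas (η.bundleChart_mem_atlas F)).mfderiv_bijective hu

lemma mfderiv_proj_surjective (u : η.CircleBundle) :
    Function.Surjective (mfderiv 𝓘(ℝ, E4) 𝓘(ℝ, E3) (CircleBundle.proj (η := η)) u) := by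
  intro v
  obtain ⟨F, -, hu⟩ := exists_mem_bundleChart_source u
  obtain ⟨w, hw⟩ := (mfderiv_bundleChart_bijective hu).2
    ((chartDerivAt F.base (CircleBundle.proj u) v, 0) : E4)
  refine ⟨w, ?_⟩
  have h := (mfderiv_bundleChart hu w).symm.trans hw
  exact ((mdifferentiable_chartAt F.base).mfderiv_bijective
    (F.dom_subset (proj_mem_dom hu))).1 (congrArg Prod.fst h)

lemma eq_zero_of_vertical {F : C.Frame} {u : η.CircleBundle}
    (hu : u ∈ (η.bundleChart F).source) {w : TangentSpace 𝓘(ℝ, E4) u}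
    (h1 : mfderiv 𝓘(ℝ, E4) 𝓘(ℝ, E3) CircleBundle.proj u w = 0)
    (h2 : dFun (E := E4) (fun u => F.slope (η.toSpherization u)) u w = 0) : w = 0 := by
  apply (mfderiv_bundleChart_bijective hu).1
  have h := mfderiv_bundleChart hu w
  rw [h1, h2, map_zero] at h
  rw [map_zero]
  exact h

/-- An adapted coframe in terms of its angle with respect to a unitary frame. -/
lemma map_eq_rotation {F : C.Frame} (hF : η.IsUnitary F) (Θ : η.UnitaryCoframe F)
    {u : η.CircleBundle} (hu : u ∈ (η.bundleChart F).source)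
    (w : TangentSpace 𝓘(ℝ, E3) u.1.pt) :
    u.1.map w = ![Real.cos (η.angle F u) * Θ.θ 0 u.1.pt w + Real.sin (η.angle F u) * Θ.θ 1 u.1.pt w,
      Real.cos (η.angle F u) * Θ.θ 1 u.1.pt w - Real.sin (η.angle F u) * Θ.θ 0 u.1.pt w,
      η.form u.1.pt w] := by
  obtain ⟨hx, s, hs⟩ := mem_bundleChart_source.1 hu
  change u.1.pt ∈ F.dom at hx
  have hs' : F.slope (η.toSpherization u) = s := by
    rw [hs]; exact F.slope_point hx s
  have hray : C.mkRay u.1.pt u.firstVector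
      = C.mkRay u.1.pt (F.X u.1.pt + s • F.Y u.1.pt) := by
    rw [C.mkRay_of_ne u.firstVector_ne_zero]
    have hs2 : (⟨u.1.pt, rayOfNeZero ℝ u.firstVector u.firstVector_ne_zero⟩ : C.Spherization)
      = ⟨u.1.pt, C.mkRay u.1.pt (F.X u.1.pt + s • F.Y u.1.pt)⟩ := hs
    simpa using hs2
  obtain ⟨r, hr, hv⟩ := (C.mkRay_eq_iff u.firstVector_ne_zero (F.ne_zero hx s)).1 hray
  obtain ⟨hY, hXY⟩ := hF _ hx
  have hJ : C.J u.1.pt u.firstVector = r • (F.Y u.1.pt - s • F.X u.1.pt) := by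
    rw [hv, map_smul, map_add, map_smul, ← hY]
    congr 2
    rw [hY, C.J_sq]
    module
  have sw := η.form.d_swap u.1.pt
  have self : ∀ a, η.form.d u.1.pt a a = 0 := fun a => by have := sw a a; linarith
  have hYX : η.form.d u.1.pt (F.Y u.1.pt) (F.X u.1.pt) = -1 := by rw [sw, hXY]
  have hn : η.form.d u.1.pt u.firstVector (C.J u.1.pt u.firstVector) = 1 := by
    rw [u.2.metric, u.map_firstVector]
    simp
  -- The first vector r(X + sY) has unit length for the metric dη(·, J·), and X, Y are orthonormal
  -- for it.
  have hr2 : r ^ 2 * (1 + s ^ 2) = 1 := by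
    rw [hJ, hv] at hn
    simp only [Submodule.coe_smul, Submodule.coe_add, Submodule.coe_sub, map_smul, map_add,
      map_sub, LinearMap.smul_apply, LinearMap.add_apply, smul_eq_mul, self, hXY, hYX] at hn
    linear_combination hn
  -- The cosine of arctan s is 1/√(1 + s²), and r > 0 selects the right square root in the previous
  -- identity.
  have hcos : Real.cos (η.angle F u) = r := by
    unfold angle
    rw [hs', Real.cos_arctan, eq_comm, eq_div_iff (by positivity)]
    have h0 : 0 < r * √(1 + s ^ 2) := by positivity
    have h1 : (r * √(1 + s ^ 2)) ^ 2 = 1 := by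
      rw [mul_pow, Real.sq_sqrt (by positivity), hr2]
    nlinarith
  have hsin : Real.sin (η.angle F u) = r * s := by
    rw [← hcos]
    unfold angle
    rw [hs', Real.cos_arctan, Real.sin_arctan]
    ring
  rw [η.map_eq_of_first u.2 u.firstVector u.map_firstVector, hcos, hsin, hJ, hv,
    Θ.θ_zero _ hx, Θ.θ_one _ hx]
  simp only [Submodule.coe_smul, Submodule.coe_add, Submodule.coe_sub, map_smul, map_add,
      map_sub, LinearMap.smul_apply, LinearMap.add_apply, smul_eq_mul]
  rw [sw w (F.X u.1.pt)]
  congr 1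
  · ring
  · congr 1
    rw [sw w (F.Y u.1.pt)]
    ring

end PositiveContactForm

lemma OneForm.wedge_apply {E N : Type*} [NormedAddCommGroup E] [NormedSpace ℝ E]
    [TopologicalSpace N] [ChartedSpace E N] (α β : OneForm E N) (x : N)
    (v w : TangentSpace 𝓘(ℝ, E) x) : α.wedge β x v w = α x v * β x w - α x w * β x v := by
  unfold OneForm.wedge OneForm.tensor
  simp
  ring

/-! ### The structure equations on B: uniqueness at a point, local solutions, gluing. -/

variable {M : Type*} [TopologicalSpace M] [ChartedSpace E3 M] [IsManifold 𝓘(ℝ, E3) ∞ M]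
  {C : CRStructure M}

namespace PositiveContactForm

variable {η : PositiveContactForm C}

/-- The value of `ωⁱ ∧ ωʲ`. -/
def ww (i j : Fin 3) (u : η.CircleBundle) (v w : TangentSpace 𝓘(ℝ, E4) u) : ℝ :=
  η.tautological i u v * η.tautological j u w - η.tautological i u w * η.tautological j u v

/-- The first structure equation at a point. -/
structure FirstAt (u : η.CircleBundle) (α : TangentSpace 𝓘(ℝ, E4) u →L[ℝ] ℝ) (a₁ a₂ : ℝ) :
    Prop where
  d_ω₁ : ∀ v w, (η.tautological 0).d u v w
    = -(α v * η.tautological 1 u w - α w * η.tautological 1 u v)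
      + a₁ * ww 1 2 u v w + a₂ * ww 2 0 u v w
  d_ω₂ : ∀ v w, (η.tautological 1).d u v w
    = (α v * η.tautological 0 u w - α w * η.tautological 0 u v)
      + a₂ * ww 1 2 u v w - a₁ * ww 2 0 u v w

/-- Vectors dual to the tautological forms. -/
lemma exists_dual (u : η.CircleBundle) : ∃ e : Fin 3 → TangentSpace 𝓘(ℝ, E4) u,
    ∀ i j, η.tautological i u (e j) = if i = j then 1 else 0 := by
  have h : ∀ j : Fin 3, ∃ w : TangentSpace 𝓘(ℝ, E4) u,
      mfderiv 𝓘(ℝ, E4) 𝓘(ℝ, E3) (CircleBundle.proj (η := η)) u w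
        = u.1.map.symm (Pi.single j 1) := fun j => mfderiv_proj_surjective u _
  choose e he using h
  refine ⟨e, fun i j => ?_⟩
  change u.1.map (mfderiv 𝓘(ℝ, E4) 𝓘(ℝ, E3) (CircleBundle.proj (η := η)) u (e j)) i = _
  rw [he]
  have := u.1.map.apply_symm_apply (Pi.single j 1)
  rw [this, Pi.single_apply]

/-- Evaluating on vectors dual to ω₀, ω₁, ω₂ isolates a₂, and both α(e₂) + a₁ and α(e₂) - a₁. Then
α(e₁) is known too, and with the second argument e₁ the first equation determines α on every vector.
-/
lemma FirstAt.unique {u : η.CircleBundle} {α α' : TangentSpace 𝓘(ℝ, E4) u →L[ℝ] ℝ}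
    {a₁ a₂ a₁' a₂' : ℝ} (h : FirstAt u α a₁ a₂) (h' : FirstAt u α' a₁' a₂') :
    α = α' ∧ a₁ = a₁' ∧ a₂ = a₂' := by
  obtain ⟨e, he⟩ := exists_dual u
  have k1 := fun v w => (h.d_ω₁ v w).symm.trans (h'.d_ω₁ v w)
  have k2 := fun v w => (h.d_ω₂ v w).symm.trans (h'.d_ω₂ v w)
  unfold ww at k1 k2
  have p1 := fun w => k1 w (e 1)
  have p2 := fun w => k2 w (e 0)
  have p3 := k1 (e 2) (e 0)
  have q0 := p1 (e 0)
  have q2 := p1 (e 2)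
  have r1 := p2 (e 1)
  have r2 := p2 (e 2)
  simp [he] at p1 p2 p3 q0 q2 r1 r2
  have ha1 : a₁ = a₁' := by linarith
  have ha2 : a₂ = a₂' := by linarith
  refine ⟨?_, ha1, ha2⟩
  subst ha1 ha2
  ext w
  have := p1 w
  have s1 : α (e 1) = α' (e 1) := by linarith
  rw [s1] at this
  linarith

lemma firstStructureEquation_iff {α : OneForm E4 η.CircleBundle} {a₁ a₂ : η.CircleBundle → ℝ} :
    η.FirstStructureEquation α a₁ a₂ ↔ α.IsSmooth ∧ IsSmoothFun (E := E4) a₁ ∧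
      IsSmoothFun (E := E4) a₂ ∧ (∀ u, FirstAt u (α u) (a₁ u) (a₂ u)) ∧
      ∀ u v w, (η.tautological 2).d u v w = ww 0 1 u v w := by
  constructor
  · rintro ⟨h1, h2, h3, h4, h5, h6⟩
    refine ⟨h1, h2, h3, fun u => ⟨fun v w => ?_, fun v w => ?_⟩, fun u v w => ?_⟩
    · rw [h4 u]
      simp only [LinearMap.add_apply, LinearMap.neg_apply, LinearMap.smul_apply, smul_eq_mul,
        OneForm.wedge_apply, ww]
    · rw [h5 u]
      simp only [LinearMap.add_apply, LinearMap.sub_apply, LinearMap.smul_apply, smul_eq_mul,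
        OneForm.wedge_apply, ww]
    · rw [h6 u, OneForm.wedge_apply, ww]
  · rintro ⟨h1, h2, h3, h4, h5⟩
    refine ⟨h1, h2, h3, fun u => ?_, fun u => ?_, fun u => ?_⟩
    · ext v w
      rw [(h4 u).d_ω₁]
      simp only [LinearMap.add_apply, LinearMap.neg_apply, LinearMap.smul_apply, smul_eq_mul,
        OneForm.wedge_apply, ww]
    · ext v w
      rw [(h4 u).d_ω₂]
      simp only [LinearMap.add_apply, LinearMap.sub_apply, LinearMap.smul_apply, smul_eq_mul,
        OneForm.wedge_apply, ww]
    · ext v w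
      rw [h5, OneForm.wedge_apply, ww]

lemma tautological_two_eq : η.tautological 2 = η.form.pullback CircleBundle.proj := by
  funext u
  ext w
  exact u.2.third _

lemma smoothAt_tautological_two (u : η.CircleBundle) : (η.tautological 2).SmoothAt u := by
  rw [tautological_two_eq]
  exact (η.smoothAt_form _).pullback (contMDiff_proj u)

/-- Since ω₂ = π*η, this is the condition dη = u¹ ∧ u² in the definition of an adapted coframe,
pulled back to B. -/
lemma d_tautological_two (u : η.CircleBundle) (v w : TangentSpace 𝓘(ℝ, E4) u) :
    (η.tautological 2).d u v w = ww 0 1 u v w := by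
  rw [tautological_two_eq, OneForm.d_pullback (contMDiff_proj u) (η.smoothAt_form _)]
  exact u.2.wedge _ _

namespace UnitaryCoframe

variable {F : C.Frame} (Θ : η.UnitaryCoframe F)

/-- The pullback to `B` of the coframe. -/
def lift (i : Fin 3) : OneForm E4 η.CircleBundle := (Θ.θ i).pullback CircleBundle.proj

/-- The local expression of the connection form. -/
def connection : OneForm E4 η.CircleBundle := fun u =>
  Θ.β.pullback CircleBundle.proj u - dFun (E := E4) (η.angle F) u

lemma smoothAt_lift (i : Fin 3) {u : η.CircleBundle} (hu : u ∈ (η.bundleChart F).source) :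
    (Θ.lift i).SmoothAt u :=
  (Θ.smoothAt_θ i (proj_mem_dom hu)).pullback (contMDiff_proj u)

lemma smoothAt_connection {u : η.CircleBundle} (hu : u ∈ (η.bundleChart F).source) :
    Θ.connection.SmoothAt u :=
  ((Θ.smoothAt_β (proj_mem_dom hu)).pullback (contMDiff_proj u)).sub
    (smoothAt_dFun (contMDiffAt_angle hu))

lemma tautological_zero (hF : η.IsUnitary F)
    {u : η.CircleBundle} (hu : u ∈ (η.bundleChart F).source) :
    η.tautological 0 u = Real.cos (η.angle F u) • Θ.lift 0 u
      + Real.sin (η.angle F u) • Θ.lift 1 u := by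
  ext w
  exact congrFun (map_eq_rotation hF Θ hu
    (mfderiv 𝓘(ℝ, E4) 𝓘(ℝ, E3) CircleBundle.proj u w)) 0

lemma tautological_one (hF : η.IsUnitary F)
    {u : η.CircleBundle} (hu : u ∈ (η.bundleChart F).source) :
    η.tautological 1 u = Real.cos (η.angle F u) • Θ.lift 1 u
      - Real.sin (η.angle F u) • Θ.lift 0 u := by
  ext w
  exact congrFun (map_eq_rotation hF Θ hu
    (mfderiv 𝓘(ℝ, E4) 𝓘(ℝ, E3) CircleBundle.proj u w)) 1

lemma tautological_two {u : η.CircleBundle} (hu : u ∈ (η.bundleChart F).source) :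
    η.tautological 2 u = Θ.lift 2 u := by
  rw [tautological_two_eq, lift, OneForm.pullback, OneForm.pullback, Θ.θ_two _ (proj_mem_dom hu)]

lemma smoothAt_tautological_zero (hF : η.IsUnitary F) (Θ : η.UnitaryCoframe F)
    {u : η.CircleBundle} (hu : u ∈ (η.bundleChart F).source) :
    (η.tautological 0).SmoothAt u := by
  refine OneForm.SmoothAt.congr (((Θ.smoothAt_lift 0 hu).smul (contMDiffAt_cos_angle hu)).add
    ((Θ.smoothAt_lift 1 hu).smul (contMDiffAt_sin_angle hu))) ?_
  filter_upwards [(η.bundleChart F).open_source.mem_nhds hu] with z hz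
  exact Θ.tautological_zero hF hz

lemma smoothAt_tautological_one (hF : η.IsUnitary F) (Θ : η.UnitaryCoframe F)
    {u : η.CircleBundle} (hu : u ∈ (η.bundleChart F).source) :
    (η.tautological 1).SmoothAt u := by
  refine OneForm.SmoothAt.congr (((Θ.smoothAt_lift 1 hu).smul (contMDiffAt_cos_angle hu)).sub
    ((Θ.smoothAt_lift 0 hu).smul (contMDiffAt_sin_angle hu))) ?_
  filter_upwards [(η.bundleChart F).open_source.mem_nhds hu] with z hz
  exact Θ.tautological_one hF hz

lemma dFun_cos_angle {u : η.CircleBundle} (hu : u ∈ (η.bundleChart F).source)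
    (v : TangentSpace 𝓘(ℝ, E4) u) :
    dFun (E := E4) (fun u => Real.cos (η.angle F u)) u v
      = -Real.sin (η.angle F u) * dFun (E := E4) (η.angle F) u v :=
  dFun_comp (contMDiffAt_angle hu) (Real.hasDerivAt_cos _) v

lemma dFun_sin_angle {u : η.CircleBundle} (hu : u ∈ (η.bundleChart F).source)
    (v : TangentSpace 𝓘(ℝ, E4) u) :
    dFun (E := E4) (fun u => Real.sin (η.angle F u)) u v
      = Real.cos (η.angle F u) * dFun (E := E4) (η.angle F) u v :=
  dFun_comp (contMDiffAt_angle hu) (Real.hasDerivAt_sin _) v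

lemma d_lift (i : Fin 3) {u : η.CircleBundle} (hu : u ∈ (η.bundleChart F).source)
    (v w : TangentSpace 𝓘(ℝ, E4) u) :
    (Θ.lift i).d u v w = (Θ.θ i).d (CircleBundle.proj u)
      (mfderiv 𝓘(ℝ, E4) 𝓘(ℝ, E3) CircleBundle.proj u v)
      (mfderiv 𝓘(ℝ, E4) 𝓘(ℝ, E3) CircleBundle.proj u w) :=
  OneForm.d_pullback (contMDiff_proj u) (Θ.smoothAt_θ i (proj_mem_dom hu)) v w

/-- The local expression of `a₁`. -/
def a₁ (u : η.CircleBundle) : ℝ :=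
  (Real.cos (η.angle F u) ^ 2 - Real.sin (η.angle F u) ^ 2) * Θ.A₁ (CircleBundle.proj u)
    + 2 * Real.cos (η.angle F u) * Real.sin (η.angle F u) * Θ.A₂ (CircleBundle.proj u)

/-- The local expression of `a₂`. -/
def a₂ (u : η.CircleBundle) : ℝ :=
  (Real.cos (η.angle F u) ^ 2 - Real.sin (η.angle F u) ^ 2) * Θ.A₂ (CircleBundle.proj u)
    - 2 * Real.cos (η.angle F u) * Real.sin (η.angle F u) * Θ.A₁ (CircleBundle.proj u)

lemma contMDiffAt_lift {f : M → ℝ} (hf : ∀ x ∈ F.dom, ContMDiffAt 𝓘(ℝ, E3) 𝓘(ℝ) ∞ f x)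
    {u : η.CircleBundle} (hu : u ∈ (η.bundleChart F).source) :
    ContMDiffAt 𝓘(ℝ, E4) 𝓘(ℝ) ∞ (fun u : η.CircleBundle => f (CircleBundle.proj u)) u :=
  (hf _ (proj_mem_dom hu)).comp u (contMDiff_proj u)

lemma contMDiffAt_a₁ {u : η.CircleBundle} (hu : u ∈ (η.bundleChart F).source) :
    ContMDiffAt 𝓘(ℝ, E4) 𝓘(ℝ) ∞ (Θ.a₁ (η := η)) u :=
  ((((contMDiffAt_cos_angle hu).pow 2).sub ((contMDiffAt_sin_angle hu).pow 2)).mul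
    (contMDiffAt_lift (fun _ => Θ.contMDiffAt_A₁) hu)).add
    (((contMDiffAt_const.mul (contMDiffAt_cos_angle hu)).mul (contMDiffAt_sin_angle hu)).mul
    (contMDiffAt_lift (fun _ => Θ.contMDiffAt_A₂) hu))

lemma contMDiffAt_a₂ {u : η.CircleBundle} (hu : u ∈ (η.bundleChart F).source) :
    ContMDiffAt 𝓘(ℝ, E4) 𝓘(ℝ) ∞ (Θ.a₂ (η := η)) u :=
  ((((contMDiffAt_cos_angle hu).pow 2).sub ((contMDiffAt_sin_angle hu).pow 2)).mul
    (contMDiffAt_lift (fun _ => Θ.contMDiffAt_A₂) hu)).sub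
    (((contMDiffAt_const.mul (contMDiffAt_cos_angle hu)).mul (contMDiffAt_sin_angle hu)).mul
    (contMDiffAt_lift (fun _ => Θ.contMDiffAt_A₁) hu))

/-- Differentiating the rotated coframe adds dφ ∧ ω₁ to dω₀ and -dφ ∧ ω₀ to dω₁, which is absorbed
by replacing β with β - dφ. The torsion pair is rotated through twice the angle, whence the
quadratic expressions in `a₁` and `a₂`. -/
lemma firstAt (hF : η.IsUnitary F) {u : η.CircleBundle} (hu : u ∈ (η.bundleChart F).source) :
    FirstAt u (Θ.connection u) (Θ.a₁ u) (Θ.a₂ u) := by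
  have hn := (η.bundleChart F).open_source.mem_nhds hu
  have hx := proj_mem_dom hu
  have hcs := Real.sin_sq_add_cos_sq (η.angle F u)
  have hs : Real.sin (η.angle F u) ^ 2 = 1 - Real.cos (η.angle F u) ^ 2 := by linarith
  have t0 : ∀ w, η.tautological 0 u w = Real.cos (η.angle F u) * Θ.lift 0 u w
      + Real.sin (η.angle F u) * Θ.lift 1 u w := fun w => by
    rw [Θ.tautological_zero hF hu]; rfl
  have t1 : ∀ w, η.tautological 1 u w = Real.cos (η.angle F u) * Θ.lift 1 u w
      - Real.sin (η.angle F u) * Θ.lift 0 u w := fun w => by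
    rw [Θ.tautological_one hF hu]; rfl
  have t2 : ∀ w, η.tautological 2 u w = Θ.lift 2 u w := fun w => by
    rw [Θ.tautological_two hu]
  have hc : ∀ w, Θ.connection u w = Θ.β.pullback CircleBundle.proj u w
      - dFun (E := E4) (η.angle F) u w := fun w => rfl
  have l : ∀ i w, Θ.θ i (CircleBundle.proj u)
    (mfderiv 𝓘(ℝ, E4) 𝓘(ℝ, E3) CircleBundle.proj u w) = Θ.lift i u w := fun i w => rfl
  have lb : ∀ w, Θ.β (CircleBundle.proj u)
    (mfderiv 𝓘(ℝ, E4) 𝓘(ℝ, E3) CircleBundle.proj u w)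
      = Θ.β.pullback CircleBundle.proj u w := fun w => rfl
  constructor
  · intro v w
    have h : (η.tautological 0).d u = OneForm.d (fun z => Real.cos (η.angle F z) • Θ.lift 0 z
        + Real.sin (η.angle F z) • Θ.lift 1 z) u :=
      OneForm.d_congr (by filter_upwards [hn] with z hz using Θ.tautological_zero hF hz)
    rw [h, OneForm.d_add ((Θ.smoothAt_lift 0 hu).smul (contMDiffAt_cos_angle hu))
      ((Θ.smoothAt_lift 1 hu).smul (contMDiffAt_sin_angle hu)),
      OneForm.d_smul (contMDiffAt_cos_angle hu) (Θ.smoothAt_lift 0 hu),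
      OneForm.d_smul (contMDiffAt_sin_angle hu) (Θ.smoothAt_lift 1 hu),
      Θ.d_lift 0 hu, Θ.d_lift 1 hu, Θ.d_θ_zero hx, Θ.d_θ_one hx,
      dFun_cos_angle hu, dFun_cos_angle hu, dFun_sin_angle hu, dFun_sin_angle hu]
    simp only [ww, t0, t1, t2, hc, l, lb, a₁, a₂]
    ring_nf
    simp only [hs, show Real.sin (η.angle F u) ^ 3
      = Real.sin (η.angle F u) * (1 - Real.cos (η.angle F u) ^ 2) by
        rw [← hs]; ring]
    ring
  · intro v w
    have h : (η.tautological 1).d u = OneForm.d (fun z => Real.cos (η.angle F z) • Θ.lift 1 z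
        - Real.sin (η.angle F z) • Θ.lift 0 z) u :=
      OneForm.d_congr (by filter_upwards [hn] with z hz using Θ.tautological_one hF hz)
    rw [h, OneForm.d_sub ((Θ.smoothAt_lift 1 hu).smul (contMDiffAt_cos_angle hu))
      ((Θ.smoothAt_lift 0 hu).smul (contMDiffAt_sin_angle hu)),
      OneForm.d_smul (contMDiffAt_cos_angle hu) (Θ.smoothAt_lift 1 hu),
      OneForm.d_smul (contMDiffAt_sin_angle hu) (Θ.smoothAt_lift 0 hu),
      Θ.d_lift 0 hu, Θ.d_lift 1 hu, Θ.d_θ_zero hx, Θ.d_θ_one hx,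
      dFun_cos_angle hu, dFun_cos_angle hu, dFun_sin_angle hu, dFun_sin_angle hu]
    simp only [ww, t0, t1, t2, hc, l, lb, a₁, a₂]
    ring_nf
    simp only [hs, show Real.sin (η.angle F u) ^ 3
      = Real.sin (η.angle F u) * (1 - Real.cos (η.angle F u) ^ 2) by
        rw [← hs]; ring]
    ring

/-- The local expression of `b₁`. -/
def b₁ (u : η.CircleBundle) : ℝ :=
  Real.cos (η.angle F u) * Θ.comp Θ.β 1 2 (CircleBundle.proj u)
    + Real.sin (η.angle F u) * Θ.comp Θ.β 2 0 (CircleBundle.proj u)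

/-- The local expression of `b₂`. -/
def b₂ (u : η.CircleBundle) : ℝ :=
  Real.cos (η.angle F u) * Θ.comp Θ.β 2 0 (CircleBundle.proj u)
    - Real.sin (η.angle F u) * Θ.comp Θ.β 1 2 (CircleBundle.proj u)

lemma contMDiffAt_b₁ {u : η.CircleBundle} (hu : u ∈ (η.bundleChart F).source) :
    ContMDiffAt 𝓘(ℝ, E4) 𝓘(ℝ) ∞ (Θ.b₁ (η := η)) u :=
  ((contMDiffAt_cos_angle hu).mul
    (contMDiffAt_lift (fun _ => Θ.contMDiffAt_comp (fun _ => Θ.smoothAt_β) 1 2) hu)).add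
    ((contMDiffAt_sin_angle hu).mul
    (contMDiffAt_lift (fun _ => Θ.contMDiffAt_comp (fun _ => Θ.smoothAt_β) 2 0) hu))

lemma contMDiffAt_b₂ {u : η.CircleBundle} (hu : u ∈ (η.bundleChart F).source) :
    ContMDiffAt 𝓘(ℝ, E4) 𝓘(ℝ) ∞ (Θ.b₂ (η := η)) u :=
  ((contMDiffAt_cos_angle hu).mul
    (contMDiffAt_lift (fun _ => Θ.contMDiffAt_comp (fun _ => Θ.smoothAt_β) 2 0) hu)).sub
    ((contMDiffAt_sin_angle hu).mul
    (contMDiffAt_lift (fun _ => Θ.contMDiffAt_comp (fun _ => Θ.smoothAt_β) 1 2) hu))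

/-- As d(dφ) = 0, only the pullback of dβ remains. Its components along θ₁ ∧ θ₂ and θ₂ ∧ θ₀ rotate
with the angle, while θ₀ ∧ θ₁ = ω₀ ∧ ω₁ is invariant, so the curvature coefficient is pulled back
from M. -/
lemma d_connection (hF : η.IsUnitary F) {u : η.CircleBundle} (hu : u ∈ (η.bundleChart F).source)
    (v w : TangentSpace 𝓘(ℝ, E4) u) :
    Θ.connection.d u v w = Θ.b₁ u * ww 1 2 u v w + Θ.b₂ u * ww 2 0 u v w
      + Θ.comp Θ.β 0 1 (CircleBundle.proj u) * ww 0 1 u v w := by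
  have hx := proj_mem_dom hu
  have hcs := Real.sin_sq_add_cos_sq (η.angle F u)
  have hs : Real.sin (η.angle F u) ^ 2 = 1 - Real.cos (η.angle F u) ^ 2 := by linarith
  have t0 : ∀ w, η.tautological 0 u w = Real.cos (η.angle F u) * Θ.lift 0 u w
      + Real.sin (η.angle F u) * Θ.lift 1 u w := fun w => by
    rw [Θ.tautological_zero hF hu]; rfl
  have t1 : ∀ w, η.tautological 1 u w = Real.cos (η.angle F u) * Θ.lift 1 u w
      - Real.sin (η.angle F u) * Θ.lift 0 u w := fun w => by
    rw [Θ.tautological_one hF hu]; rfl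
  have t2 : ∀ w, η.tautological 2 u w = Θ.lift 2 u w := fun w => by
    rw [Θ.tautological_two hu]
  have l : ∀ i w, Θ.θ i (CircleBundle.proj u)
    (mfderiv 𝓘(ℝ, E4) 𝓘(ℝ, E3) CircleBundle.proj u w) = Θ.lift i u w := fun i w => rfl
  have h : Θ.connection.d u v w = (Θ.β.pullback CircleBundle.proj).d u v w - 0 := by
    rw [← d_dFun (contMDiffAt_angle hu) v w]
    exact OneForm.d_sub ((Θ.smoothAt_β hx).pullback (contMDiff_proj u))
      (smoothAt_dFun (contMDiffAt_angle hu)) v w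
  rw [h, OneForm.d_pullback (contMDiff_proj u) (Θ.smoothAt_β hx), Θ.d_expand _ hx]
  simp only [ww, t0, t1, t2, l, b₁, b₂]
  ring_nf
  simp only [hs]
  ring

/-- On vertical vectors the connection form is -dφ = -ds/(1 + s²), so its vanishing forces ds to
vanish. -/
lemma eq_zero_of_connection {u : η.CircleBundle} (hu : u ∈ (η.bundleChart F).source)
    {w : TangentSpace 𝓘(ℝ, E4) u}
    (h1 : mfderiv 𝓘(ℝ, E4) 𝓘(ℝ, E3) CircleBundle.proj u w = 0) (h2 : Θ.connection u w = 0) :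
    w = 0 := by
  refine eq_zero_of_vertical hu h1 ?_
  have hb : Θ.β.pullback CircleBundle.proj u w = 0 := by
    change Θ.β _ (mfderiv 𝓘(ℝ, E4) 𝓘(ℝ, E3) CircleBundle.proj u w) = 0
    rw [h1, map_zero]
  have h3 : Θ.β.pullback CircleBundle.proj u w - dFun (E := E4) (η.angle F) u w = 0 := h2
  have h4 := dFun_comp (contMDiffAt_slope hu)
    (Real.hasDerivAt_arctan (F.slope (η.toSpherization u))) w
  change dFun (E := E4) (η.angle F) u w = _ at h4
  rw [hb, h4, zero_sub, neg_eq_zero] at h3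
  refine (mul_eq_zero.1 h3).resolve_left ?_
  positivity

end UnitaryCoframe

lemma exists_unitaryCoframe (u : η.CircleBundle) : ∃ (F : C.Frame) (_ : η.IsUnitary F)
    (_ : η.UnitaryCoframe F), u ∈ (η.bundleChart F).source := by
  obtain ⟨F, hF, hu⟩ := exists_mem_bundleChart_source u
  exact ⟨F, hF, unitaryCoframe hF, hu⟩

lemma smoothAt_tautological (i : Fin 3) (u : η.CircleBundle) : (η.tautological i).SmoothAt u := by
  obtain ⟨F, hF, Θ, hu⟩ := exists_unitaryCoframe u
  fin_cases i
  · exact UnitaryCoframe.smoothAt_tautological_zero hF Θ hu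
  · exact UnitaryCoframe.smoothAt_tautological_one hF Θ hu
  · exact smoothAt_tautological_two u

-- The solution is chosen separately at each point. By uniqueness at a point it coincides on each
-- chart with the local expressions, which are smooth.
variable (η) in
lemma existsUnique_first :
    ∃! p : OneForm E4 η.CircleBundle × (η.CircleBundle → ℝ) × (η.CircleBundle → ℝ),
      η.FirstStructureEquation p.1 p.2.1 p.2.2 := by
  have h : ∀ u : η.CircleBundle, ∃ (α : TangentSpace 𝓘(ℝ, E4) u →L[ℝ] ℝ) (x y : ℝ),
      FirstAt u α x y := by
    intro u
    obtain ⟨F, hF, Θ, hu⟩ := exists_unitaryCoframe u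
    exact ⟨_, _, _, Θ.firstAt hF hu⟩
  choose α x y hp using h
  refine ⟨⟨α, x, y⟩, firstStructureEquation_iff.2 ⟨OneForm.isSmooth_iff.2 fun u => ?_,
    fun u => ?_, fun u => ?_, hp, d_tautological_two⟩, ?_⟩
  · obtain ⟨F, hF, Θ, hu⟩ := exists_unitaryCoframe u
    refine (Θ.smoothAt_connection hu).congr ?_
    filter_upwards [(η.bundleChart F).open_source.mem_nhds hu] with z hz
    exact ((hp z).unique (Θ.firstAt hF hz)).1
  · obtain ⟨F, hF, Θ, hu⟩ := exists_unitaryCoframe u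
    refine (Θ.contMDiffAt_a₁ hu).congr_of_eventuallyEq ?_
    filter_upwards [(η.bundleChart F).open_source.mem_nhds hu] with z hz
    exact ((hp z).unique (Θ.firstAt hF hz)).2.1
  · obtain ⟨F, hF, Θ, hu⟩ := exists_unitaryCoframe u
    refine (Θ.contMDiffAt_a₂ hu).congr_of_eventuallyEq ?_
    filter_upwards [(η.bundleChart F).open_source.mem_nhds hu] with z hz
    exact ((hp z).unique (Θ.firstAt hF hz)).2.2
  · rintro ⟨α', x', y'⟩ h'
    have h' := (firstStructureEquation_iff.1 h').2.2.2.1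
    have k := fun u => (h' u).unique (hp u)
    exact Prod.ext (funext fun u => (k u).1)
      (Prod.ext (funext fun u => (k u).2.1) (funext fun u => (k u).2.2))

lemma FirstStructureEquation.eventually_eq {α : OneForm E4 η.CircleBundle}
    {a₁ a₂ : η.CircleBundle → ℝ} (h : η.FirstStructureEquation α a₁ a₂) {F : C.Frame}
    (hF : η.IsUnitary F) (Θ : η.UnitaryCoframe F) {u : η.CircleBundle}
    (hu : u ∈ (η.bundleChart F).source) : ∀ᶠ z in 𝓝 u, α z = Θ.connection z := by
  filter_upwards [(η.bundleChart F).open_source.mem_nhds hu] with z hz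
  exact (((firstStructureEquation_iff.1 h).2.2.2.1 z).unique (Θ.firstAt hF hz)).1

lemma secondStructureEquation_iff {α : OneForm E4 η.CircleBundle}
    {b₁ b₂ K : η.CircleBundle → ℝ} :
    η.SecondStructureEquation α b₁ b₂ K ↔ IsSmoothFun (E := E4) b₁ ∧ IsSmoothFun (E := E4) b₂ ∧
      IsSmoothFun (E := E4) K ∧ ∀ u v w, α.d u v w
        = b₁ u * ww 1 2 u v w + b₂ u * ww 2 0 u v w + K u * ww 0 1 u v w := by
  constructor
  · rintro ⟨h1, h2, h3, h4⟩
    refine ⟨h1, h2, h3, fun u v w => ?_⟩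
    rw [h4 u]
    simp only [LinearMap.add_apply, LinearMap.smul_apply, smul_eq_mul, OneForm.wedge_apply, ww]
  · rintro ⟨h1, h2, h3, h4⟩
    refine ⟨h1, h2, h3, fun u => ?_⟩
    ext v w
    rw [h4]
    simp only [LinearMap.add_apply, LinearMap.smul_apply, smul_eq_mul, OneForm.wedge_apply, ww]

lemma ww_coeff_unique {u : η.CircleBundle} {x y z x' y' z' : ℝ}
    (h : ∀ v w, x * ww 1 2 u v w + y * ww 2 0 u v w + z * ww 0 1 u v w
      = x' * ww 1 2 u v w + y' * ww 2 0 u v w + z' * ww 0 1 u v w) :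
    x = x' ∧ y = y' ∧ z = z' := by
  obtain ⟨e, he⟩ := exists_dual u
  have h1 := h (e 1) (e 2)
  have h2 := h (e 2) (e 0)
  have h3 := h (e 0) (e 1)
  simp [ww, he] at h1 h2 h3
  exact ⟨h1, h2, h3⟩

/-- The exterior derivative only depends on the germ of α, which is that of the local connection
form; the coefficients found there glue because the products ωᵢ ∧ ωⱼ are independent. -/
lemma FirstStructureEquation.existsUnique_second {α : OneForm E4 η.CircleBundle}
    {a₁ a₂ : η.CircleBundle → ℝ} (h : η.FirstStructureEquation α a₁ a₂) :
    ∃! q : (η.CircleBundle → ℝ) × (η.CircleBundle → ℝ) × (η.CircleBundle → ℝ),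
      η.SecondStructureEquation α q.1 q.2.1 q.2.2 := by
  have loc : ∀ {F : C.Frame} (hF : η.IsUnitary F) (Θ : η.UnitaryCoframe F) {u : η.CircleBundle}
      (hu : u ∈ (η.bundleChart F).source) v w, α.d u v w
        = Θ.b₁ u * ww 1 2 u v w + Θ.b₂ u * ww 2 0 u v w
          + Θ.comp Θ.β 0 1 (CircleBundle.proj u) * ww 0 1 u v w := by
    intro F hF Θ u hu v w
    rw [OneForm.d_congr (h.eventually_eq hF Θ hu), Θ.d_connection hF hu]
  have hex : ∀ u : η.CircleBundle, ∃ x y z : ℝ, ∀ v w, α.d u v w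
      = x * ww 1 2 u v w + y * ww 2 0 u v w + z * ww 0 1 u v w := by
    intro u
    obtain ⟨F, hF, Θ, hu⟩ := exists_unitaryCoframe u
    exact ⟨_, _, _, loc hF Θ hu⟩
  choose x y z hp using hex
  refine ⟨⟨x, y, z⟩, secondStructureEquation_iff.2 ⟨fun u => ?_, fun u => ?_, fun u => ?_, hp⟩, ?_⟩
  · obtain ⟨F, hF, Θ, hu⟩ := exists_unitaryCoframe u
    refine (Θ.contMDiffAt_b₁ hu).congr_of_eventuallyEq ?_
    filter_upwards [(η.bundleChart F).open_source.mem_nhds hu] with z hz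
    exact (ww_coeff_unique fun v w => (hp z v w).symm.trans (loc hF Θ hz v w)).1
  · obtain ⟨F, hF, Θ, hu⟩ := exists_unitaryCoframe u
    refine (Θ.contMDiffAt_b₂ hu).congr_of_eventuallyEq ?_
    filter_upwards [(η.bundleChart F).open_source.mem_nhds hu] with z hz
    exact (ww_coeff_unique fun v w => (hp z v w).symm.trans (loc hF Θ hz v w)).2.1
  · obtain ⟨F, hF, Θ, hu⟩ := exists_unitaryCoframe u
    refine (UnitaryCoframe.contMDiffAt_lift
      (fun _ => Θ.contMDiffAt_comp (fun _ => Θ.smoothAt_β) 0 1) hu).congr_of_eventuallyEq ?_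
    filter_upwards [(η.bundleChart F).open_source.mem_nhds hu] with z hz
    exact (ww_coeff_unique fun v w => (hp z v w).symm.trans (loc hF Θ hz v w)).2.2
  · rintro ⟨x', y', z'⟩ h'
    have h' := (secondStructureEquation_iff.1 h').2.2.2
    have k := fun u => ww_coeff_unique fun v w => (h' u v w).symm.trans (hp u v w)
    exact Prod.ext (funext fun u => (k u).1)
      (Prod.ext (funext fun u => (k u).2.1) (funext fun u => (k u).2.2))

/-- The forms `ω¹, ω², ω³, α` are linearly independent. -/
lemma FirstStructureEquation.eq_zero {α : OneForm E4 η.CircleBundle}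
    {a₁ a₂ : η.CircleBundle → ℝ} (h : η.FirstStructureEquation α a₁ a₂) {u : η.CircleBundle}
    {w : TangentSpace 𝓘(ℝ, E4) u} (hw : ∀ i, η.tautological i u w = 0) (hα : α u w = 0) :
    w = 0 := by
  obtain ⟨F, hF, Θ, hu⟩ := exists_unitaryCoframe u
  refine Θ.eq_zero_of_connection hu ?_ ?_
  · exact u.1.map.injective ((funext hw).trans (map_zero u.1.map).symm)
  · rwa [← (h.eventually_eq hF Θ hu).self_of_nhds]

end PositiveContactForm

/-! ### Signature and smoothness of the induced metric. -/

lemma exists_dual_basis {V : Type*} [AddCommGroup V] [Module ℝ V]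
    (hV : Module.finrank ℝ V = 4) (f : V →ₗ[ℝ] (Fin 4 → ℝ)) (hf : ∀ w, f w = 0 → w = 0) :
    ∃ b : Module.Basis (Fin 4) ℝ V, ∀ i j, f (b i) j = if i = j then 1 else 0 := by
  have : FiniteDimensional ℝ V := Module.finite_of_finrank_pos (by rw [hV]; norm_num)
  have hinj : Function.Injective f := by
    rw [← LinearMap.ker_eq_bot, LinearMap.ker_eq_bot']
    exact hf
  let e := LinearEquiv.ofInjectiveOfFinrankEq f hinj (by rw [hV]; simp)
  refine ⟨Module.Basis.ofEquivFun e, fun i j => ?_⟩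
  have h1 : e (Module.Basis.ofEquivFun e i) = Pi.single i 1 := by simp
  have h3 : f (Module.Basis.ofEquivFun e i) = Pi.single i 1 := h1
  rw [h3, Pi.single_apply]
  simp [eq_comm]

/-- A bilinear form `α² + β² + γ · σ` with `α, β, γ, σ` a basis of the dual space has signature
`(3, 1)`. -/
lemma exists_lorentz_basis {V : Type*} [AddCommGroup V] [Module ℝ V]
    (hV : Module.finrank ℝ V = 4) {g : LinearMap.BilinForm ℝ V} (α β γ σ : V →ₗ[ℝ] ℝ)
    (hg : ∀ v w, g v w = α v * α w + β v * β w + (1 / 2 : ℝ) * (γ v * σ w + σ v * γ w))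
    (h0 : ∀ w, α w = 0 → β w = 0 → γ w = 0 → σ w = 0 → w = 0) :
    ∃ b : Module.Basis (Fin 4) ℝ V,
      ∀ i j, g (b i) (b j) = if i = j then (if i = 3 then -1 else 1) else 0 := by
  -- Polarization: γ · σ = ((γ + σ)/2)² - ((γ - σ)/2)², so these four coordinates diagonalize the
  -- form, with the negative direction last.
  let f : V →ₗ[ℝ] (Fin 4 → ℝ) :=
    LinearMap.pi ![α, β, (1 / 2 : ℝ) • (γ + σ), (1 / 2 : ℝ) • (γ - σ)]
  have f0 : ∀ w, f w 0 = α w := fun w => rfl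
  have f1 : ∀ w, f w 1 = β w := fun w => rfl
  have f2 : ∀ w, f w 2 = (1 / 2 : ℝ) * (γ w + σ w) := fun w => rfl
  have f3 : ∀ w, f w 3 = (1 / 2 : ℝ) * (γ w - σ w) := fun w => rfl
  obtain ⟨b, hb⟩ := exists_dual_basis hV f (by
    intro w hw
    have k : ∀ i, f w i = 0 := fun i => congrFun hw i
    have k2 := k 2
    have k3 := k 3
    rw [f2] at k2
    rw [f3] at k3
    exact h0 w ((f0 w).symm.trans (k 0)) ((f1 w).symm.trans (k 1)) (by linarith) (by linarith))
  refine ⟨b, fun i j => ?_⟩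
  have hf : ∀ v w, g v w = f v 0 * f w 0 + f v 1 * f w 1 + f v 2 * f w 2 - f v 3 * f w 3 := by
    intro v w
    rw [hg, f0, f0, f1, f1, f2, f2, f3, f3]; ring
  rw [hf]
  simp only [hb]
  fin_cases i <;> fin_cases j <;> simp

variable {M : Type*} [TopologicalSpace M] [ChartedSpace E3 M] [IsManifold 𝓘(ℝ, E3) ∞ M]
  {C : CRStructure M}

lemma finrank_tangentSpace_E4 {N : Type*} [TopologicalSpace N] [ChartedSpace E4 N] (x : N) :
    Module.finrank ℝ (TangentSpace 𝓘(ℝ, E4) x) = 4 := by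
  change Module.finrank ℝ E4 = 4
  simp [E4]

namespace PositiveContactForm

variable {η : PositiveContactForm C}

lemma smoothAt_sigma {α : OneForm E4 η.CircleBundle} {K : η.CircleBundle → ℝ}
    (hα : α.IsSmooth) (hK : IsSmoothFun (E := E4) K) (u : η.CircleBundle) :
    (η.sigma α K).SmoothAt u :=
  ((OneForm.isSmooth_iff.1 hα u).smul contMDiffAt_const).sub
    ((smoothAt_tautological 2 u).smul (contMDiffAt_const.mul (hK u)))

lemma bundleMetric_apply (α : OneForm E4 η.CircleBundle) (K : η.CircleBundle → ℝ)
    (u : η.CircleBundle) (v w : TangentSpace 𝓘(ℝ, E4) u) :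
    η.bundleMetric α K u v w = η.tautological 0 u v * η.tautological 0 u w
      + η.tautological 1 u v * η.tautological 1 u w
      + (1 / 2 : ℝ) * (η.tautological 2 u v * η.sigma α K u w
        + η.sigma α K u v * η.tautological 2 u w) := by
  unfold bundleMetric OneForm.symmProd OneForm.tensor
  simp
  ring

lemma sigma_apply (α : OneForm E4 η.CircleBundle) (K : η.CircleBundle → ℝ)
    (u : η.CircleBundle) (v : TangentSpace 𝓘(ℝ, E4) u) :
    η.sigma α K u v = 4 / 3 * α u v - 1 / 3 * K u * η.tautological 2 u v := rfl

lemma inducedMetric_apply (α : OneForm E4 η.CircleBundle) (K : η.CircleBundle → ℝ)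
    (r : C.Spherization) (v w : TangentSpace 𝓘(ℝ, E4) r) :
    η.inducedMetric α K r v w = η.bundleMetric α K (η.equivSpherization.symm r)
      (mfderiv 𝓘(ℝ, E4) 𝓘(ℝ, E4) η.equivSpherization.symm r v)
      (mfderiv 𝓘(ℝ, E4) 𝓘(ℝ, E4) η.equivSpherization.symm r w) := rfl

lemma mfderiv_equivSpherization_symm_injective (r : C.Spherization)
    {v : TangentSpace 𝓘(ℝ, E4) r}
    (hv : mfderiv 𝓘(ℝ, E4) 𝓘(ℝ, E4) η.equivSpherization.symm r v = 0) : v = 0 := by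
  have h1 : mfderiv 𝓘(ℝ, E4) 𝓘(ℝ, E4) (η.equivSpherization ∘ η.equivSpherization.symm) r = _ :=
    mfderiv_comp r ((contMDiff_equivSpherization _).mdifferentiableAt (by simp))
      ((contMDiff_equivSpherization_symm r).mdifferentiableAt (by simp))
  have h2 : η.equivSpherization ∘ η.equivSpherization.symm = id := by
    funext z; simp
  rw [h2, mfderiv_id] at h1
  have h3 := congrArg (fun L => L v) h1
  refine h3.trans ?_
  change mfderiv 𝓘(ℝ, E4) 𝓘(ℝ, E4) η.equivSpherization (η.equivSpherization.symm r)
    (mfderiv 𝓘(ℝ, E4) 𝓘(ℝ, E4) η.equivSpherization.symm r v) = 0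
  rw [hv, map_zero]

/-- The pullback to `SD` of a form on `B`. -/
def toSD (τ : OneForm E4 η.CircleBundle) : OneForm E4 C.Spherization :=
  τ.pullback η.equivSpherization.symm

lemma toSD_apply (τ : OneForm E4 η.CircleBundle) (r : C.Spherization)
    (v : TangentSpace 𝓘(ℝ, E4) r) :
    toSD τ r v = τ (η.equivSpherization.symm r)
      (mfderiv 𝓘(ℝ, E4) 𝓘(ℝ, E4) η.equivSpherization.symm r v) := rfl

lemma isSmooth_toSD {τ : OneForm E4 η.CircleBundle} (hτ : ∀ u, τ.SmoothAt u) :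
    (toSD τ).IsSmooth :=
  OneForm.isSmooth_iff.2 fun r => (hτ _).pullback (contMDiff_equivSpherization_symm r)

lemma inducedMetric_eq (α : OneForm E4 η.CircleBundle) (K : η.CircleBundle → ℝ)
    (r : C.Spherization) (v w : TangentSpace 𝓘(ℝ, E4) r) :
    η.inducedMetric α K r v w = toSD (η.tautological 0) r v * toSD (η.tautological 0) r w
      + toSD (η.tautological 1) r v * toSD (η.tautological 1) r w
      + (1 / 2 : ℝ) * (toSD (η.tautological 2) r v * toSD (η.sigma α K) r w
        + toSD (η.sigma α K) r v * toSD (η.tautological 2) r w) := by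
  rw [inducedMetric_apply, bundleMetric_apply]
  simp only [toSD_apply]

/-- Modulo ω₂ the form σ is (4/3)α, so a vector killed by ω₀, ω₁, ω₂, σ is also killed by α and
vanishes. Symmetry and smoothness are visible from the expression by smooth 1-forms. -/
lemma isLorentzian_inducedMetric {α : OneForm E4 η.CircleBundle} {K : η.CircleBundle → ℝ}
    (h : η.IsWebster α K) : (η.inducedMetric α K).IsLorentzian := by
  obtain ⟨a₁, a₂, b₁, b₂, h1, h2⟩ := h
  have hΩ : ∀ i, (toSD (η.tautological i)).IsSmooth := fun i =>
    isSmooth_toSD (smoothAt_tautological i)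
  have hS : (toSD (η.sigma α K)).IsSmooth := isSmooth_toSD (smoothAt_sigma h1.smooth_α h2.smooth_K)
  refine ⟨fun x₀ v w => ?_, fun r v w => ?_, fun r => ?_⟩
  · simp only [inducedMetric_eq]
    have a : ∀ (τ : OneForm E4 C.Spherization) (_ : τ.IsSmooth) (v : E4), ContDiffOn ℝ ∞
        (fun y => τ ((chartAt E4 x₀).symm y) (chartInvDeriv x₀ y v)) (chartAt E4 x₀).target :=
      fun τ hτ v => (hτ x₀).clm_apply contDiffOn_const
    exact (((a _ (hΩ 0) v).mul (a _ (hΩ 0) w)).add ((a _ (hΩ 1) v).mul (a _ (hΩ 1) w))).add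
      (contDiffOn_const.mul (((a _ (hΩ 2) v).mul (a _ hS w)).add
        ((a _ hS v).mul (a _ (hΩ 2) w))))
  · rw [inducedMetric_eq, inducedMetric_eq]; ring
  · refine exists_lorentz_basis (finrank_tangentSpace_E4 r) (toSD (η.tautological 0) r).toLinearMap
      (toSD (η.tautological 1) r).toLinearMap (toSD (η.tautological 2) r).toLinearMap
      (toSD (η.sigma α K) r).toLinearMap (fun v w => inducedMetric_eq α K r v w) ?_
    intro w k0 k1 k4 k5
    apply mfderiv_equivSpherization_symm_injective (η := η) r
    apply h1.eq_zero
    · intro i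
      fin_cases i
      · exact k0
      · exact k1
      · exact k4
    · have k6 := (sigma_apply α K (η.equivSpherization.symm r)
        (mfderiv 𝓘(ℝ, E4) 𝓘(ℝ, E4) η.equivSpherization.symm r w)).symm.trans k5
      have k7 : η.tautological 2 (η.equivSpherization.symm r)
        (mfderiv 𝓘(ℝ, E4) 𝓘(ℝ, E4) η.equivSpherization.symm r w) = 0 := k4
      rw [k7] at k6
      linarith

end PositiveContactForm

/-! ### The transformation law of σ, for abstract forms satisfying the structure equations. -/

section Core

variable {E : Type*} [NormedAddCommGroup E] [NormedSpace ℝ E]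
  {N : Type*} [TopologicalSpace N] [ChartedSpace E N] [IsManifold 𝓘(ℝ, E) ∞ N]

/-- The value of `θ ∧ τ`. -/
def wv (θ τ : OneForm E N) (x : N) (v w : TangentSpace 𝓘(ℝ, E) x) : ℝ :=
  θ x v * τ x w - θ x w * τ x v

/-- Forms satisfying the structure equations of a pseudohermitian structure. -/
structure StructureForms (ω₀ ω₁ ω₂ α : OneForm E N) (K : N → ℝ) : Prop where
  smooth₀ : ∀ x, ω₀.SmoothAt x
  smooth₁ : ∀ x, ω₁.SmoothAt x
  smooth₂ : ∀ x, ω₂.SmoothAt x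
  smooth_α : ∀ x, α.SmoothAt x
  eqs : ∀ x, ∃ a₁ a₂ b₁ b₂ : ℝ, ∀ v w,
    ω₀.d x v w = -wv α ω₁ x v w + a₁ * wv ω₁ ω₂ x v w + a₂ * wv ω₂ ω₀ x v w ∧
    ω₁.d x v w = wv α ω₀ x v w + a₂ * wv ω₁ ω₂ x v w - a₁ * wv ω₂ ω₀ x v w ∧
    ω₂.d x v w = wv ω₀ ω₁ x v w ∧
    α.d x v w = b₁ * wv ω₁ ω₂ x v w + b₂ * wv ω₂ ω₀ x v w + K x * wv ω₀ ω₁ x v w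

/-- The change of the connection form and the curvature under a change of the contact form. -/
theorem StructureForms.transformation {ω₀ ω₁ ω₂ α τ₀ τ₁ τ₂ γ : OneForm E N} {K K' : N → ℝ}
    (hω : StructureForms ω₀ ω₁ ω₂ α K) (hτ : StructureForms τ₀ τ₁ τ₂ γ K') {ρ P Q : N → ℝ}
    (hρ : ∀ x, ContMDiffAt 𝓘(ℝ, E) 𝓘(ℝ) ∞ ρ x) (hρ0 : ∀ x, 0 < ρ x)
    (h₀ : ∀ x, τ₀ x = ρ x • ω₀ x + P x • ω₂ x) (h₁ : ∀ x, τ₁ x = ρ x • ω₁ x + Q x • ω₂ x)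
    (h₂ : ∀ x, τ₂ x = (ρ x * ρ x) • ω₂ x) {e : Fin 3 → ∀ x : N, TangentSpace 𝓘(ℝ, E) x}
    (he₀ : ∀ x j, ω₀ x (e j x) = if j = 0 then 1 else 0)
    (he₁ : ∀ x j, ω₁ x (e j x) = if j = 1 then 1 else 0)
    (he₂ : ∀ x j, ω₂ x (e j x) = if j = 2 then 1 else 0)
    (heα : ∀ x j, α x (e j x) = 0) (x : N) (w : TangentSpace 𝓘(ℝ, E) x) :
    (ρ x) ^ 2 * (4 / 3 * γ x w - 1 / 3 * K' x * τ₂ x w)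
      = (ρ x) ^ 2 * (4 / 3 * α x w - 1 / 3 * K x * ω₂ x w)
        - 2 * ρ x * (P x * ω₀ x w + Q x * ω₁ x w) - (P x ^ 2 + Q x ^ 2) * ω₂ x w := by
  have hω2 : ∀ x, ω₂ x ≠ 0 := by
    intro x h
    have := he₂ x 2
    rw [h] at this
    simp at this
  -- `P` and `Q` are arbitrary functions here; they are smooth because Pω₂ and Qω₂ are smooth forms
  -- and ω₂ vanishes nowhere.
  have hP : ∀ x, ContMDiffAt 𝓘(ℝ, E) 𝓘(ℝ) ∞ P x := fun x =>
    contMDiffAt_of_smul_eq (hω.smooth₂ x)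
      ((hτ.smooth₀ x).sub ((hω.smooth₀ x).smul (hρ x)))
      (Eventually.of_forall fun z => by rw [h₀ z, add_sub_cancel_left]) (hω2 x)
  have hQ : ∀ x, ContMDiffAt 𝓘(ℝ, E) 𝓘(ℝ) ∞ Q x := fun x =>
    contMDiffAt_of_smul_eq (hω.smooth₂ x)
      ((hτ.smooth₁ x).sub ((hω.smooth₁ x).smul (hρ x)))
      (Eventually.of_forall fun z => by rw [h₁ z, add_sub_cancel_left]) (hω2 x)
  have d0 : ∀ x v w, τ₀.d x v w = dFun (E := E) ρ x v * ω₀ x w - dFun (E := E) ρ x w * ω₀ x v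
      + ρ x * ω₀.d x v w + (dFun (E := E) P x v * ω₂ x w - dFun (E := E) P x w * ω₂ x v
      + P x * ω₂.d x v w) := by
    intro x v w
    rw [OneForm.d_congr (Eventually.of_forall h₀), OneForm.d_add ((hω.smooth₀ x).smul (hρ x))
      ((hω.smooth₂ x).smul (hP x)), OneForm.d_smul (hρ x) (hω.smooth₀ x),
      OneForm.d_smul (hP x) (hω.smooth₂ x)]
  have d1 : ∀ x v w, τ₁.d x v w = dFun (E := E) ρ x v * ω₁ x w - dFun (E := E) ρ x w * ω₁ x v
      + ρ x * ω₁.d x v w + (dFun (E := E) Q x v * ω₂ x w - dFun (E := E) Q x w * ω₂ x v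
      + Q x * ω₂.d x v w) := by
    intro x v w
    rw [OneForm.d_congr (Eventually.of_forall h₁), OneForm.d_add ((hω.smooth₁ x).smul (hρ x))
      ((hω.smooth₂ x).smul (hQ x)), OneForm.d_smul (hρ x) (hω.smooth₁ x),
      OneForm.d_smul (hQ x) (hω.smooth₂ x)]
  have d2 : ∀ x v w, τ₂.d x v w = dFun (E := E) ρ x v * (ρ x * ω₂ x w)
      - dFun (E := E) ρ x w * (ρ x * ω₂ x v)
      + ρ x * (dFun (E := E) ρ x v * ω₂ x w - dFun (E := E) ρ x w * ω₂ x v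
      + ρ x * ω₂.d x v w) := by
    intro x v w
    have h : ∀ z, τ₂ z = ρ z • (fun y => ρ y • ω₂ y : OneForm E N) z := fun z => by
      rw [h₂ z, mul_smul]
    rw [OneForm.d_congr (Eventually.of_forall h),
      OneForm.d_smul (hρ x) ((hω.smooth₂ x).smul (hρ x)), OneForm.d_smul (hρ x) (hω.smooth₂ x)]
    rfl
  have t0 : ∀ x w, τ₀ x w = ρ x * ω₀ x w + P x * ω₂ x w := fun x w => by rw [h₀]; rfl
  have t1 : ∀ x w, τ₁ x w = ρ x * ω₁ x w + Q x * ω₂ x w := fun x w => by rw [h₁]; rfl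
  have t2 : ∀ x w, τ₂ x w = ρ x * ρ x * ω₂ x w := fun x w => by rw [h₂]; rfl
  -- the components of `γ` and the derivatives of `ρ`
  have comps : ∀ x, 2 * dFun (E := E) ρ x (e 0 x) = Q x ∧ 2 * dFun (E := E) ρ x (e 1 x) = -P x ∧
      2 * (ρ x * γ x (e 0 x)) = -3 * P x ∧ 2 * (ρ x * γ x (e 1 x)) = -3 * Q x ∧
      dFun (E := E) P x (e 1 x) - dFun (E := E) Q x (e 0 x)
        = 2 * (ρ x * γ x (e 2 x)) - γ x (e 1 x) * Q x - γ x (e 0 x) * P x ∧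
      (∀ w, γ x w = α x w + γ x (e 0 x) * ω₀ x w + γ x (e 1 x) * ω₁ x w
        + γ x (e 2 x) * ω₂ x w) := by
    intro x
    obtain ⟨a₁, a₂, b₁, b₂, hω'⟩ := hω.eqs x
    obtain ⟨a₁', a₂', b₁', b₂', hτ'⟩ := hτ.eqs x
    have hr := (hρ0 x).ne'
    have E0 : ∀ v w, _ := fun v w => (d0 x v w).symm.trans (hτ' v w).1
    have E1 : ∀ v w, _ := fun v w => (d1 x v w).symm.trans (hτ' v w).2.1
    have E2 : ∀ v w, _ := fun v w => (d2 x v w).symm.trans (hτ' v w).2.2.1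
    simp only [fun v w => (hω' v w).1, fun v w => (hω' v w).2.1, fun v w => (hω' v w).2.2.1, wv,
      t0, t1, t2] at E0 E1 E2
    -- As α vanishes on the dual vectors, the numbers γ(e j) are the components of γ - α. The
    -- evaluations below form a linear system for these components and for the derivatives of ρ
    -- along e₀ and e₁.
    have E01 := E0 (e 0 x) (e 1 x)
    have E02 := E0 (e 1 x) (e 2 x)
    have E0w := fun w => E0 w (e 1 x)
    have E11 := E1 (e 0 x) (e 1 x)
    have E12 := E1 (e 2 x) (e 0 x)
    have E21 := E2 (e 0 x) (e 2 x)
    have E22 := E2 (e 1 x) (e 2 x)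
    simp [he₀, he₁, he₂, heα] at E01 E02 E0w E11 E12 E21 E22
    have r0 : 2 * dFun (E := E) ρ x (e 0 x) = Q x := by
      apply mul_left_cancel₀ hr; linarith
    have r1 : 2 * dFun (E := E) ρ x (e 1 x) = -P x := by
      apply mul_left_cancel₀ hr; linarith
    refine ⟨r0, r1, by linarith, by linarith, by linarith, fun w => ?_⟩
    apply mul_left_cancel₀ hr
    -- With e₁ in the second slot the equation contains ρ γ(w). Subtracting ω₀(w) and ω₂(w) times
    -- its values at e₀ and e₂ removes the unknown torsion terms and the derivatives of ρ and P.
    have F0 := E0w (e 0 x)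
    have F2 := E0w (e 2 x)
    simp [he₀, he₁, he₂, heα] at F0 F2
    linear_combination E0w w - ω₀ x w * F0 - ω₂ x w * F2
  -- the exterior derivative of `ρ γ + (3/2)(P ω₀ + Q ω₁) = ρ α + X ω₂`
  have hX : ∀ z, ρ z • γ z + ((3 / 2 * P z) • ω₀ z + (3 / 2 * Q z) • ω₁ z) - ρ z • α z
      = (ρ z * γ z (e 2 z)) • ω₂ z := by
    intro z
    ext w
    obtain ⟨-, -, c0, c1, -, cw⟩ := comps z
    simp only [add_apply, sub_apply, smul_apply, smul_eq_mul]
    rw [cw w]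
    linear_combination (1 / 2 * ω₀ z w) * c0 + (1 / 2 * ω₁ z w) * c1
  have hP' : ∀ x, ContMDiffAt 𝓘(ℝ, E) 𝓘(ℝ) ∞ (fun z => 3 / 2 * P z) x := fun x =>
    contMDiffAt_const.mul (hP x)
  have hQ' : ∀ x, ContMDiffAt 𝓘(ℝ, E) 𝓘(ℝ) ∞ (fun z => 3 / 2 * Q z) x := fun x =>
    contMDiffAt_const.mul (hQ x)
  have dP' : ∀ v, dFun (E := E) (fun z => 3 / 2 * P z) x v = 3 / 2 * dFun (E := E) P x v :=
    fun v => dFun_comp (g := fun t => 3 / 2 * t) (hP x)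
      (by simpa using (hasDerivAt_id (P x)).const_mul (3 / 2 : ℝ)) v
  have dQ' : ∀ v, dFun (E := E) (fun z => 3 / 2 * Q z) x v = 3 / 2 * dFun (E := E) Q x v :=
    fun v => dFun_comp (g := fun t => 3 / 2 * t) (hQ x)
      (by simpa using (hasDerivAt_id (Q x)).const_mul (3 / 2 : ℝ)) v
  have s1 := ((hω.smooth₀ x).smul (hP' x)).add ((hω.smooth₁ x).smul (hQ' x))
  have s2 := ((hτ.smooth_α x).smul (hρ x)).add s1
  have s3 := (hω.smooth_α x).smul (hρ x)
  -- The vectors e j are not assumed smooth; smoothness of X = ργ(e₂) follows from X being the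
  -- factor of a smooth form along ω₂.
  have hXs : ContMDiffAt 𝓘(ℝ, E) 𝓘(ℝ) ∞ (fun z => ρ z * γ z (e 2 z)) x :=
    contMDiffAt_of_smul_eq (hω.smooth₂ x) (s2.sub s3) (Eventually.of_forall hX) (hω2 x)
  -- On e₀, e₁ the form ω₂ vanishes, so dX does not contribute and the right side is just X. The
  -- left side contains ρ³K' - ρK and derivatives of P and Q.
  have hd := congrArg (fun B => B (e 0 x) (e 1 x))
    (OneForm.d_congr (x := x) (Eventually.of_forall hX))
  rw [OneForm.d_sub s2 s3, OneForm.d_add ((hτ.smooth_α x).smul (hρ x)) s1,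
    OneForm.d_add ((hω.smooth₀ x).smul (hP' x)) ((hω.smooth₁ x).smul (hQ' x)),
    OneForm.d_smul (hρ x) (hτ.smooth_α x), OneForm.d_smul (hP' x) (hω.smooth₀ x),
    OneForm.d_smul (hQ' x) (hω.smooth₁ x), OneForm.d_smul (hρ x) (hω.smooth_α x),
    OneForm.d_smul hXs (hω.smooth₂ x), dP', dP', dQ', dQ'] at hd
  obtain ⟨a₁, a₂, b₁, b₂, hω'⟩ := hω.eqs x
  obtain ⟨a₁', a₂', b₁', b₂', hτ'⟩ := hτ.eqs x
  obtain ⟨hω0, hω1, hω2', hω3⟩ := hω' (e 0 x) (e 1 x)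
  rw [hω0, hω1, hω2', hω3, (hτ' (e 0 x) (e 1 x)).2.2.2] at hd
  simp [wv, t0, t1, t2, he₀, he₁, he₂, heα] at hd
  obtain ⟨r0, r1, c0, c1, cx, cw⟩ := comps x
  rw [cw w, t2]
  -- Here `hd` gives the new curvature and `cx` trades the derivatives of P and Q for γ(e₂).
  -- Together they contribute 4γ(e₂) to ρ²K', which cancels against the component (4/3)γ(e₂) of
  -- (4/3)γ.
  linear_combination (2 / 3 * ρ x * ω₀ x w + P x / 3 * ω₂ x w) * c0
    + (2 / 3 * ρ x * ω₁ x w + Q x / 3 * ω₂ x w) * c1 - (ρ x / 3 * ω₂ x w) * hd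
    - (ρ x / 2 * ω₂ x w) * cx + (ρ x * γ x (e 1 x) / 6 * ω₂ x w) * r0
    - (ρ x * γ x (e 0 x) / 6 * ω₂ x w) * r1

end Core

section Core

variable {E : Type*} [NormedAddCommGroup E] [NormedSpace ℝ E]
  {N : Type*} [TopologicalSpace N] [ChartedSpace E N] [IsManifold 𝓘(ℝ, E) ∞ N]
  {N' : Type*} [TopologicalSpace N'] [ChartedSpace E N'] [IsManifold 𝓘(ℝ, E) ∞ N']

/-- Naturality of `d` allows the structure equations of a second contact form to be transported to
the circle bundle of the first, where both sets of forms can be compared. -/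
lemma StructureForms.pullback {ω₀ ω₁ ω₂ α : OneForm E N} {K : N → ℝ}
    (h : StructureForms ω₀ ω₁ ω₂ α K) {f : N' → N} (hf : ContMDiff 𝓘(ℝ, E) 𝓘(ℝ, E) ∞ f) :
    StructureForms (ω₀.pullback f : OneForm E N') (ω₁.pullback f) (ω₂.pullback f) (α.pullback f)
      (fun x => K (f x)) where
  smooth₀ x := (h.smooth₀ _).pullback (hf x)
  smooth₁ x := (h.smooth₁ _).pullback (hf x)
  smooth₂ x := (h.smooth₂ _).pullback (hf x)
  smooth_α x := (h.smooth_α _).pullback (hf x)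
  eqs x := by
    obtain ⟨a₁, a₂, b₁, b₂, he⟩ := h.eqs (f x)
    refine ⟨a₁, a₂, b₁, b₂, fun v w => ?_⟩
    rw [OneForm.d_pullback (hf x) (h.smooth₀ _), OneForm.d_pullback (hf x) (h.smooth₁ _),
      OneForm.d_pullback (hf x) (h.smooth₂ _), OneForm.d_pullback (hf x) (h.smooth_α _)]
    exact he _ _

lemma OneForm.pullback_comp {N'' : Type*} [TopologicalSpace N''] [ChartedSpace E N'']
    {f : N' → N} {g : N'' → N'} (hf : ContMDiff 𝓘(ℝ, E) 𝓘(ℝ, E) ∞ f)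
    (hg : ContMDiff 𝓘(ℝ, E) 𝓘(ℝ, E) ∞ g) (θ : OneForm E N) :
    ((θ.pullback f : OneForm E N').pullback g : OneForm E N'') = θ.pullback (f ∘ g) := by
  funext x
  have h := mfderiv_comp x ((hf (g x)).mdifferentiableAt (by simp))
    ((hg x).mdifferentiableAt (by simp))
  unfold OneForm.pullback
  rw [h]
  rfl

end Core

variable {M : Type*} [TopologicalSpace M] [ChartedSpace E3 M] [IsManifold 𝓘(ℝ, E3) ∞ M]
  {C : CRStructure M}

/-! ### Comparison of two positive contact forms and of their circle bundles. -/

namespace PositiveContactForm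

lemma form_ne_zero (η : PositiveContactForm C) (x : M) : η.form x ≠ 0 := by
  intro h
  have : C.D x = ⊤ := by
    ext w
    simp [η.mem_D_iff, h]
  have h2 := C.finrank_D x
  have hfr : Module.finrank ℝ (TangentSpace 𝓘(ℝ, E3) x) = 3 := finrank_euclideanSpace_fin
  rw [this, finrank_top, hfr] at h2
  norm_num at h2

lemma d_smul_form (η : PositiveContactForm C) {μ : M → ℝ} (hμ : IsSmoothFun (E := E3) μ) (x : M)
    (v w : TangentSpace 𝓘(ℝ, E3) x) :
    OneForm.d (fun x => μ x • η.form x) x v w = dFun (E := E3) μ x v * η.form x w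
      - dFun (E := E3) μ x w * η.form x v + μ x * η.form.d x v w :=
  OneForm.d_smul (hμ x) (η.smoothAt_form x) v w

/-- The multiple of a positive contact form by a positive function. -/
def smul (η : PositiveContactForm C) (μ : M → ℝ) (hμ : IsSmoothFun (E := E3) μ)
    (hμ0 : ∀ x, 0 < μ x) : PositiveContactForm C where
  form := fun x => μ x • η.form x
  smooth := OneForm.isSmooth_iff.2 fun x => (η.smoothAt_form x).smul (hμ x)
  mem_D_iff x v := by
    rw [η.mem_D_iff]
    simp [(hμ0 x).ne']
  pos x v hv := by
    rw [η.d_smul_form hμ, (η.mem_D_iff x _).1 v.2, (η.mem_D_iff x _).1 (C.J x v).2]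
    have := mul_pos (hμ0 x) (η.pos x v hv)
    linarith

variable {η η' : PositiveContactForm C}

/-- Positive contact forms of a CR structure are proportional. -/
lemma exists_factor (η η' : PositiveContactForm C) : ∃ μ : M → ℝ, IsSmoothFun (E := E3) μ ∧
    (∀ x, 0 < μ x) ∧ ∀ x, η'.form x = μ x • η.form x := by
  have h : ∀ x, ∃ c : ℝ, η'.form x = c • η.form x := by
    intro x
    obtain ⟨t, ht⟩ : ∃ t, η.form x t ≠ 0 := by
      by_contra hcon
      push Not at hcon
      exact η.form_ne_zero x (by ext t; exact hcon t)
    refine ⟨η'.form x t / η.form x t, ?_⟩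
    ext w
    -- Subtracting a multiple of t moves w into ker η = D = ker η'.
    have hw : w - (η.form x w / η.form x t) • t ∈ C.D x := by
      rw [η.mem_D_iff]
      simp [ht]
    rw [η'.mem_D_iff, map_sub, map_smul, smul_eq_mul, sub_eq_zero] at hw
    rw [hw, smul_apply, smul_eq_mul]
    ring
  choose μ hμ using h
  have hs : IsSmoothFun (E := E3) μ := fun x =>
    contMDiffAt_of_smul_eq (η.smoothAt_form x) (η'.smoothAt_form x) (Eventually.of_forall hμ)
      (η.form_ne_zero x)
  refine ⟨μ, hs, fun x => ?_, hμ⟩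
  have := C.nontrivial_D x
  obtain ⟨v, hv⟩ := exists_ne (0 : C.D x)
  -- On D the dμ terms of d(μη) vanish, so dη' = μ dη there, and positivity of both forms on (v, Jv)
  -- gives the sign of μ.
  have h1 := η'.pos x v hv
  have h2 : η'.form = fun x => μ x • η.form x := funext hμ
  rw [h2, η.d_smul_form hs, (η.mem_D_iff x _).1 v.2, (η.mem_D_iff x _).1 (C.J x v).2] at h1
  have h3 : 0 < μ x * η.form.d x v (C.J x v) := by linarith
  exact pos_of_mul_pos_left h3 (η.pos x v hv).le

/-- The relation of the coframes with the same first direction, adapted to proportional contact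
forms. -/
lemma exists_map_eq {μ : M → ℝ} (hμ : IsSmoothFun (E := E3) μ) (hμ0 : ∀ x, 0 < μ x)
    (h : ∀ x, η'.form x = μ x • η.form x) (u : η.CircleBundle) (u' : η'.CircleBundle)
    (huu' : η'.toSpherization u' = η.toSpherization u) :
    ∃ P Q : ℝ, ∀ v : E3,
      u'.1.map v 0 = √(μ u.1.pt) * u.1.map v 0 + P * u.1.map v 2 ∧
      u'.1.map v 1 = √(μ u.1.pt) * u.1.map v 1 + Q * u.1.map v 2 ∧
      u'.1.map v 2 = √(μ u.1.pt) * √(μ u.1.pt) * u.1.map v 2 := by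
  obtain ⟨⟨x, m⟩, hm⟩ := u
  obtain ⟨⟨x', m'⟩, hm'⟩ := u'
  obtain rfl : x' = x := congrArg CRStructure.Spherization.pt huu'
  let U : η.CircleBundle := ⟨⟨x', m⟩, hm⟩
  let U' : η'.CircleBundle := ⟨⟨x', m'⟩, hm'⟩
  have hr : rayOfNeZero ℝ U'.firstVector U'.firstVector_ne_zero
      = rayOfNeZero ℝ U.firstVector U.firstVector_ne_zero := by
    simpa [toSpherization] using huu'
  rw [ray_eq_iff] at hr
  obtain ⟨r, hr, hrv⟩ := hr.symm.exists_pos_left U.firstVector_ne_zero U'.firstVector_ne_zero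
  have hd : ∀ v w, η'.form.d x' v w = dFun (E := E3) μ x' v * η.form x' w
      - dFun (E := E3) μ x' w * η.form x' v + μ x' * η.form.d x' v w := by
    intro v w
    rw [show η'.form = fun x => μ x • η.form x from funext h]
    exact η.d_smul_form hμ x' v w
  have hD : ∀ v : C.D x', η.form x' v = 0 := fun v => (η.mem_D_iff x' v).1 v.2
  let a : C.D x' := U.firstVector
  let a' : C.D x' := U'.firstVector
  have haa' : a' = r • a := hrv.symm
  have k1 : η.form.d x' a (C.J x' a) = 1 := by
    have := hm.metric a a
    have h0 : m (a : TangentSpace 𝓘(ℝ, E3) x') = Pi.single 0 1 := U.map_firstVector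
    rw [this]
    change m (a : TangentSpace 𝓘(ℝ, E3) x') 0 * m (a : TangentSpace 𝓘(ℝ, E3) x') 0
      + m (a : TangentSpace 𝓘(ℝ, E3) x') 1 * m (a : TangentSpace 𝓘(ℝ, E3) x') 1 = 1
    rw [h0]
    simp
  have k2 : η'.form.d x' a' (C.J x' a') = 1 := by
    have := hm'.metric a' a'
    have h0 : m' (a' : TangentSpace 𝓘(ℝ, E3) x') = Pi.single 0 1 := U'.map_firstVector
    rw [this]
    change m' (a' : TangentSpace 𝓘(ℝ, E3) x') 0 * m' (a' : TangentSpace 𝓘(ℝ, E3) x') 0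
      + m' (a' : TangentSpace 𝓘(ℝ, E3) x') 1 * m' (a' : TangentSpace 𝓘(ℝ, E3) x') 1 = 1
    rw [h0]
    simp
  have hJ : C.J x' a' = r • C.J x' a := by rw [haa', map_smul]
  -- Both first vectors have unit length, the new one for dη'(·, J·) = μ dη(·, J·) on D; hence r =
  -- 1/√μ.
  have k3 : r * r * μ x' = 1 := by
    rw [hd, hD, hD, hJ, haa'] at k2
    simp only [Submodule.coe_smul, map_smul, LinearMap.smul_apply, smul_eq_mul, k1] at k2
    linarith
  have hsq : √(μ x') * √(μ x') = μ x' := Real.mul_self_sqrt (hμ0 x').le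
  have hρ : 0 < √(μ x') := Real.sqrt_pos.2 (hμ0 x')
  have k4 : r * μ x' = √(μ x') := by
    have h1 : r * √(μ x') = 1 := by
      have h0 : 0 < r * √(μ x') := mul_pos hr hρ
      have : (r * √(μ x')) ^ 2 = 1 := by rw [mul_pow, pow_two, pow_two, hsq, k3]
      nlinarith
    linear_combination (√(μ x')) * h1 - r * hsq
  have e := fun w => η.map_eq_of_first hm a U.map_firstVector w
  have e' := fun w => η'.map_eq_of_first hm' a' U'.map_firstVector w
  -- Insert a' = r a into the formulas expressing an adapted coframe by its first vector. Since η
  -- vanishes on D, one dμ term survives in each of the first two components; it is a multiple of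
  -- η(v) and supplies P = -r dμ(Ja), respectively Q = r dμ(a).
  have main : ∀ v : TangentSpace 𝓘(ℝ, E3) x',
      m' v 0 = √(μ x') * m v 0 + -(r * dFun (E := E3) μ x' (C.J x' a)) * m v 2 ∧
      m' v 1 = √(μ x') * m v 1 + r * dFun (E := E3) μ x' a * m v 2 ∧
      m' v 2 = √(μ x') * √(μ x') * m v 2 := by
    intro v
    have e0 : m v 0 = η.form.d x' v (C.J x' a) := congrFun (e v) 0
    have e1 : m v 1 = η.form.d x' a v := congrFun (e v) 1
    have e2 : m v 2 = η.form x' v := congrFun (e v) 2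
    have e0' : m' v 0 = η'.form.d x' v (C.J x' a') := congrFun (e' v) 0
    have e1' : m' v 1 = η'.form.d x' a' v := congrFun (e' v) 1
    have e2' : m' v 2 = η'.form x' v := congrFun (e' v) 2
    refine ⟨?_, ?_, ?_⟩
    · rw [e0, e2, e0', hJ, Submodule.coe_smul, map_smul, hd, hD, ← k4, smul_eq_mul]
      ring
    · rw [e1, e2, e1', haa', Submodule.coe_smul, map_smul, LinearMap.smul_apply, hd, hD, ← k4,
        smul_eq_mul]
      ring
    · rw [e2, e2', hsq, h]
      rfl
  exact ⟨_, _, main⟩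

lemma IsWebster.structureForms {α : OneForm E4 η.CircleBundle} {K : η.CircleBundle → ℝ}
    (h : η.IsWebster α K) : StructureForms (η.tautological 0) (η.tautological 1)
      (η.tautological 2) α K := by
  obtain ⟨a₁, a₂, b₁, b₂, h1, h2⟩ := h
  refine ⟨smoothAt_tautological 0, smoothAt_tautological 1, smoothAt_tautological 2,
    OneForm.isSmooth_iff.1 h1.smooth_α, fun u => ⟨a₁ u, a₂ u, b₁ u, b₂ u, fun v w => ?_⟩⟩
  have h3 := (firstStructureEquation_iff.1 h1).2.2.2
  exact ⟨(h3.1 u).d_ω₁ v w, (h3.1 u).d_ω₂ v w, h3.2 u v w,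
    (secondStructureEquation_iff.1 h2).2.2.2 u v w⟩

/-- These are the first three vectors of the basis dual to ω₀, ω₁, ω₂, α. They are chosen pointwise,
which suffices for the transformation law. -/
lemma IsWebster.exists_dual {α : OneForm E4 η.CircleBundle} {K : η.CircleBundle → ℝ}
    (h : η.IsWebster α K) (u : η.CircleBundle) : ∃ e : Fin 3 → TangentSpace 𝓘(ℝ, E4) u,
      (∀ j, η.tautological 0 u (e j) = if j = 0 then 1 else 0) ∧
      (∀ j, η.tautological 1 u (e j) = if j = 1 then 1 else 0) ∧
      (∀ j, η.tautological 2 u (e j) = if j = 2 then 1 else 0) ∧ ∀ j, α u (e j) = 0 := by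
  obtain ⟨a₁, a₂, b₁, b₂, h1, h2⟩ := h
  obtain ⟨b, hb⟩ := exists_dual_basis (finrank_tangentSpace_E4 u)
    (LinearMap.pi ![(η.tautological 0 u).toLinearMap, (η.tautological 1 u).toLinearMap,
      (η.tautological 2 u).toLinearMap, (α u).toLinearMap]) (by
    intro w hw
    refine h1.eq_zero (fun i => ?_) (congrFun hw 3)
    fin_cases i
    · exact congrFun hw 0
    · exact congrFun hw 1
    · exact congrFun hw 2)
  refine ⟨fun j => b j.castSucc, fun j => ?_, fun j => ?_, fun j => ?_, fun j => ?_⟩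
  · exact (hb j.castSucc 0).trans (by fin_cases j <;> simp)
  · exact (hb j.castSucc 1).trans (by fin_cases j <;> simp [Fin.ext_iff])
  · exact (hb j.castSucc 2).trans (by fin_cases j <;> simp [Fin.ext_iff])
  · exact (hb j.castSucc 3).trans (by fin_cases j <;> simp [Fin.ext_iff])

/-- The identification of the circle bundles of two contact forms. -/
def change (η η' : PositiveContactForm C) : η.CircleBundle → η'.CircleBundle :=
  η'.equivSpherization.symm ∘ η.equivSpherization

lemma contMDiff_change : ContMDiff 𝓘(ℝ, E4) 𝓘(ℝ, E4) ∞ (change η η') :=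
  contMDiff_equivSpherization_symm.comp contMDiff_equivSpherization

lemma toSpherization_change (u : η.CircleBundle) :
    η'.toSpherization (change η η' u) = η.toSpherization u :=
  η'.equivSpherization.apply_symm_apply _

/-- The identification covers the identity of M, because it preserves the ray and hence its base
point. -/
lemma mfderiv_proj_change (u : η.CircleBundle) (w : TangentSpace 𝓘(ℝ, E4) u) :
    (mfderiv 𝓘(ℝ, E4) 𝓘(ℝ, E3) (CircleBundle.proj (η := η')) (change η η' u)
      (mfderiv 𝓘(ℝ, E4) 𝓘(ℝ, E4) (change η η') u w) : E3)
      = mfderiv 𝓘(ℝ, E4) 𝓘(ℝ, E3) (CircleBundle.proj (η := η)) u w := by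
  have h : CircleBundle.proj (η := η') ∘ change η η' = CircleBundle.proj (η := η) := by
    funext z
    exact congrArg CRStructure.Spherization.pt (toSpherization_change z)
  have h2 := mfderiv_comp u ((contMDiff_proj (η := η') _).mdifferentiableAt (by simp))
    ((contMDiff_change (η := η) (η' := η') u).mdifferentiableAt (by simp))
  have h3 := congrArg (fun φ : η.CircleBundle → M =>
    (mfderiv 𝓘(ℝ, E4) 𝓘(ℝ, E3) φ u w : E3)) h
  exact (congrArg (fun L => L w) h2).symm.trans h3

/-- By the preceding lemma, the pulled back tautological forms and the original ones apply two
coframes to the same vector dπ(w), so the algebraic relation between those coframes carries over. -/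
lemma exists_pullback_change {μ : M → ℝ} (hμ : IsSmoothFun (E := E3) μ) (hμ0 : ∀ x, 0 < μ x)
    (h : ∀ x, η'.form x = μ x • η.form x) (u : η.CircleBundle) :
    ∃ P Q : ℝ,
      (η'.tautological 0).pullback (change η η') u
        = √(μ (CircleBundle.proj u)) • η.tautological 0 u + P • η.tautological 2 u ∧
      (η'.tautological 1).pullback (change η η') u
        = √(μ (CircleBundle.proj u)) • η.tautological 1 u + Q • η.tautological 2 u ∧
      (η'.tautological 2).pullback (change η η') u
        = (√(μ (CircleBundle.proj u)) * √(μ (CircleBundle.proj u))) • η.tautological 2 u := by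
  obtain ⟨P, Q, hPQ⟩ := exists_map_eq hμ hμ0 h u (change η η' u) (toSpherization_change u)
  have key : ∀ i w, (η'.tautological i).pullback (change η η') u w
      = (change η η' u).1.map (mfderiv 𝓘(ℝ, E4) 𝓘(ℝ, E3)
        (CircleBundle.proj (η := η)) u w : E3) i := by
    intro i w
    rw [← mfderiv_proj_change (η' := η') u w]
    rfl
  refine ⟨P, Q, ?_, ?_, ?_⟩
  · ext w
    exact (key 0 w).trans (hPQ _).1
  · ext w
    exact (key 1 w).trans (hPQ _).2.1
  · ext w
    exact (key 2 w).trans (hPQ _).2.2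

/-- The identification of the circle bundles was defined through SD, so composing it with the
inverse of h for η gives the inverse of h for η'. -/
lemma toSD_pullback_change {τ : OneForm E4 η'.CircleBundle} :
    toSD (τ.pullback (change η η') : OneForm E4 η.CircleBundle) = toSD τ := by
  unfold toSD
  rw [OneForm.pullback_comp contMDiff_change contMDiff_equivSpherization_symm]
  congr 1
  funext r
  simp [change]

/-- The induced metrics of proportional contact forms are proportional. -/
theorem inducedMetric_smul {μ : M → ℝ} (hμ : IsSmoothFun (E := E3) μ) (hμ0 : ∀ x, 0 < μ x)
    (h : ∀ x, η'.form x = μ x • η.form x) {α : OneForm E4 η.CircleBundle}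
    {K : η.CircleBundle → ℝ} {α' : OneForm E4 η'.CircleBundle} {K' : η'.CircleBundle → ℝ}
    (hw : η.IsWebster α K) (hw' : η'.IsWebster α' K') (r : C.Spherization) :
    η'.inducedMetric α' K' r = μ r.pt • η.inducedMetric α K r := by
  -- No regularity of P and Q is recorded by this choice; the transformation law recovers it.
  choose P Q h0 h1 h2 using exists_pullback_change hμ hμ0 h
  choose e he0 he1 he2 heα using hw.exists_dual
  have hρ : ∀ u : η.CircleBundle, ContMDiffAt 𝓘(ℝ, E4) 𝓘(ℝ) ∞
      (fun u : η.CircleBundle => √(μ (CircleBundle.proj u))) u := fun u =>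
    (Real.contDiffAt_sqrt (hμ0 _).ne').contMDiffAt.comp u
      ((hμ _).comp u (contMDiff_proj u))
  have hρ0 : ∀ u : η.CircleBundle, 0 < √(μ (CircleBundle.proj u)) := fun u =>
    Real.sqrt_pos.2 (hμ0 _)
  have T := hw.structureForms.transformation (hw'.structureForms.pullback contMDiff_change)
    hρ hρ0 h0 h1 h2 (e := fun j u => e u j) he0 he1 he2 heα
  have hr : CircleBundle.proj (η.equivSpherization.symm r) = r.pt :=
    congrArg CRStructure.Spherization.pt (η.equivSpherization.apply_symm_apply r)
  have hK : K' (change η η' (η.equivSpherization.symm r)) = K' (η'.equivSpherization.symm r) := by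
    simp [change]
  have T' : ∀ w : TangentSpace 𝓘(ℝ, E4) r, μ r.pt * toSD (η'.sigma α' K') r w
      = μ r.pt * toSD (η.sigma α K) r w - 2 * √(μ r.pt) *
        (P (η.equivSpherization.symm r) * toSD (η.tautological 0) r w
          + Q (η.equivSpherization.symm r) * toSD (η.tautological 1) r w)
        - (P (η.equivSpherization.symm r) ^ 2 + Q (η.equivSpherization.symm r) ^ 2)
          * toSD (η.tautological 2) r w := by
    intro w
    have := T (η.equivSpherization.symm r)
      (mfderiv 𝓘(ℝ, E4) 𝓘(ℝ, E4) η.equivSpherization.symm r w)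
    rw [hr, Real.sq_sqrt (hμ0 _).le, hK] at this
    have e1 : toSD (η'.sigma α' K') r w = 4 / 3 * toSD α' r w
      - 1 / 3 * K' (η'.equivSpherization.symm r) * toSD (η'.tautological 2) r w := rfl
    rw [e1, ← toSD_pullback_change (η := η) (τ := α'),
      ← toSD_pullback_change (η := η) (τ := η'.tautological 2)]
    exact this
  have z0 : ∀ w, toSD (η'.tautological 0) r w = √(μ r.pt) * toSD (η.tautological 0) r w
      + P (η.equivSpherization.symm r) * toSD (η.tautological 2) r w := by
    intro w
    rw [← toSD_pullback_change (η := η), toSD_apply, h0, hr]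
    rfl
  have z1 : ∀ w, toSD (η'.tautological 1) r w = √(μ r.pt) * toSD (η.tautological 1) r w
      + Q (η.equivSpherization.symm r) * toSD (η.tautological 2) r w := by
    intro w
    rw [← toSD_pullback_change (η := η), toSD_apply, h1, hr]
    rfl
  have z2 : ∀ w, toSD (η'.tautological 2) r w = μ r.pt * toSD (η.tautological 2) r w := by
    intro w
    rw [← toSD_pullback_change (η := η), toSD_apply, h2, hr, Real.mul_self_sqrt (hμ0 _).le]
    rfl
  have hsq := Real.mul_self_sqrt (hμ0 r.pt).le
  ext v w
  rw [inducedMetric_eq, z0, z0, z1, z1, z2, z2, LinearMap.smul_apply, LinearMap.smul_apply,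
    smul_eq_mul, inducedMetric_eq]
  -- Expanding τ₀² + τ₁² produces 2ρω₂ · (Pω₀ + Qω₁) + (P² + Q²)ω₂²; the transformation law for σ,
  -- multiplied by ω₂ and symmetrized in v and w, removes exactly these terms. The last summand
  -- replaces √μ · √μ by μ.
  linear_combination (1 / 2 * toSD (η.tautological 2) r v) * T' w
    + (1 / 2 * toSD (η.tautological 2) r w) * T' v
    + (toSD (η.tautological 0) r v * toSD (η.tautological 0) r w
      + toSD (η.tautological 1) r v * toSD (η.tautological 1) r w) * hsq

end PositiveContactForm

end FeffermanCR

end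

theorem mainTheorem8 {M : Type*} [TopologicalSpace M] [ChartedSpace E3 M]
    [IsManifold 𝓘(ℝ, E3) ∞ M] (C : CRStructure M) :
    -- the circle bundle `B`, its identification with `SD`, the forms and functions given by the
    -- structure equations, and the induced Lorentzian metric are well defined
    (∀ η : PositiveContactForm C,
      ContMDiff 𝓘(ℝ, E4) 𝓘(ℝ, E3) ∞ (PositiveContactForm.CircleBundle.proj (η := η)) ∧
      (∀ i, (η.tautological i).IsSmooth) ∧
      ContMDiff 𝓘(ℝ, E4) 𝓘(ℝ, E4) ∞ η.equivSpherization ∧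
      ContMDiff 𝓘(ℝ, E4) 𝓘(ℝ, E4) ∞ η.equivSpherization.symm ∧
      (∃! p : OneForm E4 η.CircleBundle × (η.CircleBundle → ℝ) × (η.CircleBundle → ℝ),
        η.FirstStructureEquation p.1 p.2.1 p.2.2) ∧
      (∀ α a₁ a₂, η.FirstStructureEquation α a₁ a₂ →
        ∃! q : (η.CircleBundle → ℝ) × (η.CircleBundle → ℝ) × (η.CircleBundle → ℝ),
          η.SecondStructureEquation α q.1 q.2.1 q.2.2) ∧
      (∀ α K, η.IsWebster α K → (η.inducedMetric α K).IsLorentzian)) ∧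
    -- the conformal class of the induced metric does not depend on the contact form
    (∀ (η η' : PositiveContactForm C) (α : OneForm E4 η.CircleBundle) (K : η.CircleBundle → ℝ)
      (α' : OneForm E4 η'.CircleBundle) (K' : η'.CircleBundle → ℝ),
      η.IsWebster α K → η'.IsWebster α' K' →
      ConformallyEquivalent (η.inducedMetric α K) (η'.inducedMetric α' K')) ∧
    -- multiplying the contact form by a positive function multiplies the induced metric by it
    (∀ (η : PositiveContactForm C) (μ : M → ℝ), IsSmoothFun (E := E3) μ → (∀ x, 0 < μ x) →
      (∃ η' : PositiveContactForm C, ∀ x, η'.form x = μ x • η.form x) ∧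
      ∀ η' : PositiveContactForm C, (∀ x, η'.form x = μ x • η.form x) →
        ∀ (α : OneForm E4 η.CircleBundle) (K : η.CircleBundle → ℝ)
          (α' : OneForm E4 η'.CircleBundle) (K' : η'.CircleBundle → ℝ),
          η.IsWebster α K → η'.IsWebster α' K' →
          ∀ r : C.Spherization, η'.inducedMetric α' K' r = μ r.pt • η.inducedMetric α K r) := by
  refine ⟨fun η => ⟨PositiveContactForm.contMDiff_proj,
    fun i => OneForm.isSmooth_iff.2 (PositiveContactForm.smoothAt_tautological i),
    PositiveContactForm.contMDiff_equivSpherization,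
    PositiveContactForm.contMDiff_equivSpherization_symm, η.existsUnique_first,
    fun α a₁ a₂ h => h.existsUnique_second,
    fun α K h => PositiveContactForm.isLorentzian_inducedMetric h⟩, ?_, ?_⟩
  · intro η η' α K α' K' h h'
    obtain ⟨μ, hμ, hμ0, hη⟩ := η.exists_factor η'
    refine ⟨fun r => μ r.pt, ?_, fun r => hμ0 _, fun r =>
      PositiveContactForm.inducedMetric_smul hμ hμ0 hη h h' r⟩
    -- Smoothness is available for the projection of B, so the projection of SD is factored through
    -- the inverse of h.
    have hpt : (fun r : C.Spherization => μ r.pt)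
        = fun r => μ (PositiveContactForm.CircleBundle.proj (η.equivSpherization.symm r)) := by
      funext r
      exact congrArg (fun z : C.Spherization => μ z.pt)
        (η.equivSpherization.apply_symm_apply r).symm
    unfold IsSmoothFun
    rw [hpt]
    exact hμ.comp (PositiveContactForm.contMDiff_proj.comp
      PositiveContactForm.contMDiff_equivSpherization_symm)
  · intro η μ hμ hμ0
    exact ⟨⟨η.smul μ hμ hμ0, fun x => rfl⟩, fun η' hη α K α' K' h h' r =>
      PositiveContactForm.inducedMetric_smul hμ hμ0 hη h h' r⟩
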